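/- **Asymptotics of the prices.** Let $S=\{-1,1\}$, let $\rho$ be a finite measure on $S$, and let $q:(0,\infty)\times S\to[0,\infty)$ be measurable, such that $q(r,\cdot)$ converges in $L^1(\rho)$ to a nonnegative $\rho$-integrable function as $r\downarrow 0$. Assume: * $q$ is bounded; for $\rho$-a.e. $\xi$ the finite limit $q(0+,\xi)=\lim_{r\downarrow0}q(r,\xi)$ exists; and $\int_S\rho(d\xi)\int_0^1|q(r,\xi)-q(0+,\xi)|\,r^{-1}dr<\infty$; * $q(0+,1)=0$, and $q(r,1)=O(e^{-\delta_0 r})$ as $r\to\infty$ for some $\delta_0>1$; * $\rho(\{-1\})>0$ and $q(0+,-1)>0$. For $\alpha\in(3/2,2)$ let $$\nu_\alpha(B)=(2-\alpha)\int_S\rho(d\xi)\int_0^\infty 1_B(r\xi)\frac{q(r,\xi)}{r^{\alpha+1}}dr,\qquad m_\alpha=-\int_{\mathbb R}\bigl(e^x-1-x1_{\{|x|<1\}}\bigr)\nu_\alpha(dx),$$ and let $X^\alpha$ be a real Lévy process with $X^\alpha_0=0$ and triplet $(m_\alpha,0,\nu_\alpha)$ (with truncation function $x1_{\{|x|<1\}}$),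 i.e. $$E\bigl[e^{izX^\alpha_1}\bigr]=\exp\Bigl(im_\alpha z+\int_{\mathbb R}\bigl(e^{izx}-1-izx1_{\{|x|<1\}}\bigr)\nu_\alpha(dx)\Bigr),\qquad z\in\mathbb R.$$ Let $\Sigma=\int_S\xi^2q(0+,\xi)\rho(d\xi)=q(0+,-1)\rho(\{-1\})$, let $X_t=-\frac{\Sigma}{2}t+\sqrt{\Sigma}\,B_t$ with $B$ a standard Brownian motion, and let $g_t(w)=E[e^{iwX_t}]$ for $w\in\mathbb C$. Let $\Phi$ be the standard normal distribution function and $$C_{\mathrm{BS}}(t,K,\sigma)=\Phi\Bigl(\tfrac{\log(1/K)+\sigma^2t/2}{\sigma\sqrt t}\Bigr)-K\,\Phi\Bigl(\tfrac{\log(1/K)-\sigma^2t/2}{\sigma\sqrt t}\Bigr).$$ With the principal logarithm, Euler's constant $\gamma_E$ and $s=\delta+iz$, put $$\begin{aligned}C(z,\delta)={}&\Sigma\Bigl\{-\tfrac12s^2\log s+\tfrac{3-2\gamma_E}{4}s^2-\tfrac{3-2\gamma_E}{4}s\Bigr\}\\&+\int_S\rho(d\xi)\int_0^\infty\bigl(e^{sr\xi}-1-sr\xi1_{(0,1)}(r)\bigr)\frac{q(r,\xi)-q(0+,\xi)}{r^3}dr\\&-s\int_S\rho(d\xi)\int_0^\infty\bigl(e^{r\xi}-1-r\xi1_{(0,1)}(r)\bigr)\frac{q(r,\xi)-q(0+,\xi)}{r^3}dr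 .\end{aligned}$$ Then for all $t,K>0$ the integrals defining $E[(e^{X^\alpha_t}-K)_+]$, $C(z,0)$ and $C(z,1)$, and $$A_{\mathrm{call}}(t,K)=\frac1{2\pi}\int_{-\infty}^\infty e^{-iz\log K}\,\frac{g_t(z-i)\,tC(z,1)}{-z^2+iz}\,dz,\qquad A_{\mathrm{dig}}(t,K)=\frac1\pi\int_0^\infty\Re\Bigl[e^{-iz\log K}\,\frac{g_t(z)\,tC(z,0)}{iz}\Bigr]dz$$ converge absolutely, and as $\alpha\uparrow2$ $$E\bigl[(e^{X^\alpha_t}-K)_+\bigr]-C_{\mathrm{BS}}(t,K,\sqrt\Sigma)=(2-\alpha)A_{\mathrm{call}}(t,K)+o(2-\alpha),$$ $$P\bigl(e^{X^\alpha_t}\ge K\bigr)-P\bigl(e^{X_t}\ge K\bigr)=(2-\alpha)A_{\mathrm{dig}}(t,K)+o(2-\alpha).$$ -/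

import Mathlib

open MeasureTheory ProbabilityTheory Filter Topology Set
open scoped NNReal ENNReal

noncomputable section

namespace GTS

/-- The unit sphere `S = {-1, 1}` of `ℝ`. -/
abbrev Sph : Type := Metric.sphere (0 : ℝ) 1

/-- The direction `1`. -/
def posDir : Sph := ⟨1, by simp⟩

/-- The direction `-1`. -/
def negDir : Sph := ⟨-1, by simp⟩

variable {Ω : Type*} [MeasurableSpace Ω]

/-- A real-valued Lévy process. -/
structure IsLevyProcess (X : ℝ≥0 → Ω → ℝ) (P : Measure Ω) : Prop where
  measurable : ∀ t, Measurable (X t)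
  zero : ∀ᵐ ω ∂P, X 0 ω = 0
  indep : HasIndepIncrements X P
  stationary : ∀ s t, IdentDistrib (X (s + t) - X s) (X t - X 0) P P
  stochCont : ∀ t, TendstoInMeasure P X (𝓝 t) (X t)
  cadlag : ∀ᵐ ω ∂P, ∀ t, ContinuousWithinAt (fun s => X s ω) (Ici t) t ∧
    ∃ l, Tendsto (fun s => X s ω) (𝓝[<] t) (𝓝 l)

/-- The process `X` has generating triplet `(m, V, ν)`, relative to the truncation function
`x ↦ x 1_{|x| < 1}`: the law of `X₁` has the Lévy–Khintchine characteristic function. -/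
structure HasTriplet (X : ℝ≥0 → Ω → ℝ) (P : Measure Ω) (m V : ℝ) (ν : Measure ℝ) : Prop where
  variance_nonneg : 0 ≤ V
  zero_null : ν {0} = 0
  small_jumps : ∫⁻ x, ENNReal.ofReal (min 1 (x ^ 2)) ∂ν < ⊤
  charFun_one : ∀ z : ℝ, charFun (P.map (X 1)) z =
    Complex.exp (Complex.I * m * z - V * z ^ 2 / 2 +
      ∫ x : ℝ, (Complex.exp (Complex.I * z * x) - 1
        - Complex.I * z * (({y : ℝ | |y| < 1}.indicator (fun y => y) x : ℝ) : ℂ)) ∂ν)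

/-- The measure `B ↦ ∫_S ρ(dξ) ∫₀^∞ 1_B(r ξ) q(r, ξ) r^{-α-1} dr`, as the image of
`q(r, ξ) r^{-α-1} ρ(dξ) dr` under `(ξ, r) ↦ r ξ`. -/
def levyMeasure (α : ℝ) (ρ : Measure Sph) (q : ℝ → Sph → ℝ) : Measure ℝ :=
  ((ρ.prod (volume.restrict (Ioi (0 : ℝ)))).withDensity
    (fun p => ENNReal.ofReal (q p.2 p.1 / p.2 ^ (α + 1)))).map (fun p => p.2 * (p.1 : ℝ))

/-- `q : (0, ∞) × S → [0, ∞)` is measurable and, as `r ↓ 0`, `q(r, ·)` converges in `L¹(ρ)` to a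
nonnegative `ρ`-integrable function. Values of `q` at `r ≤ 0` are irrelevant. -/
structure IsTempering (ρ : Measure Sph) (q : ℝ → Sph → ℝ) : Prop where
  measurable : Measurable (fun p : Ioi (0 : ℝ) × Sph => q p.1 p.2)
  nonneg : ∀ r, 0 < r → ∀ ξ, 0 ≤ q r ξ
  limit : ∃ p : Sph → ℝ, (∀ ξ, 0 ≤ p ξ) ∧ Integrable p ρ ∧
    Tendsto (fun r => ∫⁻ ξ, ENNReal.ofReal |q r ξ - p ξ| ∂ρ) (𝓝[>] 0) (𝓝 0)

/-- `X` is a real-valued generalized tempered stable process with parameters `(m, α, ρ, q)`. -/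
structure IsGTS (X : ℝ≥0 → Ω → ℝ) (P : Measure Ω) (m α : ℝ) (ρ : Measure Sph)
    (q : ℝ → Sph → ℝ) : Prop where
  levy : IsLevyProcess X P
  index : α ∈ Ioo (0 : ℝ) 2
  finite : IsFiniteMeasure ρ
  tempering : IsTempering ρ q
  triplet : HasTriplet X P m 0 (levyMeasure α ρ q)

/-- `q(0+, ξ)`. -/
def qZero (q : ℝ → Sph → ℝ) (ξ : Sph) : ℝ := limUnder (𝓝[>] (0 : ℝ)) (fun r => q r ξ)

/-- The conditions on `q`: boundedness, existence of `q(0+, ξ)`, and integrability of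
`|q(r, ξ) - q(0+, ξ)| / r` near `0`. -/
structure TemperingConditions (ρ : Measure Sph) (q : ℝ → Sph → ℝ) : Prop where
  bounded : ∃ M : ℝ, 0 < M ∧ ∀ r, 0 < r → ∀ ξ, q r ξ ≤ M
  limit_exists : ∀ᵐ ξ ∂ρ, ∃ l : ℝ, Tendsto (fun r => q r ξ) (𝓝[>] 0) (𝓝 l)
  integrable : ∫⁻ ξ, (∫⁻ r in Ioo (0 : ℝ) 1,
    ENNReal.ofReal (|q r ξ - qZero q ξ| / r)) ∂ρ < ⊤

/-- The drift `-∫ (eˣ - 1 - x 1_{|x| < 1}) ν(dx)`. -/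
def martingaleDrift (ν : Measure ℝ) : ℝ :=
  -∫ x : ℝ, (Real.exp x - 1 - {y : ℝ | |y| < 1}.indicator (fun y => y) x) ∂ν

/-- The tempering function `h(α) q` with `h(α) = 2 - α`. -/
def scaledTempering (q : ℝ → Sph → ℝ) (α : ℝ) : ℝ → Sph → ℝ := fun r ξ => (2 - α) * q r ξ

/-- The family `X^α`, `α ∈ (3/2, 2)`, of log-prices of the scaled pure-jump exponential Lévy
model `exp(X^α)`. -/
structure IsScaledModel (X : ℝ → ℝ≥0 → Ω → ℝ) (P : Measure Ω) (ρ : Measure Sph)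
    (q : ℝ → Sph → ℝ) : Prop where
  gts : ∀ α ∈ Ioo (3 / 2 : ℝ) 2,
    IsGTS (X α) P (martingaleDrift (levyMeasure α ρ (scaledTempering q α))) α ρ
      (scaledTempering q α)
  conditions : TemperingConditions ρ q
  qZero_pos : Tendsto (fun r => q r posDir) (𝓝[>] 0) (𝓝 0)
  decay : ∃ δ₀ : ℝ, 1 < δ₀ ∧
    (fun r => q r posDir) =O[atTop] (fun r => Real.exp (-δ₀ * r))

/-- `Σ = ∫_S ξ² q(0+, ξ) ρ(dξ)`. -/
def totalVar (ρ : Measure Sph) (q : ℝ → Sph → ℝ) : ℝ :=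
  ∫ ξ, (ξ : ℝ) * (ξ : ℝ) * qZero q ξ ∂ρ

/-- The Brownian motion with drift `m t + √v B_t`, `m = -v / 2`, where `B` is a standard Brownian
motion: the log-price in the Black–Scholes model with volatility `√v` and spot price `1`. -/
def bsLogPrice (v : ℝ) (B : ℝ≥0 → Ω → ℝ) (t : ℝ≥0) (ω : Ω) : ℝ := -(v / 2) * t + √v * B t ω

/-- The standard normal distribution function. -/
def stdNormalCDF (x : ℝ) : ℝ := cdf (gaussianReal 0 1) x

/-- The Black–Scholes call price with spot price `1` and zero interest rate. -/
def bsCall (t K σ : ℝ) : ℝ :=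
  stdNormalCDF ((Real.log (1 / K) + σ ^ 2 * t / 2) / (σ * √t))
    - K * stdNormalCDF ((Real.log (1 / K) - σ ^ 2 * t / 2) / (σ * √t))

/-- The call price `E[(e^Y - K)₊]` for the log-price `Y`. -/
def callPrice (P : Measure Ω) (Y : Ω → ℝ) (K : ℝ) : ℝ := ∫ ω, max (Real.exp (Y ω) - K) 0 ∂P

/-- The digital price `P(e^Y ≥ K)` for the log-price `Y`. -/
def digitalPrice (P : Measure Ω) (Y : Ω → ℝ) (K : ℝ) : ℝ := P.real {ω | K ≤ Real.exp (Y ω)}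

/-- The characteristic function `w ↦ E[e^{i w Y}]` at complex arguments. -/
def charFunC (P : Measure Ω) (Y : Ω → ℝ) (w : ℂ) : ℂ := complexMGF Y P (Complex.I * w)

/-- `(e^{s r ξ} - 1 - s r ξ 1_{(0,1)}(r)) (q(r, ξ) - q(0+, ξ)) / r³`. -/
def temperingIntegrand (q : ℝ → Sph → ℝ) (s : ℂ) (ξ : Sph) (r : ℝ) : ℂ :=
  (Complex.exp (s * r * (ξ : ℝ)) - 1
    - s * (((Ioo (0 : ℝ) 1).indicator (fun u => u) r : ℝ) : ℂ) * (ξ : ℝ))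
    * ((q r ξ - qZero q ξ : ℝ) : ℂ) / (r : ℂ) ^ 3

/-- `∫_S ρ(dξ) ∫₀^∞ (e^{s r ξ} - 1 - s r ξ 1_{(0,1)}(r)) (q(r, ξ) - q(0+, ξ)) r⁻³ dr`. -/
def temperingIntegral (ρ : Measure Sph) (q : ℝ → Sph → ℝ) (s : ℂ) : ℂ :=
  ∫ ξ, (∫ r in Ioi (0 : ℝ), temperingIntegrand q s ξ r) ∂ρ

/-- The function `C(z, δ)`, with the principal branch of the logarithm. -/
def cumulantCoeff (ρ : Measure Sph) (q : ℝ → Sph → ℝ) (z δ : ℝ) : ℂ :=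
  let s : ℂ := δ + Complex.I * z
  let c : ℂ := (3 - 2 * Real.eulerMascheroniConstant) / 4
  totalVar ρ q * (-(1 / 2) * s ^ 2 * Complex.log s + c * s ^ 2 - c * s)
    + temperingIntegral ρ q s - temperingIntegral ρ q 1 * s

/-- The integrand of `A_call`; `g` is the characteristic function of the Black–Scholes
log-price at time `t`. -/
def callIntegrand (ρ : Measure Sph) (q : ℝ → Sph → ℝ) (g : ℂ → ℂ) (t K z : ℝ) : ℂ :=
  Complex.exp (-Complex.I * z * Real.log K)
    * (g (z - Complex.I) * (t * cumulantCoeff ρ q z 1) / (-(z : ℂ) ^ 2 + Complex.I * z))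

/-- `A_call(t, K)`. -/
def callCoeff (ρ : Measure Sph) (q : ℝ → Sph → ℝ) (g : ℂ → ℂ) (t K : ℝ) : ℂ :=
  1 / (2 * Real.pi) * ∫ z : ℝ, callIntegrand ρ q g t K z

/-- The integrand of `A_dig`. -/
def digitalIntegrand (ρ : Measure Sph) (q : ℝ → Sph → ℝ) (g : ℂ → ℂ) (t K z : ℝ) : ℝ :=
  (Complex.exp (-Complex.I * z * Real.log K)
    * (g z * (t * cumulantCoeff ρ q z 0) / (Complex.I * z))).re

/-- `A_dig(t, K)`. -/
def digitalCoeff (ρ : Measure Sph) (q : ℝ → Sph → ℝ) (g : ℂ → ℂ) (t K : ℝ) : ℝ :=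
  1 / Real.pi * ∫ z in Ioi (0 : ℝ), digitalIntegrand ρ q g t K z

end GTS

end

/-! The drift `martingaleDrift` removes the truncation function from the exponent: the
Lévy–Khintchine kernel becomes `martKernel s x = e^{sx} - 1 - s(e^x - 1)`, which vanishes at `s = 0`
and `s = 1`. Hence `E[e^{sX_t}] = e^{tκ_α(s)}` in the strip `0 ≤ Re s ≤ 1`
(`integral_exp_eq_of_charFun_eq`, through compound Poisson approximation), where `κ_α` is
`jumpCumulant`. The Black–Scholes exponent is `κ_2(s) = Σ(s² - s)/2`.

Both price differences are Fourier integrals of `e^{tκ_α} - e^{tκ_2}`. The digital one lives on `Re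
s = 0` with multiplier `e^{-izk}/(iz)`, `k = log K` (`measureReal_Ici_sub_eq_integral`). The call is
an exponential mixture of digitals under the tilted law `e^x μ(dx)`, so it lives on `Re s = 1` with
multiplier `e^{-izk}/(-z² + iz)` (`integral_call_sub_eq`). It remains to divide by `2 - α` and let
`α ↑ 2` by dominated convergence (`expansion_integral_exp`), which needs three facts about the
cumulant.

Pointwise limit (`JumpDensity.tendsto_jumpCumulant`). The jump density is `(2-α) f(x)|x|^{-α-1}`.
Since `q(0+,1) = 0`, subtracting `Σ 1_{x<0}` from `f` leaves an excess that is small at `0`. The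
one-sided stable part has the exact cumulant `ΣΓ(3-α)(s^α - s)/(α(α-1))`; differentiating at `α = 2`
produces `s² log s` and the constant `(3-2γ_E)/4`. The excess already carries a factor `2-α`, and
its integral converges at `α = 2` because `|q - q(0+)|/r` is integrable near `0`; it gives the
tempering integrals.

Uniform error (`JumpDensity.exists_norm_jumpCumulant_sub_le`). On both lines `|κ_α - κ_2| ≤
A(2-α)|z|(1+|z|)²`; the factor `|z|` cancels the pole of the multipliers at `z = 0`.

Uniform decay (`JumpDensity.exists_re_jumpCumulant_le`). The small negative jumps force `Re κ_α ≤
c(R - |z|)` with `c`, `R` independent of `α`: the factor `2-α` is compensated by the mass `1/(2-α)`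
that `|x|^{1-α}` puts near `0`. -/

namespace GTS

/-! ### Characteristic functions of a Lévy process at all times. -/

section LevyProcess

variable {Ω : Type*} [MeasurableSpace Ω] {X : ℝ≥0 → Ω → ℝ} {P : Measure Ω}
  [IsProbabilityMeasure P]

lemma IsLevyProcess.charFun_add (h : IsLevyProcess X P) (s t : ℝ≥0) (z : ℝ) :
    charFun (P.map (X (s + t))) z = charFun (P.map (X s)) z * charFun (P.map (X t)) z := by
  have hind := h.indep.indepFun_eval_sub (r := 0) (s := s) (t := s + t) (by simp) (by simp) h.zero
  have h1 : P.map (X (s + t) - X s) = P.map (X t) := by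
    rw [(h.stationary s t).map_eq]
    refine Measure.map_congr ?_
    filter_upwards [h.zero] with ω hω
    simp [hω]
  have h2 := hind.charFun_map_add_eq_mul (h.measurable _).aemeasurable
    ((h.measurable _).sub (h.measurable _)).aemeasurable
  rw [h1] at h2
  have h3 : X s + (X (s + t) - X s) = X (s + t) := by ext; simp
  rw [h3] at h2
  rw [h2, Pi.mul_apply]

lemma IsLevyProcess.charFun_zero_time (h : IsLevyProcess X P) (z : ℝ) :
    charFun (P.map (X 0)) z = 1 := by
  rw [Measure.map_congr (g := fun _ => (0 : ℝ)) h.zero, Measure.map_const]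
  simp

lemma IsLevyProcess.charFun_nsmul (h : IsLevyProcess X P) (n : ℕ) (t : ℝ≥0) (z : ℝ) :
    charFun (P.map (X (n * t))) z = charFun (P.map (X t)) z ^ n := by
  induction n with
  | zero => simp [h.charFun_zero_time]
  | succ n ih => rw [Nat.cast_succ, add_one_mul, h.charFun_add, ih, pow_succ]

lemma IsLevyProcess.continuous_charFun (h : IsLevyProcess X P) (z : ℝ) :
    Continuous (fun t => charFun (P.map (X t)) z) := by
  rw [continuous_iff_continuousAt]
  intro t
  have h1 := ((h.stochCont t).tendstoInDistribution
    (fun i => (h.measurable i).aemeasurable)).tendsto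
  have := (ProbabilityMeasure.tendsto_iff_forall_integral_rclike_tendsto ℂ).1 h1 (BoundedContinuousFunction.innerProbChar z)
  simpa [ContinuousAt, charFun_eq_integral_innerProbChar] using this

/-- A continuous root of `exp ∘ ψ` normalized at `0` is `exp ∘ (ψ / n)`. -/
lemma eq_exp_div_of_pow_eq {φ ψ : ℝ → ℂ} (hφ : Continuous φ) (hψ : Continuous ψ)
    (hφ0 : φ 0 = 1) (hψ0 : ψ 0 = 0) {n : ℕ} (hn : n ≠ 0)
    (h : ∀ z, φ z ^ n = Complex.exp (ψ z)) (z : ℝ) : φ z = Complex.exp (ψ z / n) := by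
  -- The quotient of the two candidate roots is continuous with values in the finite set of `n`-th
  -- roots of unity, hence constant, and it equals `1` at `0`.
  set f : ℝ → ℂ := fun z => φ z * Complex.exp (-(ψ z / n)) with hf
  have hn' : (n : ℂ) ≠ 0 := by exact_mod_cast hn
  have hfn : ∀ z, f z ^ n = 1 := by
    intro z
    simp only [hf, mul_pow, h, ← Complex.exp_nat_mul, ← Complex.exp_add]
    rw [show ψ z + n * (-(ψ z / n)) = 0 by field_simp; ring, Complex.exp_zero]
  have hfin : {w : ℂ | w ^ n = 1}.Finite := by
    have : {w : ℂ | w ^ n = 1} ⊆ ((Polynomial.nthRoots n (1 : ℂ)).toFinset : Set ℂ) := by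
      intro w hw
      simpa [Polynomial.mem_nthRoots (Nat.pos_of_ne_zero hn)] using hw
    exact (Finset.finite_toSet _).subset this
  have hc : f z = f 0 := by
    refine isPreconnected_univ.constant_of_mapsTo (T := {w : ℂ | w ^ n = 1}) hfin.isDiscrete
      (by fun_prop) (fun x _ => hfn x) (mem_univ _) (mem_univ _)
  simp only [hf, hφ0, hψ0] at hc
  have hc' : φ z * Complex.exp (-(ψ z / n)) = 1 := by simpa using hc
  rw [Complex.exp_neg] at hc'
  field_simp [Complex.exp_ne_zero] at hc'
  exact hc'

/-- The characteristic function of a Lévy process at time `t`. -/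
lemma IsLevyProcess.charFun_eq (h : IsLevyProcess X P) {ψ : ℝ → ℂ} (hψ : Continuous ψ)
    (hψ0 : ψ 0 = 0) (h1 : ∀ z, charFun (P.map (X 1)) z = Complex.exp (ψ z)) (t : ℝ≥0) (z : ℝ) :
    charFun (P.map (X t)) z = Complex.exp (t * ψ z) := by
  have hprob : ∀ t, IsProbabilityMeasure (P.map (X t)) := fun t =>
    Measure.isProbabilityMeasure_map (h.measurable t).aemeasurable
  have key : ∀ m n : ℕ, charFun (P.map (X (m * (1 / (n + 1 : ℕ))))) z
      = Complex.exp ((m * (1 / (n + 1 : ℕ)) : ℝ≥0) * ψ z) := by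
    intro m n
    have hroot := eq_exp_div_of_pow_eq (φ := charFun (P.map (X (1 / (n + 1 : ℕ))))) (ψ := ψ)
      (n := n + 1) (by fun_prop) hψ (by simp) hψ0 n.succ_ne_zero
      (fun y => by
        rw [← h.charFun_nsmul, ← h1]
        congr 3
        field_simp) z
    rw [h.charFun_nsmul, hroot, ← Complex.exp_nat_mul]
    congr 1
    push_cast
    field_simp
  have hcont2 : Continuous (fun t : ℝ≥0 => Complex.exp (t * ψ z)) := by fun_prop
  -- The formula is known at rational times; `⌊t(n+1)⌋/(n+1)` approaches `t`, and stochastic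
  -- continuity makes the characteristic function continuous in time.
  have hseq : Tendsto (fun n : ℕ => ((⌊t * (n + 1 : ℕ)⌋₊ : ℝ≥0) * (1 / (n + 1 : ℕ)))) atTop
      (𝓝 t) := by
    have := (tendsto_nat_floor_mul_div_atTop (R := ℝ) t.2).comp (tendsto_natCast_atTop_atTop.comp
      (tendsto_add_atTop_nat 1))
    rw [← NNReal.tendsto_coe]
    refine this.congr fun n => ?_
    simp only [Function.comp, NNReal.coe_mul, NNReal.coe_natCast, NNReal.coe_div, NNReal.coe_one]
    rw [mul_one_div]
    congr 2
  refine tendsto_nhds_unique (((h.continuous_charFun z).tendsto t).comp hseq) ?_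
  refine ((hcont2.tendsto t).comp hseq).congr fun n => ?_
  simp only [Function.comp]
  rw [key]

end LevyProcess

/-! ### Fourier inversion for tails of probability measures. -/

section Inversion

open Complex (I)
open scoped FourierTransform

/-- Averaging `e^{-izx}` times the characteristic function against a centred Gaussian of variance
`v` gives `∫ e^{-v(y-x)²/2} μ(dy)`, which dominates the mass of the atom. The Gaussian density is at
most `(2πv)^{-1/2}`, so the average vanishes as `v → ∞`. -/
lemma measure_singleton_eq_zero_of_integrable_charFun {μ : Measure ℝ} [IsProbabilityMeasure μ]
    (h : Integrable (charFun μ)) (x : ℝ) : μ {x} = 0 := by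
  have key : ∀ v : ℝ≥0, v ≠ 0 →
      μ.real {x} ≤ (√(2 * Real.pi * v))⁻¹ * ∫ z, ‖charFun μ z‖ := by
    intro v hv
    have hF : ∀ y : ℝ, (Real.exp (-(v * (y - x) ^ 2 / 2)) : ℂ)
        = ∫ z, Complex.exp (z * ((y - x : ℝ) : ℂ) * I) ∂gaussianReal 0 v := by
      intro y
      have := charFun_gaussianReal (μ := 0) (v := v) (y - x)
      rw [charFun_apply_real] at this
      simp only [mul_comm (((y - x : ℝ) : ℂ))] at this
      rw [this]
      push_cast
      congr 1
      ring
    have h1 : ((∫ y, Real.exp (-(v * (y - x) ^ 2 / 2)) ∂μ : ℝ) : ℂ)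
        = ∫ z, Complex.exp (-(z * x * I)) * charFun μ z ∂gaussianReal 0 v := by
      rw [← integral_complex_ofReal]
      simp_rw [hF]
      rw [integral_integral_swap]
      · refine integral_congr_ae (.of_forall fun z => ?_)
        simp only [charFun_apply_real]
        rw [← integral_const_mul]
        refine integral_congr_ae (.of_forall fun y => ?_)
        simp only [← Complex.exp_add]
        congr 1
        push_cast
        ring
      · refine Integrable.of_bound (C := 1) ?_ (.of_forall fun p => ?_)
        · exact Continuous.aestronglyMeasurable (by fun_prop)
        · simp only [Function.uncurry, ← Complex.ofReal_mul, Complex.norm_exp_ofReal_mul_I, le_refl]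
    have h2 : μ.real {x} ≤ ∫ y, Real.exp (-(v * (y - x) ^ 2 / 2)) ∂μ := by
      rw [← integral_indicator_one (measurableSet_singleton x)]
      refine integral_mono ((integrable_const (1 : ℝ)).indicator (measurableSet_singleton x)) ?_ ?_
      · refine Integrable.of_bound (C := 1) (Continuous.aestronglyMeasurable (by fun_prop))
          (.of_forall fun y => ?_)
        rw [Real.norm_eq_abs, Real.abs_exp, Real.exp_le_one_iff]
        have : 0 ≤ (v : ℝ) * (y - x) ^ 2 / 2 := by positivity
        linarith
      · intro y
        by_cases hy : y = x
        · simp [hy]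
        · simp only [indicator, mem_singleton_iff, hy, if_false]
          positivity
    refine h2.trans ?_
    rw [← Complex.ofReal_re (∫ y, Real.exp (-(v * (y - x) ^ 2 / 2)) ∂μ), h1]
    refine (Complex.re_le_norm _).trans ?_
    rw [integral_gaussianReal_eq_integral_smul hv, ← integral_const_mul]
    refine norm_integral_le_of_norm_le (h.norm.const_mul _) (.of_forall fun z => ?_)
    rw [norm_smul, norm_mul, ← neg_mul, ← neg_mul, ← Complex.ofReal_neg, ← Complex.ofReal_mul,
      Complex.norm_exp_ofReal_mul_I, one_mul]
    gcongr
    rw [Real.norm_eq_abs, abs_of_nonneg (gaussianPDFReal_nonneg _ _ _), gaussianPDFReal]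
    refine mul_le_of_le_one_right (by positivity) ?_
    rw [Real.exp_le_one_iff]
    have : 0 ≤ (z - 0) ^ 2 / (2 * (v : ℝ)) := by positivity
    rw [neg_div]
    linarith
  have hlim : Tendsto (fun n : ℕ => (√(2 * Real.pi * ((n + 1 : ℕ) : ℝ≥0)))⁻¹
      * ∫ z, ‖charFun μ z‖) atTop (𝓝 0) := by
    rw [← zero_mul (∫ z, ‖charFun μ z‖)]
    refine Tendsto.mul_const _ (tendsto_inv_atTop_zero.comp (Real.tendsto_sqrt_atTop.comp ?_))
    refine Tendsto.const_mul_atTop (by positivity) ?_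
    exact (tendsto_natCast_atTop_atTop (R := ℝ)).comp (tendsto_add_atTop_nat 1)
  have hle : μ.real {x} ≤ 0 := ge_of_tendsto hlim
    (.of_forall fun n => key _ (by simp))
  have h0 : μ.real {x} = 0 := le_antisymm hle measureReal_nonneg
  rwa [measureReal_eq_zero_iff] at h0

lemma integrable_indicator_Ioc_prod (μ : Measure ℝ) [IsProbabilityMeasure μ] (h : ℝ) :
    Integrable (fun p : ℝ × ℝ => (Ioc (p.2 - h) p.2).indicator (1 : ℝ → ℂ) p.1)
      (volume.prod μ) := by
  have hm : Measurable (fun p : ℝ × ℝ => (Ioc (p.2 - h) p.2).indicator (1 : ℝ → ℂ) p.1) := by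
    have : (fun p : ℝ × ℝ => (Ioc (p.2 - h) p.2).indicator (1 : ℝ → ℂ) p.1)
        = {p : ℝ × ℝ | p.2 - h < p.1 ∧ p.1 ≤ p.2}.indicator 1 := by
      ext p
      simp [indicator, mem_Ioc]
    rw [this]
    refine Measurable.indicator (by fun_prop) ?_
    exact (measurableSet_lt (f := fun p : ℝ × ℝ => p.2 - h) (g := fun p => p.1)
      (by fun_prop) (by fun_prop)).inter
      (measurableSet_le (f := fun p : ℝ × ℝ => p.1) (g := fun p => p.2) (by fun_prop) (by fun_prop))
  rw [integrable_prod_iff' hm.aestronglyMeasurable]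
  constructor
  · refine .of_forall fun y => ?_
    exact (integrable_indicator_iff measurableSet_Ioc).2
      (show IntegrableOn (fun _ => (1 : ℂ)) (Ioc (y - h) y) volume from
        integrableOn_const (by simp))
  · refine Integrable.congr (integrable_const (volume.real (Ioc (0 - h) 0))) (.of_forall fun y => ?_)
    simp only [norm_indicator_eq_indicator_norm]
    simp [Measure.real]

lemma measureReal_Ico_eq_integral (μ : Measure ℝ) [IsProbabilityMeasure μ] (h x : ℝ) :
    (μ.real (Ico x (x + h)) : ℂ) = ∫ y, (Ioc (y - h) y).indicator (1 : ℝ → ℂ) x ∂μ := by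
  have : ∀ y, (Ioc (y - h) y).indicator (1 : ℝ → ℂ) x
      = (((Ico x (x + h)).indicator (1 : ℝ → ℝ) y : ℝ) : ℂ) := by
    intro y
    simp only [indicator, mem_Ioc, mem_Ico]
    split_ifs with h1 h2 h2
    · simp
    · exact absurd ⟨h1.2, by linarith [h1.1]⟩ h2
    · exact absurd ⟨by linarith [h2.2], h2.1⟩ h1
    · simp
  simp_rw [this]
  rw [integral_complex_ofReal, integral_indicator_one measurableSet_Ico]

/-- The window mass `x ↦ μ[x, x+h)` is the convolution of `μ` with the indicator of `(-h, 0]`, so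
its transform factorizes. Tails themselves are not integrable, which is why windows are used. -/
lemma fourier_measureReal_Ico (μ : Measure ℝ) [IsProbabilityMeasure μ] {h : ℝ} (hh : 0 < h)
    (w : ℝ) :
    𝓕 (fun x => (μ.real (Ico x (x + h)) : ℂ)) w
      = charFun μ (-2 * Real.pi * w)
        * ∫ x in (-h)..0, Complex.exp (I * ((-2 * Real.pi * w : ℝ) : ℂ) * x) := by
  set ζ : ℝ := -2 * Real.pi * w with hζ
  rw [Real.fourier_real_eq_integral_exp_smul]
  have h1 : ∀ x : ℝ, Complex.exp (((-2 * Real.pi * x * w : ℝ) : ℂ) * I)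
        • (μ.real (Ico x (x + h)) : ℂ)
      = ∫ y, Complex.exp (I * ζ * x) * (Ioc (y - h) y).indicator (1 : ℝ → ℂ) x ∂μ := by
    intro x
    rw [measureReal_Ico_eq_integral, integral_const_mul, smul_eq_mul]
    congr 2
    rw [hζ]
    push_cast
    ring
  simp_rw [h1]
  rw [integral_integral_swap]
  · rw [charFun_apply_real, ← integral_mul_const]
    refine integral_congr_ae (.of_forall fun y => ?_)
    simp only
    have h2 : ∀ x : ℝ, Complex.exp (I * ζ * x) * (Ioc (y - h) y).indicator (1 : ℝ → ℂ) x
        = (Ioc (y - h) y).indicator (fun x : ℝ => Complex.exp (I * ζ * x)) x := by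
      intro x
      simp only [indicator]
      split_ifs <;> simp
    simp_rw [h2]
    rw [integral_indicator measurableSet_Ioc,
      ← intervalIntegral.integral_of_le (by linarith), ← intervalIntegral.integral_const_mul]
    have h3 := intervalIntegral.integral_comp_add_right (a := -h) (b := 0)
      (fun x : ℝ => Complex.exp (I * ζ * x)) y
    rw [show -h + y = y - h by ring, zero_add] at h3
    rw [← h3]
    refine intervalIntegral.integral_congr fun x _ => ?_
    simp only [← Complex.exp_add]
    congr 1
    push_cast
    ring
  · refine (integrable_indicator_Ioc_prod μ h).bdd_mul (c := 1) ?_ (.of_forall fun p => ?_)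
    · exact Continuous.aestronglyMeasurable (by fun_prop)
    · rw [mul_assoc, mul_comm I, ← Complex.ofReal_mul, Complex.norm_exp_ofReal_mul_I]

lemma continuous_measureReal_Ico {μ : Measure ℝ} [IsProbabilityMeasure μ]
    (hμ : ∀ x, μ {x} = 0) (h : ℝ) :
    Continuous (fun x => (μ.real (Ico x (x + h)) : ℂ)) := by
  rw [continuous_iff_continuousAt]
  intro x
  simp_rw [measureReal_Ico_eq_integral]
  refine continuousAt_of_dominated (bound := fun _ => 1) (.of_forall fun y => ?_)
    (.of_forall fun y => .of_forall fun z => ?_) (integrable_const _) ?_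
  · have : (fun z => (Ioc (z - h) z).indicator (1 : ℝ → ℂ) y) = (Ico y (y + h)).indicator 1 := by
      ext z
      simp only [indicator, mem_Ioc, mem_Ico]
      congr 1
      simp only [eq_iff_iff]
      constructor <;> rintro ⟨h1, h2⟩ <;> constructor <;> linarith
    rw [this]
    exact (measurable_one.indicator measurableSet_Ico).aestronglyMeasurable
  · rw [norm_indicator_eq_indicator_norm]
    exact indicator_le_self' (fun _ _ => by simp) _ |>.trans (by simp)
  · have hne : ∀ a : ℝ, ∀ᵐ y ∂μ, y ≠ a := fun a => by
      rw [ae_iff]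
      simpa using hμ a
    filter_upwards [hne x, hne (x + h)] with y h1 h2
    by_cases hy : x ∈ Ioc (y - h) y
    · have : Ioo (y - h) y ∈ 𝓝 x := Ioo_mem_nhds hy.1 (lt_of_le_of_ne hy.2 (Ne.symm h1))
      refine (continuousAt_const (y := (1 : ℂ))).congr ?_
      filter_upwards [this] with z hz
      simp [indicator, hz.1, hz.2.le]
    · have : (Icc (y - h) y)ᶜ ∈ 𝓝 x := by
        refine isClosed_Icc.isOpen_compl.mem_nhds fun hx => hy ⟨lt_of_le_of_ne hx.1 ?_, hx.2⟩
        intro h3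
        exact h2 (by linarith)
      refine (continuousAt_const (y := (0 : ℂ))).congr ?_
      filter_upwards [this] with z hz
      rw [indicator_of_notMem]
      exact fun h4 => hz ⟨h4.1.le, h4.2⟩

/-- The transform is bounded by `h` times the modulus of the characteristic function, hence
integrable, and the absence of atoms makes the window mass continuous: inversion holds at every
point. The factor `1/(2π)` is the Jacobian of `w ↦ -2πw`. -/
lemma measureReal_Ico_eq_fourier {μ : Measure ℝ} [IsProbabilityMeasure μ]
    (hμ : Integrable (charFun μ)) {h : ℝ} (hh : 0 < h) (k : ℝ) :
    (μ.real (Ico k (k + h)) : ℂ) = 1 / (2 * Real.pi) * ∫ z : ℝ, Complex.exp (-I * z * k)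
      * (charFun μ z * ∫ x in (-h)..0, Complex.exp (I * z * x)) := by
  have hbd : ∀ z : ℝ, ‖∫ x in (-h)..0, Complex.exp (I * (z : ℂ) * x)‖ ≤ h := by
    intro z
    have := intervalIntegral.norm_integral_le_of_norm_le_const (a := -h) (b := 0) (C := 1)
      (f := fun x : ℝ => Complex.exp (I * (z : ℂ) * x)) (fun x _ => by
        rw [mul_assoc, mul_comm I, ← Complex.ofReal_mul, Complex.norm_exp_ofReal_mul_I])
    simpa [abs_of_pos hh] using this
  have hBm : Continuous (fun z : ℝ => ∫ x in (-h)..0, Complex.exp (I * (z : ℂ) * x)) := by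
    exact intervalIntegral.continuous_parametric_intervalIntegral_of_continuous'
      (by fun_prop) _ _
  have hint : Integrable (fun z : ℝ => charFun μ z * ∫ x in (-h)..0, Complex.exp (I * z * x)) :=
    hμ.mul_bdd (c := h) hBm.aestronglyMeasurable (.of_forall hbd)
  have hF : Integrable (fun x => (μ.real (Ico x (x + h)) : ℂ)) := by
    simp_rw [measureReal_Ico_eq_integral]
    exact (integrable_indicator_Ioc_prod μ h).integral_prod_left
  have hFF : 𝓕 (fun x => (μ.real (Ico x (x + h)) : ℂ)) = fun w => (fun z : ℝ => charFun μ z *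
      ∫ x in (-h)..0, Complex.exp (I * z * x)) (-2 * Real.pi * w) :=
    funext fun w => fourier_measureReal_Ico μ hh w
  have hpi : (-2 * Real.pi : ℝ) ≠ 0 := by simp [Real.pi_ne_zero]
  have h1 := hF.fourierInv_fourier_eq (by
    rw [hFF]
    exact hint.comp_mul_left' hpi)
    (continuous_measureReal_Ico (measure_singleton_eq_zero_of_integrable_charFun hμ)
      h).continuousAt (v := k)
  rw [← h1, Real.fourierInv_eq', hFF]
  have h2 := Measure.integral_comp_mul_left (fun z : ℝ => Complex.exp (-I * z * k)
      * (charFun μ z * ∫ x in (-h)..0, Complex.exp (I * z * x))) (-2 * Real.pi)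
  rw [show (1 / (2 * Real.pi) : ℂ) = ((|(-2 * Real.pi)⁻¹| : ℝ) : ℂ) by
    rw [abs_inv, neg_mul, abs_neg, abs_of_pos (by positivity)]; push_cast; ring]
  rw [← Complex.real_smul, ← h2]
  refine integral_congr_ae (.of_forall fun w => ?_)
  simp only [smul_eq_mul]
  congr 2
  simp
  ring

/-- The difference of the upper tails of two laws with integrable characteristic functions. -/
lemma measureReal_Ici_sub_eq_integral {μ₁ μ₂ : Measure ℝ} [IsProbabilityMeasure μ₁]
    [IsProbabilityMeasure μ₂] (h₁ : Integrable (charFun μ₁)) (h₂ : Integrable (charFun μ₂))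
    (h : Integrable (fun z : ℝ => (charFun μ₁ z - charFun μ₂ z) / (I * z))) (k : ℝ) :
    ((μ₁.real (Ici k) - μ₂.real (Ici k) : ℝ) : ℂ) = 1 / (2 * Real.pi)
      * ∫ z : ℝ, Complex.exp (-I * z * k) * ((charFun μ₁ z - charFun μ₂ z) / (I * z)) := by
  set J : ℝ → ℂ := fun z => (charFun μ₁ z - charFun μ₂ z) / (I * z) with hJ
  have hexp : ∀ a : ℝ, Integrable (fun z : ℝ => Complex.exp (-I * z * a) * J z) := by
    intro a
    refine h.bdd_mul (c := 1) (Continuous.aestronglyMeasurable (by fun_prop))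
      (.of_forall fun z => ?_)
    rw [show -I * (z : ℂ) * a = ((-z * a : ℝ) : ℂ) * I by push_cast; ring,
      Complex.norm_exp_ofReal_mul_I]
  have hbd : ∀ h' : ℝ, 0 < h' → ∀ (μ : Measure ℝ), Integrable (charFun μ) →
      Integrable (fun z : ℝ => Complex.exp (-I * z * k)
        * (charFun μ z * ∫ x in (-h')..0, Complex.exp (I * z * x))) := by
    intro h' hh' μ hμ
    have hb : ∀ z : ℝ, ‖∫ x in (-h')..0, Complex.exp (I * (z : ℂ) * x)‖ ≤ h' := by
      intro z
      have := intervalIntegral.norm_integral_le_of_norm_le_const (a := -h') (b := 0) (C := 1)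
        (f := fun x : ℝ => Complex.exp (I * (z : ℂ) * x)) (fun x _ => by
          rw [mul_assoc, mul_comm I, ← Complex.ofReal_mul, Complex.norm_exp_ofReal_mul_I])
      simpa [abs_of_pos hh'] using this
    have hBm : Continuous (fun z : ℝ => ∫ x in (-h')..0, Complex.exp (I * (z : ℂ) * x)) := by
      exact intervalIntegral.continuous_parametric_intervalIntegral_of_continuous'
        (by fun_prop) _ _
    refine (hμ.mul_bdd (c := h') hBm.aestronglyMeasurable (.of_forall hb)).bdd_mul (c := 1)
      (Continuous.aestronglyMeasurable (by fun_prop)) (.of_forall fun z => ?_)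
    rw [show -I * (z : ℂ) * k = ((-z * k : ℝ) : ℂ) * I by push_cast; ring,
      Complex.norm_exp_ofReal_mul_I]
  -- Since `∫_{-h'}^0 e^{izx} dx = (1 - e^{-izh'})/(iz)`, the window formula splits into one
  -- integral at `k` and one at `k + h'`. The split is legitimate only for the difference of two
  -- laws, where the quotient by `iz` is integrable.
  have hstep : ∀ h' : ℝ, 0 < h' →
      ((μ₁.real (Ico k (k + h')) - μ₂.real (Ico k (k + h')) : ℝ) : ℂ) = 1 / (2 * Real.pi)
        * ((∫ z : ℝ, Complex.exp (-I * z * k) * J z)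
          - ∫ z : ℝ, Complex.exp (-I * z * (k + h' : ℝ)) * J z) := by
    intro h' hh'
    rw [Complex.ofReal_sub, measureReal_Ico_eq_fourier h₁ hh', measureReal_Ico_eq_fourier h₂ hh',
      ← mul_sub, ← integral_sub (hbd h' hh' _ h₁) (hbd h' hh' _ h₂), ← integral_sub (hexp _)
        (hexp _)]
    congr 1
    refine integral_congr_ae ?_
    have hz0 : ∀ᵐ z : ℝ, z ≠ 0 := by simp [ae_iff]
    filter_upwards [hz0] with z hz
    have hz' : I * (z : ℂ) ≠ 0 := by simp [hz]
    rw [integral_exp_mul_complex hz']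
    simp only [hJ]
    rw [show -I * (z : ℂ) * ((k + h' : ℝ) : ℂ) = -I * z * k + I * z * ((-h' : ℝ) : ℂ) by
      push_cast; ring, Complex.exp_add]
    simp only [Complex.ofReal_zero, mul_zero, Complex.exp_zero]
    field_simp
  have hlim1 : ∀ (μ : Measure ℝ) [IsProbabilityMeasure μ],
      Tendsto (fun n : ℕ => μ.real (Ico k (k + ((n + 1 : ℕ) : ℝ)))) atTop (𝓝 (μ.real (Ici k))) := by
    intro μ _
    have hmono : Monotone (fun n : ℕ => Ico k (k + ((n + 1 : ℕ) : ℝ))) := by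
      intro a b hab
      refine Ico_subset_Ico_right ?_
      gcongr
    have hU : (⋃ n : ℕ, Ico k (k + ((n + 1 : ℕ) : ℝ))) = Ici k := by
      ext x
      simp only [mem_iUnion, mem_Ico, mem_Ici]
      refine ⟨fun ⟨n, hn⟩ => hn.1, fun hx => ?_⟩
      obtain ⟨n, hn⟩ := exists_nat_gt (x - k)
      exact ⟨n, hx, by push_cast; linarith⟩
    have := tendsto_measure_iUnion_atTop (μ := μ) hmono
    rw [hU] at this
    exact (ENNReal.tendsto_toReal (measure_ne_top _ _)).comp this
  -- By Riemann–Lebesgue the contribution of the far end of the window disappears.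
  have hRL : Tendsto (fun n : ℕ => ∫ z : ℝ, Complex.exp (-I * z * (k + ((n + 1 : ℕ) : ℝ) : ℝ)) * J z)
      atTop (𝓝 0) := by
    have h1 := Real.tendsto_integral_exp_smul_cocompact J
    have h2 : Tendsto (fun n : ℕ => (k + ((n + 1 : ℕ) : ℝ)) / (2 * Real.pi)) atTop
        (cocompact ℝ) := by
      refine Tendsto.mono_right ?_ atTop_le_cocompact
      refine Tendsto.atTop_div_const (by positivity) (tendsto_atTop_add_const_left _ _ ?_)
      exact (tendsto_natCast_atTop_atTop (R := ℝ)).comp (tendsto_add_atTop_nat 1)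
    refine (h1.comp h2).congr fun n => ?_
    refine integral_congr_ae (.of_forall fun z => ?_)
    simp only [Circle.smul_def, Real.fourierChar_apply, smul_eq_mul]
    congr 2
    push_cast
    have : (Real.pi : ℂ) ≠ 0 := by exact_mod_cast Real.pi_ne_zero
    field_simp
  have hA : Tendsto (fun n : ℕ => ((μ₁.real (Ico k (k + ((n + 1 : ℕ) : ℝ)))
      - μ₂.real (Ico k (k + ((n + 1 : ℕ) : ℝ))) : ℝ) : ℂ)) atTop
      (𝓝 ((μ₁.real (Ici k) - μ₂.real (Ici k) : ℝ) : ℂ)) :=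
    (Complex.continuous_ofReal.tendsto _).comp ((hlim1 μ₁).sub (hlim1 μ₂))
  have hB : Tendsto (fun n : ℕ => 1 / (2 * (Real.pi : ℂ))
        * ((∫ z : ℝ, Complex.exp (-I * z * k) * J z)
          - ∫ z : ℝ, Complex.exp (-I * z * (k + ((n + 1 : ℕ) : ℝ) : ℝ)) * J z)) atTop
      (𝓝 (1 / (2 * (Real.pi : ℂ)) * ((∫ z : ℝ, Complex.exp (-I * z * k) * J z) - 0))) :=
    (tendsto_const_nhds.sub hRL).const_mul _
  rw [sub_zero] at hB
  refine tendsto_nhds_unique hA (hB.congr fun n => ?_)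
  rw [hstep _ (by positivity)]

end Inversion

/-! ### The truncation-free kernel and its integrable majorant. -/

section Kernel

/-- The Lévy–Khintchine kernel `e^{s x} - 1 - s (eˣ - 1)` of a martingale exponential Lévy
model. -/
noncomputable def martKernel (s : ℂ) (x : ℝ) : ℂ :=
  Complex.exp (s * x) - 1 - s * (Complex.exp x - 1)

/-- The weight `min (x², |x|) (1 + e^{δ x})`, which dominates `martKernel s` for
`0 ≤ re s ≤ δ`. -/
noncomputable def jumpWeight (δ x : ℝ) : ℝ := min (x ^ 2) |x| * (1 + Real.exp (δ * x))

lemma continuous_martKernel (s : ℂ) : Continuous (martKernel s) := by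
  unfold martKernel
  fun_prop

lemma continuous_martKernel_left (x : ℝ) : Continuous (fun s => martKernel s x) := by
  unfold martKernel
  fun_prop

lemma martKernel_zero_right (s : ℂ) : martKernel s 0 = 0 := by simp [martKernel]

lemma continuous_jumpWeight (δ : ℝ) : Continuous (jumpWeight δ) := by
  unfold jumpWeight
  fun_prop

lemma jumpWeight_nonneg (δ x : ℝ) : 0 ≤ jumpWeight δ x := by
  unfold jumpWeight
  positivity

lemma jumpWeight_of_abs_le_one (δ : ℝ) {x : ℝ} (hx : |x| ≤ 1) :
    jumpWeight δ x = x ^ 2 * (1 + Real.exp (δ * x)) := by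
  rw [jumpWeight, min_eq_left]
  rw [← sq_abs]
  nlinarith [abs_nonneg x]

lemma jumpWeight_of_one_lt_abs (δ : ℝ) {x : ℝ} (hx : 1 < |x|) :
    jumpWeight δ x = |x| * (1 + Real.exp (δ * x)) := by
  rw [jumpWeight, min_eq_right]
  rw [← sq_abs]
  nlinarith [abs_nonneg x]

lemma exp_mul_le_one_add_exp {c δ : ℝ} (hc : 0 ≤ c) (hcδ : c ≤ δ) (x : ℝ) :
    Real.exp (c * x) ≤ 1 + Real.exp (δ * x) := by
  rcases le_total x 0 with hx | hx
  · have : Real.exp (c * x) ≤ 1 := Real.exp_le_one_iff.2 (mul_nonpos_of_nonneg_of_nonpos hc hx)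
    linarith [Real.exp_pos (δ * x)]
  · have : Real.exp (c * x) ≤ Real.exp (δ * x) := Real.exp_le_exp.2 (by gcongr)
    linarith

lemma norm_exp_sub_one_sub_le (w : ℂ) :
    ‖Complex.exp w - 1 - w‖ ≤ ‖w‖ ^ 2 * Real.exp ‖w‖ := by
  have := Complex.norm_exp_sub_sum_le_norm_mul_exp w 2
  simpa [Finset.sum_range_succ, sub_sub] using this

lemma norm_cexp_sub_one_sub_le_sq {x : ℝ} (hx : |x| ≤ 1) :
    ‖Complex.exp x - 1 - x‖ ≤ x ^ 2 := by
  have := Complex.norm_exp_sub_one_sub_id_le (x := (x : ℂ)) (by simpa using hx)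
  simpa using this

/-- For `|x| ≤ 1` the linear terms of the two exponentials cancel, which leaves a quadratic
remainder; for `|x| > 1` each exponential is at most `1 + e^{δx}`. The constant depends only on a
bound for `‖s‖`, as local uniformity in `s` requires. -/
lemma norm_martKernel_le {δ : ℝ} (hδ : 1 ≤ δ) {s : ℂ} (h0 : 0 ≤ s.re) (h1 : s.re ≤ δ) {R : ℝ}
    (hR : ‖s‖ ≤ R) (x : ℝ) :
    ‖martKernel s x‖ ≤ (R ^ 2 * Real.exp R + 3 * R + 2) * jumpWeight δ x := by
  have hR0 : 0 ≤ R := (norm_nonneg s).trans hR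
  rcases le_or_gt |x| 1 with hx | hx
  · rw [jumpWeight_of_abs_le_one δ hx]
    have hsx : ‖s * x‖ ≤ R * |x| := by
      rw [norm_mul, Complex.norm_real, Real.norm_eq_abs]
      gcongr
    have e1 : ‖Complex.exp (s * x) - 1 - s * x‖ ≤ R ^ 2 * Real.exp R * x ^ 2 := by
      refine (norm_exp_sub_one_sub_le _).trans ?_
      calc ‖s * x‖ ^ 2 * Real.exp ‖s * x‖ ≤ (R * |x|) ^ 2 * Real.exp R := by
            gcongr
            exact hsx.trans (mul_le_of_le_one_right hR0 hx)
        _ = R ^ 2 * Real.exp R * x ^ 2 := by rw [mul_pow, sq_abs]; ring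
    have e2 : ‖s * (Complex.exp x - 1 - x)‖ ≤ R * x ^ 2 := by
      rw [norm_mul]
      gcongr
      exact norm_cexp_sub_one_sub_le_sq hx
    have e3 : martKernel s x = (Complex.exp (s * x) - 1 - s * x)
        - s * (Complex.exp x - 1 - x) := by
      unfold martKernel; ring
    rw [e3]
    refine (norm_sub_le _ _).trans ((add_le_add e1 e2).trans ?_)
    have : 0 ≤ Real.exp (δ * x) := (Real.exp_pos _).le
    have hE := Real.exp_pos R
    calc R ^ 2 * Real.exp R * x ^ 2 + R * x ^ 2
        ≤ (R ^ 2 * Real.exp R + 3 * R + 2) * (x ^ 2 * 1) := by nlinarith [sq_nonneg x]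
      _ ≤ _ := by
        gcongr
        linarith
  · rw [jumpWeight_of_one_lt_abs δ hx]
    have e1 : ‖Complex.exp (s * x)‖ ≤ 1 + Real.exp (δ * x) := by
      rw [Complex.norm_exp]
      simpa using exp_mul_le_one_add_exp h0 h1 x
    have e2 : ‖Complex.exp (x : ℂ)‖ ≤ 1 + Real.exp (δ * x) := by
      rw [Complex.norm_exp]
      simpa using exp_mul_le_one_add_exp zero_le_one hδ x
    have hE := Real.exp_pos (δ * x)
    calc ‖martKernel s x‖ ≤ ‖Complex.exp (s * x)‖ + 1 + ‖s‖ * (‖Complex.exp (x : ℂ)‖ + 1) := by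
          unfold martKernel
          refine (norm_sub_le _ _).trans (add_le_add ?_ ?_)
          · simpa using norm_sub_le (Complex.exp (s * x)) 1
          · rw [norm_mul]
            gcongr
            simpa using norm_sub_le (Complex.exp (x : ℂ)) 1
      _ ≤ (1 + Real.exp (δ * x)) + 1 + R * ((1 + Real.exp (δ * x)) + 1) := by gcongr
      _ ≤ (R ^ 2 * Real.exp R + 3 * R + 2) * (1 * (1 + Real.exp (δ * x))) := by
          have : 0 ≤ R ^ 2 * Real.exp R := by positivity
          nlinarith [mul_nonneg hR0 hE.le, mul_nonneg this hE.le]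
      _ ≤ _ := by gcongr

lemma integrable_martKernel {ν : Measure ℝ} {δ : ℝ} (hδ : 1 ≤ δ)
    (hW : Integrable (jumpWeight δ) ν) {s : ℂ} (h0 : 0 ≤ s.re) (h1 : s.re ≤ δ) :
    Integrable (martKernel s) ν :=
  (hW.const_mul _).mono' (continuous_martKernel s).aestronglyMeasurable
    (.of_forall fun x => norm_martKernel_le hδ h0 h1 le_rfl x)

/-- The cumulant is continuous in the closed strip `0 ≤ re s ≤ δ`. -/
lemma continuousOn_integral_martKernel {ν : Measure ℝ} {δ : ℝ} (hδ : 1 ≤ δ)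
    (hW : Integrable (jumpWeight δ) ν) :
    ContinuousOn (fun s => ∫ x, martKernel s x ∂ν) {s : ℂ | 0 ≤ s.re ∧ s.re ≤ δ} := by
  intro s₀ _
  have hnear : ∀ᶠ s in 𝓝[{s : ℂ | 0 ≤ s.re ∧ s.re ≤ δ}] s₀, ‖s‖ ≤ ‖s₀‖ + 1 := by
    have : Tendsto (fun s : ℂ => ‖s‖) (𝓝[{s : ℂ | 0 ≤ s.re ∧ s.re ≤ δ}] s₀) (𝓝 ‖s₀‖) :=
      continuous_norm.continuousWithinAt
    filter_upwards [this.eventually (Iic_mem_nhds (show ‖s₀‖ < ‖s₀‖ + 1 by linarith))] with s hs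
      using hs
  refine continuousWithinAt_of_dominated (.of_forall fun s =>
    (continuous_martKernel s).aestronglyMeasurable) ?_ (hW.const_mul
      ((‖s₀‖ + 1) ^ 2 * Real.exp (‖s₀‖ + 1) + 3 * (‖s₀‖ + 1) + 2))
    (.of_forall fun x => (continuous_martKernel_left x).continuousWithinAt)
  filter_upwards [hnear, self_mem_nhdsWithin] with s hs hs'
  exact .of_forall fun x => norm_martKernel_le hδ hs'.1 hs'.2 hs x

end Kernel

/-! ### Compound Poisson laws and their exponential moments. -/

section CompoundPoisson

/-- Convolution powers of a measure on `ℝ`. -/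
noncomputable def convPow (ν : Measure ℝ) : ℕ → Measure ℝ
  | 0 => Measure.dirac 0
  | n + 1 => (convPow ν n).conv ν

instance isFiniteMeasure_convPow (ν : Measure ℝ) [IsFiniteMeasure ν] (n : ℕ) :
    IsFiniteMeasure (convPow ν n) := by
  induction n with
  | zero => exact inferInstanceAs (IsFiniteMeasure (Measure.dirac 0))
  | succ n ih => exact inferInstanceAs (IsFiniteMeasure ((convPow ν n).conv ν))

/-- Multiplicativity turns convolution into products. It is needed for `e^{sx}` and also for its
modulus, whence the general scalar field. -/
lemma integral_convPow {𝕜 : Type*} [RCLike 𝕜] {ν : Measure ℝ} [IsFiniteMeasure ν] {f : ℝ → 𝕜}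
    (hc : Continuous f) (h0 : f 0 = 1) (hadd : ∀ x y, f (x + y) = f x * f y)
    (hf : Integrable f ν) (n : ℕ) :
    Integrable f (convPow ν n) ∧ ∫ x, f x ∂convPow ν n = (∫ x, f x ∂ν) ^ n := by
  induction n with
  | zero => exact ⟨integrable_dirac (by simp), by simp [convPow, h0]⟩
  | succ n ih =>
    have hmul : (fun p : ℝ × ℝ => f (p.1 + p.2)) = fun p => f p.1 * f p.2 :=
      funext fun p => hadd _ _
    constructor
    · rw [convPow, Measure.conv, integrable_map_measure hc.aestronglyMeasurable (by fun_prop)]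
      simpa only [Function.comp_def, hmul] using ih.1.mul_prod hf
    · rw [convPow, Measure.conv, integral_map (by fun_prop) hc.aestronglyMeasurable, hmul,
        integral_prod_mul, ih.2, pow_succ]

/-- The compound Poisson law with jump measure `ν`. -/
noncomputable def compoundPoisson (ν : Measure ℝ) : Measure ℝ :=
  Measure.sum (fun n : ℕ => ENNReal.ofReal (Real.exp (-ν.real univ) / n.factorial) • convPow ν n)

lemma integral_compoundPoisson {𝕜 : Type*} [RCLike 𝕜] {ν : Measure ℝ} [IsFiniteMeasure ν]
    {f : ℝ → 𝕜} (hc : Continuous f) (h0 : f 0 = 1) (hadd : ∀ x y, f (x + y) = f x * f y)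
    (hf : Integrable f ν) :
    Integrable f (compoundPoisson ν) ∧
      HasSum (fun n : ℕ => (Real.exp (-ν.real univ) / n.factorial) • (∫ x, f x ∂ν) ^ n)
        (∫ x, f x ∂compoundPoisson ν) := by
  have hnorm := integral_convPow (f := fun x => ‖f x‖) hc.norm (by simp [h0])
    (fun x y => by simp [hadd]) hf.norm
  have hint : Integrable f (compoundPoisson ν) := by
    refine integrable_sum_measure (fun n => (integral_convPow hc h0 hadd hf n).1.smul_measure
      ENNReal.ofReal_ne_top) ?_
    have : ∀ n : ℕ, ∫ x, ‖f x‖ ∂(ENNReal.ofReal (Real.exp (-ν.real univ) / n.factorial)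
        • convPow ν n) = Real.exp (-ν.real univ) * ((∫ x, ‖f x‖ ∂ν) ^ n / n.factorial) := by
      intro n
      rw [integral_smul_measure, (hnorm n).2, ENNReal.toReal_ofReal (by positivity), smul_eq_mul]
      ring
    simp_rw [this]
    exact (Real.summable_pow_div_factorial _).mul_left _
  refine ⟨hint, ?_⟩
  have hval : ∀ n : ℕ, ∫ x, f x ∂(ENNReal.ofReal (Real.exp (-ν.real univ) / n.factorial)
      • convPow ν n) = (Real.exp (-ν.real univ) / n.factorial) • (∫ x, f x ∂ν) ^ n := fun n => by
    rw [integral_smul_measure, (integral_convPow hc h0 hadd hf n).2,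
      ENNReal.toReal_ofReal (by positivity)]
  have hsum := hasSum_integral_measure hint
  simp_rw [hval] at hsum
  exact hsum

/-- Summing over the number of jumps gives the exponential series of `∫ e^{sx} dν`; the
normalization `e^{-ν(ℝ)}` supplies the `-1` in the exponent. -/
lemma integral_cexp_compoundPoisson {ν : Measure ℝ} [IsFiniteMeasure ν] {s : ℂ}
    (hs : Integrable (fun x => Real.exp (s.re * x)) ν) :
    Integrable (fun x : ℝ => Complex.exp (s * x)) (compoundPoisson ν) ∧
      ∫ x : ℝ, Complex.exp (s * x) ∂compoundPoisson ν
        = Complex.exp (∫ x : ℝ, (Complex.exp (s * x) - 1) ∂ν) := by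
  have hs' : Integrable (fun x : ℝ => Complex.exp (s * x)) ν := by
    refine hs.mono' (Continuous.aestronglyMeasurable (by fun_prop)) (.of_forall fun x => ?_)
    rw [Complex.norm_exp]
    simp
  obtain ⟨h1, h2⟩ := integral_compoundPoisson (f := fun x : ℝ => Complex.exp (s * x))
    (by fun_prop) (by simp) (fun x y => by rw [← Complex.exp_add]; push_cast; ring_nf) hs'
  refine ⟨h1, h2.unique ?_⟩
  have h3 := (NormedSpace.expSeries_div_hasSum_exp (∫ x : ℝ, Complex.exp (s * x) ∂ν)).mul_left
    ((Real.exp (-ν.real univ) : ℝ) : ℂ)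
  rw [← Complex.exp_eq_exp_ℂ, Complex.ofReal_exp, ← Complex.exp_add] at h3
  rw [integral_sub hs' (integrable_const _), integral_const]
  rw [Complex.real_smul, mul_one, sub_eq_neg_add, ← Complex.ofReal_neg]
  refine (congrArg (fun g => HasSum g _) (funext fun n : ℕ => ?_)).mpr h3
  rw [Complex.real_smul]
  push_cast
  ring

lemma isProbabilityMeasure_compoundPoisson (ν : Measure ℝ) [IsFiniteMeasure ν] :
    IsProbabilityMeasure (compoundPoisson ν) := by
  obtain ⟨h1, h2⟩ := integral_cexp_compoundPoisson (ν := ν) (s := 0)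
    (by simp)
  simp only [zero_mul, Complex.exp_zero, sub_self, integral_zero] at h1 h2
  have hfin : IsFiniteMeasure (compoundPoisson ν) := by
    rcases integrable_const_iff.1 h1 with h | h
    · simp at h
    · exact h
  rw [integral_const, Complex.real_smul, mul_one] at h2
  have h3 : (compoundPoisson ν).real univ = 1 := by exact_mod_cast h2
  exact ⟨by rwa [Measure.real, ENNReal.toReal_eq_one_iff] at h3⟩

/-- A compound Poisson law, recentred so that `E[e^X] = 1`. -/
lemma exists_centered_compoundPoisson (ν : Measure ℝ) [IsFiniteMeasure ν]
    (h1 : Integrable Real.exp ν) :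
    ∃ μ : Measure ℝ, IsProbabilityMeasure μ ∧ ∀ s : ℂ,
      Integrable (fun x => Real.exp (s.re * x)) ν →
      Integrable (fun x : ℝ => Complex.exp (s * x)) μ ∧
      ∫ x : ℝ, Complex.exp (s * x) ∂μ = Complex.exp (∫ x, martKernel s x ∂ν) := by
  have := isProbabilityMeasure_compoundPoisson ν
  -- This shift multiplies the moment of order `s` by `e^{sb}`, which is exactly the term `-s(e^x -
  -- 1)` of `martKernel`.
  set b : ℝ := -∫ x, (Real.exp x - 1) ∂ν with hb
  refine ⟨(compoundPoisson ν).map (· + b), Measure.isProbabilityMeasure_map (by fun_prop), ?_⟩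
  intro s hs
  obtain ⟨h2, h3⟩ := integral_cexp_compoundPoisson hs
  have hsplit : ∀ x : ℝ, Complex.exp (s * ((x + b : ℝ) : ℂ))
      = Complex.exp (s * x) * Complex.exp (s * b) := fun x => by
    rw [← Complex.exp_add]; push_cast; ring_nf
  have hs' : Integrable (fun x : ℝ => Complex.exp (s * x)) ν := by
    refine hs.mono' (Continuous.aestronglyMeasurable (by fun_prop)) (.of_forall fun x => ?_)
    rw [Complex.norm_exp]
    simp
  constructor
  · rw [integrable_map_measure (Continuous.aestronglyMeasurable (by fun_prop)) (by fun_prop)]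
    simp only [Function.comp_def, hsplit]
    exact h2.mul_const _
  · rw [integral_map (by fun_prop) (Continuous.aestronglyMeasurable (by fun_prop))]
    simp only [hsplit]
    rw [integral_mul_const, h3, ← Complex.exp_add]
    congr 1
    have hb' : (b : ℂ) = -∫ x : ℝ, (Complex.exp x - 1) ∂ν := by
      rw [hb, Complex.ofReal_neg, ← integral_complex_ofReal]
      simp
    unfold martKernel
    have hr : Integrable (fun x : ℝ => Complex.exp x - 1) ν := by
      have := (h1.sub (integrable_const (1 : ℝ))).ofReal (𝕜 := ℂ)
      simpa using this
    have hs1 : Integrable (fun x : ℝ => Complex.exp (s * x) - 1) ν := hs'.sub (integrable_const _)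
    rw [integral_sub hs1 (hr.const_mul _), integral_const_mul, hb']
    ring

end CompoundPoisson

/-! ### From the characteristic function to exponential moments in the strip. -/

section ExponentialMoments

variable {ν μ : Measure ℝ} {δ : ℝ}

/-- Away from `0` the weight is bounded below. Hence removing the jumps of size at most `1/(n+1)`
leaves a finite measure that keeps its exponential moments up to order `δ`. -/
lemma sq_mul_jumpWeight_ge (n : ℕ) {x : ℝ} (hx : ((n : ℝ) + 1)⁻¹ < |x|) :
    1 + Real.exp (δ * x) ≤ ((n : ℝ) + 1) ^ 2 * jumpWeight δ x := by
  have hn : (1 : ℝ) ≤ (n : ℝ) + 1 := by linarith [n.cast_nonneg (α := ℝ)]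
  have h1 : 1 ≤ ((n : ℝ) + 1) * |x| := by
    rw [inv_lt_iff_one_lt_mul₀ (by positivity)] at hx
    linarith
  have h2 : 1 ≤ ((n : ℝ) + 1) ^ 2 * min (x ^ 2) |x| := by
    rw [mul_min_of_nonneg _ _ (by positivity), ← sq_abs x, ← mul_pow]
    refine le_min (one_le_pow₀ h1) ?_
    nlinarith [abs_nonneg x]
  rw [jumpWeight, ← mul_assoc]
  exact le_mul_of_one_le_left (by positivity) h2

lemma isFiniteMeasure_restrict_of_jumpWeight (hW : Integrable (jumpWeight δ) ν) (n : ℕ) :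
    IsFiniteMeasure (ν.restrict {x | ((n : ℝ) + 1)⁻¹ < |x|}) := by
  have hS : MeasurableSet {x : ℝ | ((n : ℝ) + 1)⁻¹ < |x|} :=
    measurableSet_lt measurable_const (by fun_prop)
  have h1 : Integrable (fun _ : ℝ => (1 : ℝ)) (ν.restrict {x | ((n : ℝ) + 1)⁻¹ < |x|}) := by
    refine (hW.restrict.const_mul (((n : ℝ) + 1) ^ 2)).mono' (by fun_prop) ?_
    filter_upwards [ae_restrict_mem hS] with x hx
    have := sq_mul_jumpWeight_ge (δ := δ) n hx
    simp only [norm_one]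
    linarith [Real.exp_pos (δ * x)]
  rcases integrable_const_iff.1 h1 with h | h
  · simp at h
  · exact h

lemma integrable_exp_restrict (hW : Integrable (jumpWeight δ) ν) (n : ℕ) {c : ℝ} (hc : 0 ≤ c)
    (hcδ : c ≤ δ) :
    Integrable (fun x => Real.exp (c * x)) (ν.restrict {x | ((n : ℝ) + 1)⁻¹ < |x|}) := by
  have hS : MeasurableSet {x : ℝ | ((n : ℝ) + 1)⁻¹ < |x|} :=
    measurableSet_lt measurable_const (by fun_prop)
  refine (hW.restrict.const_mul (((n : ℝ) + 1) ^ 2)).mono'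
    (Continuous.aestronglyMeasurable (by fun_prop)) ?_
  filter_upwards [ae_restrict_mem hS] with x hx
  rw [Real.norm_eq_abs, Real.abs_exp]
  exact (exp_mul_le_one_add_exp hc hcδ x).trans (sq_mul_jumpWeight_ge n hx)

lemma tendsto_integral_martKernel_restrict (hδ : 1 ≤ δ) (hW : Integrable (jumpWeight δ) ν) {s : ℂ}
    (h0 : 0 ≤ s.re) (h1 : s.re ≤ δ) :
    Tendsto (fun n : ℕ => ∫ x, martKernel s x ∂(ν.restrict {x | ((n : ℝ) + 1)⁻¹ < |x|})) atTop
      (𝓝 (∫ x, martKernel s x ∂ν)) := by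
  have hint := integrable_martKernel hδ hW h0 h1
  have := tendsto_setIntegral_of_monotone (μ := ν) (f := martKernel s)
    (s := fun n : ℕ => {x : ℝ | ((n : ℝ) + 1)⁻¹ < |x|})
    (fun n => measurableSet_lt measurable_const (by fun_prop))
    (fun a b hab x (hx : ((a : ℝ) + 1)⁻¹ < |x|) => by
      refine lt_of_le_of_lt ?_ hx
      gcongr) hint.integrableOn
  rwa [setIntegral_eq_integral_of_forall_compl_eq_zero] at this
  intro x hx
  have : x = 0 := by
    by_contra h
    obtain ⟨n, hn⟩ := exists_nat_one_div_lt (abs_pos.2 h)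
    exact hx (mem_iUnion.2 ⟨n, by simpa using hn⟩)
  rw [this, martKernel_zero_right]

/-- Cutting off `e^{s x}` at level `N` costs little, given an exponential moment of higher order. -/
lemma norm_integral_exp_sub_cutoff_le {m : Measure ℝ} [IsProbabilityMeasure m] (hδ : 1 < δ)
    (hm : Integrable (fun x => Real.exp (δ * x)) m) {s : ℂ} (h0 : 0 ≤ s.re) (h1 : s.re ≤ 1)
    {N : ℝ} (hN : 0 ≤ N) :
    ‖(∫ x : ℝ, Complex.exp (s * x) ∂m) - ∫ x : ℝ, Complex.exp (s * (min x N : ℝ)) ∂m‖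
      ≤ 2 * Real.exp (-(δ - 1) * N) * ∫ x, Real.exp (δ * x) ∂m := by
  have i1 : Integrable (fun x : ℝ => Complex.exp (s * x)) m := by
    refine ((integrable_const (1 : ℝ)).add hm).mono' (Continuous.aestronglyMeasurable (by fun_prop))
      (.of_forall fun x => ?_)
    rw [Complex.norm_exp]
    simpa using exp_mul_le_one_add_exp h0 (h1.trans hδ.le) x
  have i2 : Integrable (fun x : ℝ => Complex.exp (s * (min x N : ℝ))) m := by
    refine Integrable.of_bound (C := Real.exp (s.re * N)) (Continuous.aestronglyMeasurable
      (by fun_prop)) (.of_forall fun x => ?_)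
    rw [Complex.norm_exp, Complex.re_mul_ofReal, Real.exp_le_exp]
    gcongr
    exact min_le_right _ _
  rw [← integral_sub i1 i2, ← integral_const_mul]
  refine norm_integral_le_of_norm_le (hm.const_mul _) (.of_forall fun x => ?_)
  rcases le_total x N with hx | hx
  · rw [min_eq_left hx, sub_self, norm_zero]
    positivity
  · rw [min_eq_right hx]
    refine (norm_sub_le _ _).trans ?_
    rw [Complex.norm_exp, Complex.norm_exp, Complex.re_mul_ofReal, Complex.re_mul_ofReal]
    have e1 : Real.exp (s.re * x) ≤ Real.exp (-(δ - 1) * N) * Real.exp (δ * x) := by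
      rw [← Real.exp_add, Real.exp_le_exp]
      nlinarith [mul_le_mul_of_nonneg_left hx (sub_pos.2 hδ).le,
        mul_le_mul_of_nonneg_right h1 (hN.trans hx)]
    have e2 : Real.exp (s.re * N) ≤ Real.exp (s.re * x) := by
      rw [Real.exp_le_exp]
      gcongr
    linarith

/-- Exponential moments of an infinitely divisible law in terms of its Lévy measure. -/
theorem integral_exp_eq_of_charFun_eq [IsProbabilityMeasure μ] (hδ : 1 < δ)
    (hW : Integrable (jumpWeight δ) ν)
    (hμ : ∀ z : ℝ, charFun μ z = Complex.exp (∫ x, martKernel (Complex.I * z) x ∂ν)) :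
    Integrable (fun x => Real.exp (δ * x)) μ ∧ ∀ s : ℂ, 0 ≤ s.re → s.re ≤ 1 →
      ∫ x : ℝ, Complex.exp (s * x) ∂μ = Complex.exp (∫ x, martKernel s x ∂ν) := by
  -- The law is approximated by centred compound Poisson laws `m n` built from the jumps larger than
  -- `1/(n+1)`, for which the formula is known in the whole strip `0 ≤ Re s ≤ δ`.
  have hfin := fun n : ℕ => isFiniteMeasure_restrict_of_jumpWeight hW n
  choose m hmp hm using fun n : ℕ => exists_centered_compoundPoisson
    (ν.restrict {x | ((n : ℝ) + 1)⁻¹ < |x|})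
    (by simpa using integrable_exp_restrict hW n zero_le_one hδ.le)
  have hms : ∀ n (s : ℂ), 0 ≤ s.re → s.re ≤ δ → ∫ x : ℝ, Complex.exp (s * x) ∂(m n)
      = Complex.exp (∫ x, martKernel s x ∂(ν.restrict {x | ((n : ℝ) + 1)⁻¹ < |x|})) :=
    fun n s h0 h1 => (hm n s (integrable_exp_restrict hW n h0 h1)).2
  have hlim : ∀ s : ℂ, 0 ≤ s.re → s.re ≤ δ → Tendsto (fun n => ∫ x : ℝ, Complex.exp (s * x) ∂(m n))
      atTop (𝓝 (Complex.exp (∫ x, martKernel s x ∂ν))) := by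
    intro s h0 h1
    simp_rw [hms _ s h0 h1]
    exact (Complex.continuous_exp.tendsto _).comp
      (tendsto_integral_martKernel_restrict hδ.le hW h0 h1)
  let m' : ℕ → ProbabilityMeasure ℝ := fun n => ⟨m n, hmp n⟩
  let μ' : ProbabilityMeasure ℝ := ⟨μ, inferInstance⟩
  have hweak : Tendsto m' atTop (𝓝 μ') := by
    refine ProbabilityMeasure.tendsto_of_tendsto_charFun fun z => ?_
    have h1 := hlim (Complex.I * z) (by simp) (by simp; linarith)
    rw [← hμ] at h1
    refine h1.congr fun n => ?_
    rw [charFun_apply_real]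
    congr! 3 with x
    ring
  have hδint : ∀ n, Integrable (fun x => Real.exp (δ * x)) (m n) := fun n => by
    have := (hm n δ (by simpa using integrable_exp_restrict hW n (zero_le_one.trans hδ.le) le_rfl)).1
    refine this.norm.congr (.of_forall fun x => ?_)
    simp [Complex.norm_exp]
  -- The moments of order `δ` converge, hence are bounded. This gives the uniform integrability
  -- needed to pass from weak convergence to convergence of `e^{sx}` for `Re s ≤ 1 < δ`.
  obtain ⟨B, hB⟩ : ∃ B, ∀ n, ∫ x, Real.exp (δ * x) ∂(m n) ≤ B := by
    have h1 := (hlim δ (by simp; linarith) (by simp)).norm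
    obtain ⟨B, hB⟩ := h1.bddAbove_range
    refine ⟨B, fun n => (le_of_eq ?_).trans (hB ⟨n, rfl⟩)⟩
    have : ∫ x : ℝ, Complex.exp ((δ : ℂ) * x) ∂(m n)
        = ((∫ x, Real.exp (δ * x) ∂(m n) : ℝ) : ℂ) := by
      rw [← integral_complex_ofReal]
      simp
    simp only [this, Complex.norm_real, Real.norm_eq_abs]
    rw [abs_of_nonneg (integral_nonneg fun x => (Real.exp_pos _).le)]
  have hB0 : 0 ≤ B := (integral_nonneg fun x => (Real.exp_pos _).le).trans (hB 0)
  -- For `Re s ≥ 0` the function `e^{s min(x,N)}` is bounded and continuous, so weak convergence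
  -- applies to it.
  have hcut : ∀ (s : ℂ) (N : ℝ), 0 ≤ s.re →
      Tendsto (fun n => ∫ x : ℝ, Complex.exp (s * (min x N : ℝ)) ∂(m n)) atTop
        (𝓝 (∫ x : ℝ, Complex.exp (s * (min x N : ℝ)) ∂μ)) := by
    intro s N h0
    let F : BoundedContinuousFunction ℝ ℂ := BoundedContinuousFunction.ofNormedAddCommGroup
      (fun x : ℝ => Complex.exp (s * (min x N : ℝ))) (by fun_prop) (Real.exp (s.re * N))
      (fun x => by
        rw [Complex.norm_exp, Complex.re_mul_ofReal, Real.exp_le_exp]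
        gcongr
        exact min_le_right _ _)
    exact (ProbabilityMeasure.tendsto_iff_forall_integral_rclike_tendsto ℂ).1 hweak F
  have hcutint : ∀ (p : Measure ℝ) [IsProbabilityMeasure p] (N : ℝ),
      Integrable (fun x : ℝ => Real.exp (δ * min x N)) p := by
    intro p _ N
    refine Integrable.of_bound (C := Real.exp (δ * N)) (Continuous.aestronglyMeasurable
      (by fun_prop)) (.of_forall fun x => ?_)
    rw [Real.norm_eq_abs, Real.abs_exp, Real.exp_le_exp]
    gcongr
    exact min_le_right _ _
  have hcutB : ∀ N : ℝ, ∫ x, Real.exp (δ * min x N) ∂μ ≤ B := by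
    intro N
    have h1 := hcut δ N (by simp; linarith)
    have h2 : ∀ p : Measure ℝ, ∫ x : ℝ, Complex.exp ((δ : ℂ) * (min x N : ℝ)) ∂p
        = ((∫ x, Real.exp (δ * min x N) ∂p : ℝ) : ℂ) := fun p => by
      rw [← integral_complex_ofReal]
      congr! 2 with x
      rw [Complex.ofReal_exp, Complex.ofReal_mul]
    simp_rw [h2] at h1
    have h3 := (Complex.continuous_re.tendsto _).comp h1
    simp only [Function.comp_def, Complex.ofReal_re] at h3
    refine le_of_tendsto h3 (.of_forall fun n => (integral_mono (hcutint (m n) N) (hδint n)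
      fun x => ?_).trans (hB n))
    simp only [Real.exp_le_exp]
    gcongr
    exact min_le_left _ _
  -- Fatou's lemma as the cutoff level tends to infinity: the cut-off moments under the limit law
  -- are all at most `B`.
  have hδμ : Integrable (fun x => Real.exp (δ * x)) μ := by
    refine integrable_of_tendsto (G := fun (n : ℕ) x => Real.exp (δ * min x n))
      (.of_forall fun x => ?_) (fun n => Continuous.aestronglyMeasurable (by fun_prop)) ?_
    · refine tendsto_const_nhds.congr' ?_
      filter_upwards [tendsto_natCast_atTop_atTop.eventually_ge_atTop x] with n hn
      rw [min_eq_left hn]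
    · refine ne_top_of_le_ne_top (b := ENNReal.ofReal B) ENNReal.ofReal_ne_top ?_
      refine liminf_le_of_le (by isBoundedDefault) fun b hb => ?_
      obtain ⟨n, hn⟩ := hb.exists
      refine hn.trans ?_
      rw [← ofReal_integral_norm_eq_lintegral_enorm (hcutint μ n)]
      refine ENNReal.ofReal_le_ofReal ?_
      simpa using hcutB n
  refine ⟨hδμ, fun s h0 h1 => ?_⟩
  refine tendsto_nhds_unique ?_ (hlim s h0 (h1.trans hδ.le))
  -- Three-term estimate: the cutoff error is small uniformly in `n` and under the limit law once
  -- `N` is large, and for this `N` the cut-off integrals converge.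
  set B' := max B (∫ x, Real.exp (δ * x) ∂μ) with hB'
  rw [Metric.tendsto_atTop]
  intro ε hε
  have hN : ∃ N : ℝ, 0 ≤ N ∧ 2 * Real.exp (-(δ - 1) * N) * B' < ε / 3 := by
    have h2 : Tendsto (fun N : ℝ => 2 * Real.exp (-(δ - 1) * N) * B') atTop (𝓝 (2 * 0 * B')) := by
      refine ((Real.tendsto_exp_atBot.comp ?_).const_mul 2).mul_const _
      exact tendsto_id.const_mul_atTop_of_neg (by linarith)
    rw [mul_zero, zero_mul] at h2
    obtain ⟨N, hN1, hN2⟩ := ((eventually_ge_atTop (0 : ℝ)).and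
      (h2.eventually (gt_mem_nhds (by positivity : 0 < ε / 3)))).exists
    exact ⟨N, hN1, hN2⟩
  obtain ⟨N, hN0, hN⟩ := hN
  obtain ⟨n₀, hn₀⟩ := Metric.tendsto_atTop.1 (hcut s N h0) (ε / 3) (by positivity)
  refine ⟨n₀, fun n hn => ?_⟩
  have a1 := norm_integral_exp_sub_cutoff_le hδ (hδint n) h0 h1 hN0
  have a2 := norm_integral_exp_sub_cutoff_le hδ hδμ h0 h1 hN0
  have b1 : 2 * Real.exp (-(δ - 1) * N) * ∫ x, Real.exp (δ * x) ∂(m n) ≤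
      2 * Real.exp (-(δ - 1) * N) * B' := by
    gcongr
    exact (hB n).trans (le_max_left _ _)
  have b2 : 2 * Real.exp (-(δ - 1) * N) * ∫ x, Real.exp (δ * x) ∂μ ≤
      2 * Real.exp (-(δ - 1) * N) * B' := by
    gcongr
    exact le_max_right _ _
  have a3 := hn₀ n hn
  rw [← dist_eq_norm] at a1 a2
  linarith [dist_triangle (∫ x : ℝ, Complex.exp (s * x) ∂(m n))
    (∫ x : ℝ, Complex.exp (s * (min x N : ℝ)) ∂(m n)) (∫ x : ℝ, Complex.exp (s * x) ∂μ),
    dist_triangle (∫ x : ℝ, Complex.exp (s * (min x N : ℝ)) ∂(m n))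
    (∫ x : ℝ, Complex.exp (s * (min x N : ℝ)) ∂μ) (∫ x : ℝ, Complex.exp (s * x) ∂μ),
    dist_comm (∫ x : ℝ, Complex.exp (s * x) ∂μ) (∫ x : ℝ, Complex.exp (s * (min x N : ℝ)) ∂μ)]

end ExponentialMoments

/-! ### The cumulant of the one-sided stable density in the open half-plane. -/

section GammaIntegral

/-- Mean value inequality on the convex half-plane `Re w ≤ c`, where the derivative is bounded by
`e^c`. -/
lemma norm_exp_sub_exp_le {a b : ℂ} {c : ℝ} (ha : a.re ≤ c) (hb : b.re ≤ c) :
    ‖Complex.exp a - Complex.exp b‖ ≤ Real.exp c * ‖a - b‖ := by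
  refine Convex.norm_image_sub_le_of_norm_hasDerivWithin_le (s := {w : ℂ | w.re ≤ c})
    (f' := Complex.exp) (fun w _ => (Complex.hasDerivAt_exp w).hasDerivWithinAt)
    (fun w hw => ?_) (convex_halfSpace_re_le c) hb ha
  rw [Complex.norm_exp, Real.exp_le_exp]
  exact hw

lemma integrableOn_Ioi_of_norm_le_rpow {E : Type*} [NormedAddCommGroup E] {g : ℝ → E}
    {a b A B : ℝ} (ha : -1 < a) (hb : b < -1)
    (hg : AEStronglyMeasurable g (volume.restrict (Ioi 0)))
    (h1 : ∀ r, 0 < r → r ≤ 1 → ‖g r‖ ≤ A * r ^ a) (h2 : ∀ r, 1 < r → ‖g r‖ ≤ B * r ^ b) :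
    IntegrableOn g (Ioi 0) := by
  rw [← Ioc_union_Ioi_eq_Ioi zero_le_one, integrableOn_union]
  constructor
  · have h3 : IntegrableOn (fun r : ℝ => A * r ^ a) (Ioc 0 1) := by
      rw [integrableOn_Ioc_iff_integrableOn_Ioo]
      exact ((intervalIntegral.integrableOn_Ioo_rpow_iff one_pos).2 ha).const_mul _
    refine h3.mono' (hg.mono_set Ioc_subset_Ioi_self) ?_
    filter_upwards [ae_restrict_mem measurableSet_Ioc] with r hr using h1 r hr.1 hr.2
  · refine ((integrableOn_Ioi_rpow_of_lt hb one_pos).const_mul B).mono'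
      (hg.mono_set (Ioi_subset_Ioi zero_le_one)) ?_
    filter_upwards [ae_restrict_mem measurableSet_Ioi] with r hr using h2 r hr

lemma integrableOn_exp_mul_rpow {β : ℝ} (hβ : 0 < β) {s : ℂ} (hs : 0 < s.re) :
    IntegrableOn (fun r : ℝ => Complex.exp (-s * r) * ((r ^ (β - 1) : ℝ) : ℂ)) (Ioi 0) := by
  have h1 := integrableOn_rpow_mul_exp_neg_mul_rpow (s := β - 1) (p := 1) (b := s.re)
    (by linarith) one_pos hs
  refine Integrable.mono' h1 ?_ ?_
  · refine Measurable.aestronglyMeasurable ?_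
    fun_prop
  · filter_upwards [ae_restrict_mem measurableSet_Ioi] with r hr
    have hr' : (0 : ℝ) < r := hr
    rw [norm_mul, Complex.norm_exp, Complex.norm_real, Real.norm_eq_abs,
      abs_of_nonneg (by positivity), Complex.re_mul_ofReal, Complex.neg_re, mul_comm,
      Real.rpow_one]

/-- Both sides are analytic in `Re s > 0` and agree on the positive reals by Euler's integral, so
the identity theorem applies. Writing the left side as `complexMGF` of `-r` under the density
`r^{β-1}` provides its analyticity. -/
lemma integral_exp_mul_rpow {β : ℝ} (hβ : 0 < β) {s : ℂ} (hs : 0 < s.re) :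
    ∫ r : ℝ in Ioi 0, Complex.exp (-s * r) * ((r ^ (β - 1) : ℝ) : ℂ)
      = Real.Gamma β * s ^ (-(β : ℂ)) := by
  set μ : Measure ℝ := (volume.restrict (Ioi 0)).withDensity
    (fun r => ENNReal.ofReal (r ^ (β - 1))) with hμ
  have hdens : Measurable (fun r : ℝ => (r ^ (β - 1)).toNNReal) := by fun_prop
  have hval : ∀ s : ℂ, complexMGF (fun r : ℝ => -r) μ s
      = ∫ r : ℝ in Ioi 0, Complex.exp (-s * r) * ((r ^ (β - 1) : ℝ) : ℂ) := by
    intro s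
    rw [complexMGF, hμ]
    erw [integral_withDensity_eq_integral_smul hdens]
    refine setIntegral_congr_fun measurableSet_Ioi fun r hr => ?_
    have hr' : (0 : ℝ) < r := hr
    simp only [NNReal.smul_def, Real.coe_toNNReal _ (Real.rpow_nonneg hr'.le (β - 1)),
      Complex.real_smul]
    push_cast
    ring_nf
  have hset : Ioi 0 ⊆ integrableExpSet (fun r : ℝ => -r) μ := by
    intro t ht
    have ht' : (0 : ℝ) < t := ht
    change Integrable (fun r : ℝ => Real.exp (t * -r)) μ
    rw [hμ]
    erw [integrable_withDensity_iff_integrable_smul hdens]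
    have h1 := (integrableOn_exp_mul_rpow hβ (s := (t : ℂ)) (by simpa using ht')).norm
    refine h1.congr ?_
    filter_upwards [ae_restrict_mem measurableSet_Ioi] with r hr
    have hr' : (0 : ℝ) < r := hr
    simp only [NNReal.smul_def, Real.coe_toNNReal _ (Real.rpow_nonneg hr'.le (β - 1)), smul_eq_mul]
    rw [norm_mul, Complex.norm_exp, Complex.norm_real, Real.norm_eq_abs,
      abs_of_nonneg (by positivity), Complex.re_mul_ofReal, Complex.neg_re, mul_comm]
    simp
  have hint : Ioi 0 ⊆ interior (integrableExpSet (fun r : ℝ => -r) μ) :=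
    interior_maximal hset isOpen_Ioi
  have hanal : AnalyticOnNhd ℂ (complexMGF (fun r : ℝ => -r) μ) {s | 0 < s.re} := fun s hs =>
    analyticAt_complexMGF (hint hs)
  have hanal2 : AnalyticOnNhd ℂ (fun s : ℂ => Real.Gamma β * s ^ (-(β : ℂ))) {s | 0 < s.re} := by
    intro s hs
    exact analyticAt_const.mul (analyticAt_id.cpow analyticAt_const (Or.inl hs))
  have hreal : ∀ t : ℝ, 0 < t → complexMGF (fun r : ℝ => -r) μ t
      = Real.Gamma β * (t : ℂ) ^ (-(β : ℂ)) := by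
    intro t ht
    rw [hval]
    have h1 := Real.integral_rpow_mul_exp_neg_mul_Ioi hβ ht
    have h2 : ∀ r : ℝ, Complex.exp (-(t : ℂ) * r) * ((r ^ (β - 1) : ℝ) : ℂ)
        = ((r ^ (β - 1) * Real.exp (-(t * r)) : ℝ) : ℂ) := by
      intro r
      push_cast
      ring_nf
    simp_rw [h2]
    rw [integral_complex_ofReal, h1, one_div, Real.inv_rpow ht.le, ← Real.rpow_neg ht.le]
    push_cast
    rw [Complex.ofReal_cpow ht.le]
    push_cast
    ring
  have hfreq : ∃ᶠ w in 𝓝[≠] (1 : ℂ), complexMGF (fun r : ℝ => -r) μ w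
      = Real.Gamma β * w ^ (-(β : ℂ)) := by
    have htend : Tendsto (fun t : ℝ => (t : ℂ)) (𝓝[≠] 1) (𝓝[≠] (1 : ℂ)) := by
      refine tendsto_nhdsWithin_of_tendsto_nhds_of_eventually_within _ ?_ ?_
      · exact (Complex.continuous_ofReal.tendsto' 1 1 (by simp)).mono_left nhdsWithin_le_nhds
      · filter_upwards [self_mem_nhdsWithin] with t ht
        simpa using ht
    refine htend.frequently (Eventually.frequently ?_)
    filter_upwards [nhdsWithin_le_nhds (Ioi_mem_nhds one_pos)] with t ht using hreal t ht
  have := hanal.eqOn_of_preconnected_of_frequently_eq hanal2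
    (convex_halfSpace_re_gt 0).isPreconnected (by simp : (1 : ℂ) ∈ {s : ℂ | 0 < s.re}) hfreq hs
  rw [← hval]
  exact this

/-- The derivative in `r` of `martKernel s (-r)`. -/
noncomputable def martKernelDeriv (s : ℂ) (r : ℝ) : ℂ := s * Complex.exp (-r) - s * Complex.exp (-s * r)

lemma hasDerivAt_cexp_neg_mul (s : ℂ) (r : ℝ) :
    HasDerivAt (fun r : ℝ => Complex.exp (-s * r)) (-s * Complex.exp (-s * r)) r := by
  have h : HasDerivAt (fun r : ℝ => -s * (r : ℂ)) (-s) r := by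
    simpa using (Complex.ofRealCLM.hasDerivAt (x := r)).const_mul (-s)
  simpa [mul_comm] using h.cexp

lemma hasDerivAt_martKernel_neg (s : ℂ) (r : ℝ) :
    HasDerivAt (fun r : ℝ => martKernel s (-r)) (martKernelDeriv s r) r := by
  have h1 := hasDerivAt_cexp_neg_mul s r
  have h2 := hasDerivAt_cexp_neg_mul 1 r
  have h3 := (h1.sub_const 1).sub ((h2.sub_const 1).const_mul s)
  refine (h3.congr_deriv ?_).congr_of_eventuallyEq (.of_forall fun x => ?_)
  · unfold martKernelDeriv; simp; ring
  · unfold martKernel; simp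

lemma hasDerivAt_martKernelDeriv (s : ℂ) (r : ℝ) :
    HasDerivAt (martKernelDeriv s) (s ^ 2 * Complex.exp (-s * r) - s * Complex.exp (-r)) r := by
  have h1 := hasDerivAt_cexp_neg_mul s r
  have h2 := hasDerivAt_cexp_neg_mul 1 r
  have h3 := (h2.const_mul s).sub (h1.const_mul s)
  refine (h3.congr_deriv ?_).congr_of_eventuallyEq (.of_forall fun x => ?_)
  · simp; ring
  · unfold martKernelDeriv; simp

lemma norm_exp_neg_mul_le_one {s : ℂ} (hs : 0 ≤ s.re) {r : ℝ} (hr : 0 ≤ r) :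
    ‖Complex.exp (-s * r)‖ ≤ 1 := by
  rw [Complex.norm_exp, Real.exp_le_one_iff, Complex.re_mul_ofReal, Complex.neg_re]
  nlinarith

lemma norm_exp_neg_le_one {r : ℝ} (hr : 0 ≤ r) : ‖Complex.exp (-r)‖ ≤ 1 := by
  simpa using norm_exp_neg_mul_le_one (s := 1) (by simp) hr

lemma norm_martKernelDeriv_le {s : ℂ} (hs : 0 ≤ s.re) {r : ℝ} (hr : 0 ≤ r) :
    ‖martKernelDeriv s r‖ ≤ 2 * ‖s‖ := by
  unfold martKernelDeriv
  refine (norm_sub_le _ _).trans ?_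
  rw [norm_mul, norm_mul]
  nlinarith [norm_exp_neg_mul_le_one hs hr, norm_exp_neg_le_one hr, norm_nonneg s]

lemma norm_martKernelDeriv_le_mul {s : ℂ} (hs : 0 ≤ s.re) {r : ℝ} (hr : 0 ≤ r) :
    ‖martKernelDeriv s r‖ ≤ (‖s‖ ^ 2 + ‖s‖) * r := by
  have := Convex.norm_image_sub_le_of_norm_hasDerivWithin_le (s := Ici (0 : ℝ))
    (f := martKernelDeriv s) (C := ‖s‖ ^ 2 + ‖s‖)
    (fun x _ => (hasDerivAt_martKernelDeriv s x).hasDerivWithinAt)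
    (fun x hx => ?_) (convex_Ici 0) (mem_Ici.2 le_rfl) (mem_Ici.2 hr)
  · simpa [martKernelDeriv, abs_of_nonneg hr] using this
  · refine (norm_sub_le _ _).trans ?_
    rw [norm_mul, norm_mul, norm_pow]
    have h1 := norm_exp_neg_mul_le_one hs hx
    have h2 := norm_exp_neg_le_one hx
    gcongr
    · exact mul_le_of_le_one_right (by positivity) h1
    · exact mul_le_of_le_one_right (by positivity) h2

lemma norm_martKernel_neg_le_sq {s : ℂ} (hs : 0 ≤ s.re) {r : ℝ} (hr : 0 ≤ r) :
    ‖martKernel s (-r)‖ ≤ (‖s‖ ^ 2 + ‖s‖) * r ^ 2 := by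
  have := Convex.norm_image_sub_le_of_norm_hasDerivWithin_le (s := Icc (0 : ℝ) r)
    (f := fun r : ℝ => martKernel s (-r)) (C := (‖s‖ ^ 2 + ‖s‖) * r)
    (fun x _ => (hasDerivAt_martKernel_neg s x).hasDerivWithinAt)
    (fun x hx => ?_) (convex_Icc 0 r) (left_mem_Icc.2 hr) (right_mem_Icc.2 hr)
  · simpa [martKernel_zero_right, abs_of_nonneg hr, mul_assoc, sq] using this
  · refine (norm_martKernelDeriv_le_mul hs hx.1).trans ?_
    gcongr
    exact hx.2

lemma norm_martKernel_neg_le {s : ℂ} (hs : 0 ≤ s.re) {r : ℝ} (hr : 0 ≤ r) :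
    ‖martKernel s (-r)‖ ≤ 2 + 2 * ‖s‖ := by
  have h1 := norm_exp_neg_mul_le_one hs hr
  have h2 := norm_exp_neg_le_one hr
  have h3 : martKernel s (-r) = Complex.exp (-s * r) - 1 - s * (Complex.exp (-r) - 1) := by
    simp [martKernel]
  rw [h3]
  refine (norm_sub_le _ _).trans (add_le_add ((norm_sub_le _ _).trans ?_) ?_)
  · rw [norm_one]; linarith
  · rw [norm_mul]
    have := norm_sub_le (Complex.exp (-(r : ℂ))) 1
    rw [norm_one] at this
    nlinarith [norm_nonneg s]

lemma hasDerivAt_rpow_ofReal (p : ℝ) {r : ℝ} (hr : 0 < r) :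
    HasDerivAt (fun r : ℝ => ((r ^ p : ℝ) : ℂ)) ((p * r ^ (p - 1) : ℝ) : ℂ) r :=
  (Real.hasDerivAt_rpow_const (Or.inl hr.ne')).ofReal_comp

lemma integrableOn_martKernel_neg_mul_rpow {α : ℝ} (h1 : 1 < α) (h2 : α < 2) {s : ℂ}
    (hs : 0 ≤ s.re) :
    IntegrableOn (fun r : ℝ => martKernel s (-r) * ((r ^ (-α - 1) : ℝ) : ℂ)) (Ioi 0) := by
  refine integrableOn_Ioi_of_norm_le_rpow (a := 1 - α) (b := -α - 1) (A := ‖s‖ ^ 2 + ‖s‖)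
    (B := 2 + 2 * ‖s‖) (by linarith) (by linarith) ?_ ?_ ?_
  · have := continuous_martKernel s
    exact Measurable.aestronglyMeasurable (by fun_prop)
  · intro r hr _
    rw [norm_mul, Complex.norm_real, Real.norm_eq_abs, abs_of_nonneg (by positivity)]
    refine (mul_le_mul_of_nonneg_right (norm_martKernel_neg_le_sq hs hr.le) (by positivity)).trans
      (le_of_eq ?_)
    rw [mul_assoc, show 1 - α = 2 + (-α - 1) by ring, Real.rpow_add hr, Real.rpow_two]
  · intro r hr
    have hr' : 0 < r := by linarith
    rw [norm_mul, Complex.norm_real, Real.norm_eq_abs, abs_of_nonneg (by positivity)]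
    gcongr
    exact norm_martKernel_neg_le hs hr'.le

lemma tendsto_norm_le_rpow_zero {g : ℝ → ℂ} {A p : ℝ} (hp : 0 < p)
    (h : ∀ r, 0 < r → ‖g r‖ ≤ A * r ^ p) : Tendsto g (𝓝[>] 0) (𝓝 0) := by
  refine squeeze_zero_norm' (a := fun r : ℝ => A * r ^ p) ?_ ?_
  · filter_upwards [self_mem_nhdsWithin] with r hr using h r hr
  · have : Tendsto (fun r : ℝ => A * r ^ p) (𝓝 0) (𝓝 (A * 0 ^ p)) :=
      ((Real.continuousAt_rpow_const 0 p (Or.inr hp.le)).tendsto).const_mul A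
    rw [Real.zero_rpow hp.ne', mul_zero] at this
    exact this.mono_left nhdsWithin_le_nhds

lemma tendsto_norm_le_rpow_neg_atTop {g : ℝ → ℂ} {A p : ℝ} (hp : 0 < p)
    (h : ∀ r, 0 < r → ‖g r‖ ≤ A * r ^ (-p)) : Tendsto g atTop (𝓝 0) := by
  refine squeeze_zero_norm' (a := fun r : ℝ => A * r ^ (-p)) ?_ ?_
  · filter_upwards [eventually_gt_atTop 0] with r hr using h r hr
  · simpa using (tendsto_rpow_neg_atTop hp).const_mul A

/-- Two integrations by parts reduce `r^{-α-1}` to `r^{1-α}`, whose Laplace transform is a Gamma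
integral. The boundary terms vanish because the kernel is `O(r²)` and its derivative `O(r)` at `0`
with `α < 2`, while both stay bounded at infinity with `α > 1`. -/
lemma integral_martKernel_neg_of_re_pos {α : ℝ} (h1 : 1 < α) (h2 : α < 2) {s : ℂ}
    (hs : 0 < s.re) :
    ∫ r : ℝ in Ioi 0, martKernel s (-r) * ((r ^ (-α - 1) : ℝ) : ℂ)
      = Real.Gamma (2 - α) / (α * (α - 1)) * (s ^ (α : ℂ) - s) := by
  have hα : (α : ℂ) ≠ 0 := by exact_mod_cast (by linarith : α ≠ 0)
  have hα1 : (α : ℂ) - 1 ≠ 0 := by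
    have : α - 1 ≠ 0 := by linarith
    exact_mod_cast this
  have hs0 : s ≠ 0 := fun h => by simp [h] at hs
  have hint1 : IntegrableOn (fun r : ℝ => martKernelDeriv s r * ((r ^ (-α) : ℝ) : ℂ)) (Ioi 0) := by
    refine integrableOn_Ioi_of_norm_le_rpow (a := 1 - α) (b := -α) (A := ‖s‖ ^ 2 + ‖s‖)
      (B := 2 * ‖s‖) (by linarith) (by linarith) ?_ ?_ ?_
    · unfold martKernelDeriv
      exact Measurable.aestronglyMeasurable (by fun_prop)
    · intro r hr _
      rw [norm_mul, Complex.norm_real, Real.norm_eq_abs, abs_of_nonneg (by positivity)]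
      refine (mul_le_mul_of_nonneg_right (norm_martKernelDeriv_le_mul hs.le hr.le)
        (by positivity)).trans (le_of_eq ?_)
      rw [mul_assoc, sub_eq_add_neg 1 α, Real.rpow_add hr, Real.rpow_one]
    · intro r hr
      have hr' : 0 < r := by linarith
      rw [norm_mul, Complex.norm_real, Real.norm_eq_abs, abs_of_nonneg (by positivity)]
      gcongr
      exact norm_martKernelDeriv_le hs.le hr'.le
  have hi1 := integrableOn_exp_mul_rpow (β := 2 - α) (by linarith) hs
  have hi2 := integrableOn_exp_mul_rpow (β := 2 - α) (by linarith) (s := 1) (by simp)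
  have hint2 : IntegrableOn (fun r : ℝ => (s ^ 2 * Complex.exp (-s * r) - s * Complex.exp (-r))
      * ((r ^ (1 - α) : ℝ) : ℂ)) (Ioi 0) := by
    refine ((hi1.const_mul (s ^ 2)).sub (hi2.const_mul s)).congr (.of_forall fun r => ?_)
    simp only [Pi.sub_apply, neg_mul, one_mul, show 2 - α - 1 = 1 - α by ring]
    ring
  -- first integration by parts
  have p1 := integral_Ioi_mul_deriv_eq_deriv_mul (a := (0 : ℝ)) (a' := (0 : ℂ)) (b' := (0 : ℂ))
    (u := fun r : ℝ => martKernel s (-r)) (u' := martKernelDeriv s)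
    (v := fun r : ℝ => -(1 / α : ℂ) * ((r ^ (-α) : ℝ) : ℂ))
    (v' := fun r : ℝ => ((r ^ (-α - 1) : ℝ) : ℂ))
    (fun r _ => hasDerivAt_martKernel_neg s r)
    (fun r hr => ((hasDerivAt_rpow_ofReal (-α) hr).const_mul (-(1 / α : ℂ))).congr_deriv (by
      push_cast; field_simp))
    (integrableOn_martKernel_neg_mul_rpow h1 h2 hs.le)
    ((hint1.const_mul (-(1 / α : ℂ))).congr (.of_forall fun r => by simp; ring))
    (tendsto_norm_le_rpow_zero (A := (‖s‖ ^ 2 + ‖s‖) * ‖(-(1 / α : ℂ))‖) (p := 2 - α)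
      (by linarith) (fun r hr => by
        rw [Pi.mul_apply, norm_mul, norm_mul, Complex.norm_real, Real.norm_eq_abs,
          abs_of_nonneg (by positivity)]
        refine (mul_le_mul_of_nonneg_right (norm_martKernel_neg_le_sq hs.le hr.le)
          (by positivity)).trans (le_of_eq ?_)
        rw [sub_eq_add_neg 2 α, Real.rpow_add hr, Real.rpow_two]
        ring))
    (tendsto_norm_le_rpow_neg_atTop (A := (2 + 2 * ‖s‖) * ‖(-(1 / α : ℂ))‖) (p := α)
      (by linarith) (fun r hr => by
        rw [Pi.mul_apply, norm_mul, norm_mul, Complex.norm_real, Real.norm_eq_abs,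
          abs_of_nonneg (by positivity), mul_assoc]
        gcongr
        exact norm_martKernel_neg_le hs.le hr.le))
  have p2 := integral_Ioi_mul_deriv_eq_deriv_mul (a := (0 : ℝ)) (a' := (0 : ℂ)) (b' := (0 : ℂ))
    (u := martKernelDeriv s)
    (u' := fun r : ℝ => s ^ 2 * Complex.exp (-s * r) - s * Complex.exp (-r))
    (v := fun r : ℝ => -(1 / (α - 1) : ℂ) * ((r ^ (1 - α) : ℝ) : ℂ))
    (v' := fun r : ℝ => ((r ^ (-α) : ℝ) : ℂ))
    (fun r _ => hasDerivAt_martKernelDeriv s r)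
    (fun r hr => ((hasDerivAt_rpow_ofReal (1 - α) hr).const_mul (-(1 / (α - 1) : ℂ))).congr_deriv (by
      rw [show 1 - α - 1 = -α by ring]; push_cast; field_simp; ring))
    hint1
    ((hint2.const_mul (-(1 / (α - 1) : ℂ))).congr (.of_forall fun r => by
      simp only [Pi.mul_apply]; ring))
    (tendsto_norm_le_rpow_zero (A := (‖s‖ ^ 2 + ‖s‖) * ‖(-(1 / (α - 1) : ℂ))‖) (p := 2 - α)
      (by linarith) (fun r hr => by
        rw [Pi.mul_apply, norm_mul, norm_mul, Complex.norm_real, Real.norm_eq_abs,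
          abs_of_nonneg (by positivity)]
        refine (mul_le_mul_of_nonneg_right (norm_martKernelDeriv_le_mul hs.le hr.le)
          (by positivity)).trans (le_of_eq ?_)
        rw [show 2 - α = 1 + (1 - α) by ring, Real.rpow_add hr, Real.rpow_one]
        ring))
    (tendsto_norm_le_rpow_neg_atTop (A := (2 * ‖s‖) * ‖(-(1 / (α - 1) : ℂ))‖) (p := α - 1)
      (by linarith) (fun r hr => by
        rw [Pi.mul_apply, norm_mul, norm_mul, Complex.norm_real, Real.norm_eq_abs,
          abs_of_nonneg (by positivity), mul_assoc, show -(α - 1) = 1 - α by ring]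
        gcongr
        exact norm_martKernelDeriv_le hs.le hr.le))
  -- The two exponentials are Gamma integrals with parameter `2 - α`, and `s² · s^{-(2-α)} = s^α`.
  have p3 : ∫ r : ℝ in Ioi 0, (s ^ 2 * Complex.exp (-s * r) - s * Complex.exp (-r))
      * ((r ^ (1 - α) : ℝ) : ℂ) = Real.Gamma (2 - α) * (s ^ (α : ℂ) - s) := by
    have e : ∀ r : ℝ, (s ^ 2 * Complex.exp (-s * r) - s * Complex.exp (-r))
        * ((r ^ (1 - α) : ℝ) : ℂ) = s ^ 2 * (Complex.exp (-s * r) * ((r ^ (2 - α - 1) : ℝ) : ℂ))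
          - s * (Complex.exp (-1 * r) * ((r ^ (2 - α - 1) : ℝ) : ℂ)) := by
      intro r
      simp only [neg_mul, one_mul, show 2 - α - 1 = 1 - α by ring]
      ring
    simp_rw [e]
    rw [integral_sub (hi1.const_mul _) (hi2.const_mul _), integral_const_mul, integral_const_mul,
      integral_exp_mul_rpow (by linarith) hs, integral_exp_mul_rpow (by linarith) (by simp),
      Complex.one_cpow]
    have : s ^ (α : ℂ) = s ^ 2 * s ^ (-((2 - α : ℝ) : ℂ)) := by
      rw [← Complex.cpow_natCast s 2, ← Complex.cpow_add _ _ hs0]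
      push_cast
      ring_nf
    rw [this]
    ring
  rw [p1]
  have q1 : ∫ r : ℝ in Ioi 0, martKernelDeriv s r * (-(1 / α : ℂ) * ((r ^ (-α) : ℝ) : ℂ))
      = -(1 / α : ℂ) * ∫ r : ℝ in Ioi 0, martKernelDeriv s r * ((r ^ (-α) : ℝ) : ℂ) := by
    rw [← integral_const_mul]
    congr! 2 with r
    ring
  have q2 : ∫ r : ℝ in Ioi 0, (s ^ 2 * Complex.exp (-s * r) - s * Complex.exp (-r))
        * (-(1 / (α - 1) : ℂ) * ((r ^ (1 - α) : ℝ) : ℂ))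
      = -(1 / (α - 1) : ℂ) * (Real.Gamma (2 - α) * (s ^ (α : ℂ) - s)) := by
    rw [← p3, ← integral_const_mul]
    congr! 2 with r
    ring
  rw [q1, p2, q2]
  field_simp
  ring

end GammaIntegral

/-! ### Extension to the boundary and expansion of the stable part at `α = 2`. -/

section StableCumulant

lemma mem_slitPlane_of_re_nonneg {s : ℂ} (hs : 0 ≤ s.re) (h0 : s ≠ 0) : s ∈ Complex.slitPlane := by
  rw [Complex.mem_slitPlane_iff]
  rcases hs.lt_or_eq with h | h
  · exact Or.inl h
  · right
    intro him
    exact h0 (Complex.ext h.symm him)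

/-- The cumulant of a spectrally negative stable jump density. -/
lemma integral_martKernel_neg {α : ℝ} (h1 : 1 < α) (h2 : α < 2) {s : ℂ} (hs : 0 ≤ s.re)
    (h0 : s ≠ 0) :
    ∫ r : ℝ in Ioi 0, martKernel s (-r) * ((r ^ (-α - 1) : ℝ) : ℂ)
      = Real.Gamma (2 - α) / (α * (α - 1)) * (s ^ (α : ℂ) - s) := by
  -- The digital price uses the imaginary axis, where the Laplace integrals fail to converge
  -- absolutely. The point is approached from inside the half-plane: the left side converges by
  -- domination, the right side by continuity of the power on the slit plane.
  set σ : ℕ → ℂ := fun n => s + ((1 / ((n : ℝ) + 1) : ℝ) : ℂ) with hσ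
  have hσlim : Tendsto σ atTop (𝓝 s) := by
    have := (Complex.continuous_ofReal.tendsto 0).comp
      (tendsto_one_div_add_atTop_nhds_zero_nat (𝕜 := ℝ))
    simpa [hσ] using this.const_add s
  have hσre : ∀ n, 0 < (σ n).re := fun n => by
    simp only [hσ, Complex.add_re, Complex.ofReal_re]
    positivity
  have hσnorm : ∀ n, ‖σ n‖ ≤ ‖s‖ + 1 := fun n => by
    refine (norm_add_le _ _).trans ?_
    rw [Complex.norm_real, Real.norm_eq_abs, abs_of_nonneg (by positivity)]
    gcongr
    rw [div_le_one (by positivity)]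
    linarith [n.cast_nonneg (α := ℝ)]
  set R := ‖s‖ + 1 with hR
  have hR0 : 0 ≤ R := by positivity
  have hbound : IntegrableOn (fun r : ℝ => min ((R ^ 2 + R) * r ^ 2) (2 + 2 * R) * r ^ (-α - 1))
      (Ioi 0) := by
    refine integrableOn_Ioi_of_norm_le_rpow (a := 1 - α) (b := -α - 1) (A := R ^ 2 + R)
      (B := 2 + 2 * R) (by linarith) (by linarith)
      (Measurable.aestronglyMeasurable (by fun_prop)) ?_ ?_
    · intro r hr _
      rw [Real.norm_eq_abs, abs_of_nonneg (by positivity),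
        show 1 - α = 2 + (-α - 1) by ring, Real.rpow_add hr, Real.rpow_two, ← mul_assoc]
      gcongr
      exact min_le_left _ _
    · intro r hr
      have hr' : 0 < r := by linarith
      rw [Real.norm_eq_abs, abs_of_nonneg (by positivity)]
      gcongr
      exact min_le_right _ _
  have hL : Tendsto (fun n => ∫ r : ℝ in Ioi 0, martKernel (σ n) (-r)
      * ((r ^ (-α - 1) : ℝ) : ℂ)) atTop
      (𝓝 (∫ r : ℝ in Ioi 0, martKernel s (-r) * ((r ^ (-α - 1) : ℝ) : ℂ))) := by
    refine tendsto_integral_of_dominated_convergence _ (fun n => ?_) hbound (fun n => ?_) ?_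
    · exact (integrableOn_martKernel_neg_mul_rpow h1 h2 (hσre n).le).aestronglyMeasurable
    · filter_upwards [ae_restrict_mem measurableSet_Ioi] with r hr
      have hr' : 0 < r := hr
      rw [norm_mul, Complex.norm_real, Real.norm_eq_abs, abs_of_nonneg (by positivity)]
      gcongr
      refine le_min ((norm_martKernel_neg_le_sq (hσre n).le hr'.le).trans ?_)
        ((norm_martKernel_neg_le (hσre n).le hr'.le).trans ?_)
      · have := hσnorm n
        gcongr
      · linarith [hσnorm n]
    · refine .of_forall fun r => ?_
      exact (((continuous_martKernel_left (-r)).tendsto s).comp hσlim).mul_const _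
  refine tendsto_nhds_unique hL ?_
  simp_rw [integral_martKernel_neg_of_re_pos h1 h2 (hσre _)]
  refine Tendsto.const_mul _ (Tendsto.sub ?_ hσlim)
  exact ((continuousAt_id.cpow continuousAt_const
    (mem_slitPlane_of_re_nonneg hs h0)).tendsto).comp hσlim

/-- `(2 - α) Γ(-α) = Γ(3 - α) / (α (α - 1))`. -/
noncomputable def gammaCoeff (α : ℝ) : ℝ := Real.Gamma (3 - α) / (α * (α - 1))

lemma gammaCoeff_two : gammaCoeff 2 = 1 / 2 := by
  norm_num [gammaCoeff, Real.Gamma_one]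

lemma gammaCoeff_eq {α : ℝ} (h2 : α < 2) :
    gammaCoeff α = (2 - α) * (Real.Gamma (2 - α) / (α * (α - 1))) := by
  rw [gammaCoeff, show 3 - α = (2 - α) + 1 by ring, Real.Gamma_add_one (by linarith)]
  ring

/-- Source of the constant in `C(z, δ)`: `Γ(3-α)` has derivative `-Γ'(1) = γ_E` at `2`, and `α(α-1)`
has value `2` and derivative `3` there. -/
lemma hasDerivAt_gammaCoeff :
    HasDerivAt gammaCoeff (-((3 - 2 * Real.eulerMascheroniConstant) / 4)) 2 := by
  have h1 : HasDerivAt (fun α : ℝ => Real.Gamma (3 - α)) Real.eulerMascheroniConstant 2 := by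
    have h2 : HasDerivAt Real.Gamma (-Real.eulerMascheroniConstant) (3 - 2) := by
      norm_num
      exact Real.hasDerivAt_Gamma_one
    have h3 : HasDerivAt (fun α : ℝ => 3 - α) (-1) 2 := by
      simpa using (hasDerivAt_id (2 : ℝ)).const_sub 3
    exact (h2.comp 2 h3).congr_deriv (by ring)
  have h4 : HasDerivAt (fun α : ℝ => α * (α - 1)) 3 2 := by
    have := (hasDerivAt_id (2 : ℝ)).mul ((hasDerivAt_id (2 : ℝ)).sub_const 1)
    refine this.congr_deriv ?_
    norm_num
  refine (h1.div h4 (by norm_num)).congr_deriv ?_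
  norm_num [Real.Gamma_one]
  ring

/-- The sign changes because the increment is measured by `2 - α`. -/
lemma tendsto_sub_div_of_hasDerivAt {f : ℝ → ℂ} {f' : ℂ} (h : HasDerivAt f f' 2) :
    Tendsto (fun α : ℝ => (f α - f 2) / ((2 - α : ℝ) : ℂ)) (𝓝[<] 2) (𝓝 (-f')) := by
  have h1 := (hasDerivAt_iff_tendsto_slope.1 h).mono_left
    (nhdsWithin_mono (2 : ℝ) (fun x (hx : x < 2) => (ne_of_lt hx)))
  refine h1.neg.congr' ?_
  filter_upwards [self_mem_nhdsWithin] with α hα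
  have hα' : α - 2 ≠ 0 := by have : α < 2 := hα; linarith
  have h2 : ((2 - α : ℝ) : ℂ) = -((α - 2 : ℝ) : ℂ) := by push_cast; ring
  rw [slope_def_module, h2, div_neg, Complex.real_smul]
  push_cast
  rw [neg_inj]
  ring

/-- First-order expansion at `α = 2` of the stable part of the cumulant. -/
lemma tendsto_stable_cumulant {s : ℂ} (h0 : s ≠ 0) :
    Tendsto (fun α : ℝ => (gammaCoeff α * (s ^ (α : ℂ) - s) - 1 / 2 * (s ^ 2 - s))
        / ((2 - α : ℝ) : ℂ)) (𝓝[<] 2)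
      (𝓝 (-(1 / 2) * s ^ 2 * Complex.log s
        + (3 - 2 * Real.eulerMascheroniConstant) / 4 * s ^ 2
        - (3 - 2 * Real.eulerMascheroniConstant) / 4 * s)) := by
  have h1 : HasDerivAt (fun α : ℝ => s ^ (α : ℂ)) (s ^ 2 * Complex.log s) 2 := by
    have := (hasDerivAt_id ((2 : ℝ) : ℂ)).const_cpow (c := s) (Or.inl h0)
    have := this.comp_ofReal
    simpa using this
  have h2 := (hasDerivAt_gammaCoeff.ofReal_comp).mul (h1.sub_const s)
  have h3 := tendsto_sub_div_of_hasDerivAt h2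
  convert h3 using 2 with α
  · simp [gammaCoeff_two]
  · simp [gammaCoeff_two]
    ring

/-- The derivative of `log` has modulus at most `1` on `Re w ≥ 1` and `log 1 = 0`. The resulting
bound vanishes at `im s = 0`, which keeps the factor `|im s|` on this line. -/
lemma norm_log_le_of_re_eq_one {s : ℂ} (hs : s.re = 1) : ‖Complex.log s‖ ≤ |s.im| := by
  have := Convex.norm_image_sub_le_of_norm_hasDerivWithin_le (s := {w : ℂ | 1 ≤ w.re})
    (f := Complex.log) (f' := fun w => w⁻¹) (C := 1) (x := 1) (y := s)
    (fun w (hw : 1 ≤ w.re) => (Complex.hasDerivAt_log (Or.inl (by linarith))).hasDerivWithinAt)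
    (fun w (hw : 1 ≤ w.re) => ?_) (convex_halfSpace_re_ge 1) (by simp) (by simp [hs])
  · rw [Complex.log_one, sub_zero, one_mul] at this
    refine this.trans ((Complex.norm_le_abs_re_add_abs_im _).trans ?_)
    simp [hs]
  · rw [norm_inv]
    exact inv_le_one_of_one_le₀ (hw.trans (Complex.re_le_norm w))

/-- Both powers are exponentials of multiples of `log s`, so their difference is at most `(2-α)|log
s|` times the larger modulus. A factor `|im s|` must survive near `0`; on the imaginary axis it
comes from `|s|^{3/2}`, whose remaining `|s|^{1/2}` absorbs the logarithm. This is where `α > 3/2`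
matters. -/
lemma norm_cpow_sub_sq_le {α : ℝ} (h1 : 3 / 2 < α) (h2 : α < 2) {s : ℂ} (h0 : s.im ≠ 0)
    (hs : s.re = 0 ∨ s.re = 1) :
    ‖s ^ (α : ℂ) - s ^ 2‖ ≤ 6 * (2 - α) * (|s.im| * (1 + |s.im|) ^ 2) := by
  have hs0 : s ≠ 0 := fun h => h0 (by simp [h])
  have hn : 0 < ‖s‖ := norm_pos_iff.2 hs0
  have hz : 0 < |s.im| := abs_pos.2 h0
  have e1 : s ^ (α : ℂ) = Complex.exp (Complex.log s * α) := by
    rw [Complex.cpow_def_of_ne_zero hs0]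
  have e2 : s ^ 2 = Complex.exp (Complex.log s * (2 : ℝ)) := by
    rw [← Complex.cpow_natCast s 2, Complex.cpow_def_of_ne_zero hs0]
    norm_num
  have e3 : ‖Complex.log s * α - Complex.log s * (2 : ℝ)‖ = (2 - α) * ‖Complex.log s‖ := by
    rw [← mul_sub, ← Complex.ofReal_sub, norm_mul, Complex.norm_real, Real.norm_eq_abs,
      abs_of_neg (by linarith)]
    ring
  have hre : ∀ a : ℝ, (Complex.log s * a).re = Real.log ‖s‖ * a := fun a => by
    rw [Complex.re_mul_ofReal, Complex.log_re]
  have hge : 1 ≤ ‖s‖ → ‖s ^ (α : ℂ) - s ^ 2‖ ≤ ‖s‖ ^ 2 * ((2 - α) * ‖Complex.log s‖) := by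
    intro h
    have hlog := Real.log_nonneg h
    rw [e1, e2, ← e3]
    refine (norm_exp_sub_exp_le (c := Real.log ‖s‖ * 2) ?_ ?_).trans (le_of_eq ?_)
    · rw [hre]; gcongr
    · rw [hre]
    · rw [mul_comm (Real.log ‖s‖), ← Real.log_rpow hn, Real.exp_log (by positivity), Real.rpow_two]
  rcases hs with hs | hs
  · have hnorm : ‖s‖ = |s.im| := by
      have : s = s.im * Complex.I := Complex.ext (by simp [hs]) (by simp)
      rw [this]; simp
    -- The `4` majorizes `π`, the bound for the argument.
    have hlog : ‖Complex.log s‖ ≤ |Real.log ‖s‖| + 4 := by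
      refine (Complex.norm_le_abs_re_add_abs_im _).trans ?_
      rw [Complex.log_re, Complex.log_im]
      have := Complex.abs_arg_le_pi s
      have := Real.pi_lt_four
      linarith
    rcases le_or_gt 1 ‖s‖ with h | h
    · refine (hge h).trans ?_
      rw [abs_of_nonneg (Real.log_nonneg h)] at hlog
      have hl2 := Real.log_le_self hn.le
      rw [← hnorm]
      have h3 : ‖Complex.log s‖ ≤ ‖s‖ + 4 := by linarith
      have h4 : (0 : ℝ) < 2 - α := by linarith
      calc ‖s‖ ^ 2 * ((2 - α) * ‖Complex.log s‖) ≤ ‖s‖ ^ 2 * ((2 - α) * (‖s‖ + 4)) := by gcongr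
        _ = (2 - α) * (‖s‖ * (‖s‖ * (‖s‖ + 4))) := by ring
        _ ≤ (2 - α) * (‖s‖ * (6 * (1 + ‖s‖) ^ 2)) :=
          mul_le_mul_of_nonneg_left (mul_le_mul_of_nonneg_left (by nlinarith) hn.le) h4.le
        _ = _ := by ring
    · have hlneg : Real.log ‖s‖ ≤ 0 := Real.log_nonpos hn.le h.le
      have hb : ‖s ^ (α : ℂ) - s ^ 2‖ ≤ ‖s‖ ^ (3 / 2 : ℝ) * ((2 - α) * ‖Complex.log s‖) := by
        rw [e1, e2, ← e3]
        refine (norm_exp_sub_exp_le (c := Real.log ‖s‖ * (3 / 2)) ?_ ?_).trans (le_of_eq ?_)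
        · rw [hre]
          exact mul_le_mul_of_nonpos_left h1.le hlneg
        · rw [hre]
          exact mul_le_mul_of_nonpos_left (by norm_num) hlneg
        · rw [mul_comm (Real.log ‖s‖), ← Real.log_rpow hn, Real.exp_log (by positivity)]
      refine hb.trans ?_
      rw [abs_of_nonpos hlneg] at hlog
      -- With `w = |s|^{1/2}` one has `-log|s| ≤ 2/w`, so `w|log s| ≤ 2 + 4w ≤ 6`.
      set w := ‖s‖ ^ (1 / 2 : ℝ) with hw
      have hwpos : 0 < w := by positivity
      have hw2 : w * w = ‖s‖ := by
        rw [hw, ← Real.rpow_add hn]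
        norm_num
      have hw3 : ‖s‖ ^ (3 / 2 : ℝ) = ‖s‖ * w := by
        rw [hw, ← Real.rpow_one_add' hn.le (by norm_num)]
        norm_num
      have hwl : -Real.log ‖s‖ ≤ 2 * w⁻¹ := by
        have h5 : Real.log ‖s‖ = 2 * Real.log w := by
          rw [← hw2, Real.log_mul hwpos.ne' hwpos.ne']; ring
        have h6 := Real.log_le_self (inv_pos.2 hwpos).le
        rw [Real.log_inv] at h6
        linarith
      have hw1 : w ≤ 1 := by nlinarith
      rw [hw3, ← hnorm]
      have h4 : (0 : ℝ) < 2 - α := by linarith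
      calc ‖s‖ * w * ((2 - α) * ‖Complex.log s‖)
          ≤ ‖s‖ * w * ((2 - α) * (2 * w⁻¹ + 4)) := by gcongr; linarith
        _ = (2 - α) * (‖s‖ * (2 + 4 * w)) := by field_simp
        _ ≤ (2 - α) * (‖s‖ * (6 * (1 + ‖s‖) ^ 2)) := by
          gcongr
          nlinarith
        _ = _ := by ring
  · have hge1 : 1 ≤ ‖s‖ := by
      have := Complex.re_le_norm s
      linarith
    refine (hge hge1).trans ?_
    have hle : ‖s‖ ≤ 1 + |s.im| := by
      have := Complex.norm_le_abs_re_add_abs_im s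
      rwa [hs, abs_one] at this
    have h4 : (0 : ℝ) < 2 - α := by linarith
    have h5 := norm_log_le_of_re_eq_one hs
    calc ‖s‖ ^ 2 * ((2 - α) * ‖Complex.log s‖)
        ≤ (1 + |s.im|) ^ 2 * ((2 - α) * |s.im|) := by gcongr
      _ = 1 * ((2 - α) * (|s.im| * (1 + |s.im|) ^ 2)) := by ring
      _ ≤ 6 * ((2 - α) * (|s.im| * (1 + |s.im|) ^ 2)) := by
        gcongr
        norm_num
      _ = _ := by ring

/-- Uniform bound for the stable part of the cumulant on the lines `re s = 0` and `re s = 1`. -/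
lemma exists_norm_stable_cumulant_le :
    ∃ A : ℝ, 0 ≤ A ∧ ∀ᶠ α : ℝ in 𝓝[<] 2, ∀ s : ℂ, s.im ≠ 0 → (s.re = 0 ∨ s.re = 1) →
      ‖gammaCoeff α * (s ^ (α : ℂ) - s) - 1 / 2 * (s ^ 2 - s)‖
        ≤ A * (2 - α) * (|s.im| * (1 + |s.im|) ^ 2) := by
  obtain ⟨L, hLpos, hL⟩ := hasDerivAt_gammaCoeff.isBigO_sub.exists_pos
  rw [Asymptotics.isBigOWith_iff] at hL
  -- `L` is the local Lipschitz constant of `gammaCoeff` at `2`. It multiplies `|s^α - s| ≤ 7Q`,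
  -- while the value `1/2` of `gammaCoeff` multiplies `|s^α - s²| ≤ 6(2-α)Q`.
  refine ⟨7 * L + 3, by positivity, ?_⟩
  filter_upwards [nhdsWithin_le_nhds hL, self_mem_nhdsWithin,
    nhdsWithin_le_nhds (Ioi_mem_nhds (show (3 / 2 : ℝ) < 2 by norm_num))] with α hα hα2 hα1 s h0 hs
  have hα2' : α < 2 := hα2
  have hα1' : 3 / 2 < α := hα1
  rw [gammaCoeff_two, Real.norm_eq_abs, Real.norm_eq_abs, abs_of_neg (by linarith : α - 2 < 0)] at hα
  have h1 := norm_cpow_sub_sq_le hα1' hα2' h0 hs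
  set Q := |s.im| * (1 + |s.im|) ^ 2 with hQ
  have hQ0 : 0 ≤ Q := by positivity
  have h2 : ‖s ^ 2 - s‖ ≤ Q := by
    have hz := abs_nonneg s.im
    have e : s ^ 2 - s = s * (s - 1) := by ring
    have n1 := Complex.norm_le_abs_re_add_abs_im s
    have n2 := Complex.norm_le_abs_re_add_abs_im (s - 1)
    rw [e, norm_mul]
    rcases hs with hs | hs
    · simp [hs] at n1 n2
      calc ‖s‖ * ‖s - 1‖ ≤ |s.im| * (1 + |s.im|) := by gcongr
        _ ≤ Q := by
          rw [hQ]
          gcongr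
          nlinarith
    · simp [hs] at n1 n2
      calc ‖s‖ * ‖s - 1‖ ≤ (1 + |s.im|) * |s.im| := by gcongr
        _ ≤ Q := by
          rw [hQ, mul_comm]
          gcongr
          nlinarith
  have e : (gammaCoeff α : ℂ) * (s ^ (α : ℂ) - s) - 1 / 2 * (s ^ 2 - s)
      = ((gammaCoeff α - 1 / 2 : ℝ) : ℂ) * ((s ^ (α : ℂ) - s ^ 2) + (s ^ 2 - s))
        + 1 / 2 * (s ^ (α : ℂ) - s ^ 2) := by
    push_cast
    ring
  rw [e]
  refine (norm_add_le _ _).trans ?_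
  rw [norm_mul, norm_mul, Complex.norm_real, Real.norm_eq_abs]
  have h3 : ‖(s ^ (α : ℂ) - s ^ 2) + (s ^ 2 - s)‖ ≤ 7 * Q := by
    refine (norm_add_le _ _).trans ?_
    nlinarith
  have h4 : ‖(1 / 2 : ℂ)‖ = 1 / 2 := by norm_num
  rw [h4]
  have h5 : 0 ≤ L * -(α - 2) := mul_nonneg hLpos.le (by linarith)
  calc |gammaCoeff α - 1 / 2| * ‖s ^ (α : ℂ) - s ^ 2 + (s ^ 2 - s)‖
        + 1 / 2 * ‖s ^ (α : ℂ) - s ^ 2‖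
      ≤ (L * -(α - 2)) * (7 * Q) + 1 / 2 * (6 * (2 - α) * Q) := by gcongr
    _ = _ := by ring

end StableCumulant

/-! ### Kernel estimates on the lines `Re s = 0` and `Re s = 1`. -/

section KernelOnLines

lemma norm_exp_I_mul_sub_le (y : ℝ) : ‖Complex.exp (Complex.I * y) - 1 - Complex.I * y‖ ≤ 2 * y ^ 2 := by
  rcases le_or_gt |y| 1 with h | h
  · have := Complex.norm_exp_sub_one_sub_id_le (x := Complex.I * y) (by simpa using h)
    simp only [norm_mul, Complex.norm_I, one_mul, Complex.norm_real, Real.norm_eq_abs, sq_abs]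
      at this
    nlinarith [sq_nonneg y]
  · refine (norm_sub_le _ _).trans ?_
    have h1 := Real.norm_exp_I_mul_ofReal_sub_one_le (x := y)
    rw [norm_mul, Complex.norm_I, one_mul, Complex.norm_real]
    rw [Real.norm_eq_abs] at *
    rw [← sq_abs]
    nlinarith

/-- Bound of the kernel on the lines `re s = 0` and `re s = 1`, small for small `im s`. -/
lemma norm_martKernel_le_of_line {δ : ℝ} (hδ : 1 ≤ δ) {s : ℂ} (hs : s.re = 0 ∨ s.re = 1) (x : ℝ) :
    ‖martKernel s x‖ ≤ 6 * (|s.im| * (1 + |s.im|)) * jumpWeight δ x := by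
  set z := s.im with hz
  have hz0 := abs_nonneg z
  have hE1 : Real.exp x ≤ 1 + Real.exp (δ * x) := by
    simpa using exp_mul_le_one_add_exp zero_le_one hδ x
  have hEδ := Real.exp_pos (δ * x)
  have hnE : ‖Complex.exp (x : ℂ)‖ = Real.exp x := by
    rw [Complex.norm_exp, Complex.ofReal_re]
  have hosc := Real.norm_exp_I_mul_ofReal_sub_one_le (x := z * x)
  rw [Real.norm_eq_abs, abs_mul] at hosc
  have hosc2 := norm_exp_I_mul_sub_le (z * x)
  have hnIz : ‖Complex.I * (z : ℂ)‖ = |z| := by simp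
  rcases le_or_gt |x| 1 with hx | hx
  · rw [jumpWeight_of_abs_le_one δ hx]
    have hx2 : 0 ≤ x ^ 2 := sq_nonneg x
    have hexp := norm_cexp_sub_one_sub_le_sq hx
    have hfin : ‖martKernel s x‖ ≤ 6 * (|z| * (1 + |z|)) * x ^ 2 := by
      rcases hs with hs | hs
      · have e0 : s = Complex.I * z := Complex.ext (by simp [hs]) (by simp [hz])
        -- The kernel vanishes at `s = 0`; adding and subtracting `izx` makes this visible, since
        -- each group is `O(|z|)` and also quadratic in `x`.
        have e : martKernel s x = (Complex.exp (Complex.I * ((z * x : ℝ) : ℂ)) - 1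
            - Complex.I * ((z * x : ℝ) : ℂ)) - Complex.I * z * (Complex.exp x - 1 - x) := by
          rw [e0, martKernel]; push_cast; ring_nf
        rw [e]
        refine (norm_sub_le _ _).trans ?_
        rw [norm_mul, hnIz]
        have : |z| * ‖Complex.exp (x : ℂ) - 1 - x‖ ≤ |z| * x ^ 2 := by gcongr
        have hzz : (z * x) ^ 2 = |z| ^ 2 * x ^ 2 := by rw [mul_pow, sq_abs]
        nlinarith [mul_nonneg hz0 hx2, mul_nonneg (sq_nonneg |z|) hx2]
      · have e0 : s = 1 + Complex.I * z := Complex.ext (by simp [hs]) (by simp [hz])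
        -- The same for the zero at `s = 1`, with `e^{sx} = e^x e^{izx}`; the linear terms recombine
        -- into `iz(x(e^x - 1) - (e^x - 1 - x))`.
        have e : martKernel s x = Complex.exp x * (Complex.exp (Complex.I * ((z * x : ℝ) : ℂ)) - 1
            - Complex.I * ((z * x : ℝ) : ℂ)) + Complex.I * z * (x * (Complex.exp x - 1)
              - (Complex.exp x - 1 - x)) := by
          rw [e0, martKernel, show (1 + Complex.I * (z : ℂ)) * x
            = x + Complex.I * ((z * x : ℝ) : ℂ) by push_cast; ring, Complex.exp_add]
          push_cast; ring_nf
        rw [e]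
        refine (norm_add_le _ _).trans ?_
        rw [norm_mul, norm_mul, hnIz, hnE]
        have hE3 : Real.exp x ≤ 3 := by
          have : Real.exp x ≤ Real.exp 1 := Real.exp_le_exp.2 ((le_abs_self x).trans hx)
          linarith [Real.exp_one_lt_d9]
        have h1 : ‖(x : ℂ) * (Complex.exp x - 1) - (Complex.exp x - 1 - x)‖ ≤ 3 * x ^ 2 := by
          refine (norm_sub_le _ _).trans ?_
          have h2 := Complex.norm_exp_sub_one_le (x := (x : ℂ)) (by simpa using hx)
          rw [Complex.norm_real, Real.norm_eq_abs] at h2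
          rw [norm_mul, Complex.norm_real, Real.norm_eq_abs]
          have : |x| * ‖Complex.exp (x : ℂ) - 1‖ ≤ |x| * (2 * |x|) := by gcongr
          rw [← sq_abs] at hexp ⊢
          nlinarith
        have h3 : |z| * ‖(x : ℂ) * (Complex.exp x - 1) - (Complex.exp x - 1 - x)‖
            ≤ |z| * (3 * x ^ 2) := by gcongr
        have h4 : Real.exp x * ‖Complex.exp (Complex.I * ((z * x : ℝ) : ℂ)) - 1
            - Complex.I * ((z * x : ℝ) : ℂ)‖ ≤ 3 * (2 * (z * x) ^ 2) := by gcongr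
        have hzz : (z * x) ^ 2 = |z| ^ 2 * x ^ 2 := by rw [mul_pow, sq_abs]
        nlinarith [mul_nonneg hz0 hx2, mul_nonneg (sq_nonneg |z|) hx2]
    refine hfin.trans ?_
    gcongr
    exact le_mul_of_one_le_right hx2 (by linarith)
  · rw [jumpWeight_of_one_lt_abs δ hx]
    have hE0 := Real.exp_pos x
    have h2 : ‖Complex.I * z * (Complex.exp x - 1)‖ ≤ |z| * (Real.exp x + 1) := by
      rw [norm_mul, hnIz]
      gcongr
      refine (norm_sub_le _ _).trans ?_
      rw [hnE, norm_one]
    have hfin : ‖martKernel s x‖ ≤ |z| * |x| * (2 + 2 * Real.exp x) := by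
      rcases hs with hs | hs
      · have e0 : s = Complex.I * z := Complex.ext (by simp [hs]) (by simp [hz])
        have e : martKernel s x = (Complex.exp (Complex.I * ((z * x : ℝ) : ℂ)) - 1)
            - Complex.I * z * (Complex.exp x - 1) := by
          rw [e0, martKernel]; push_cast; ring_nf
        rw [e]
        refine (norm_sub_le _ _).trans ((add_le_add hosc h2).trans ?_)
        nlinarith [mul_nonneg hz0 (sub_pos.2 hx).le, mul_nonneg (mul_nonneg hz0 (abs_nonneg x)) hE0.le,
          mul_nonneg (mul_nonneg hz0 (sub_pos.2 hx).le) hE0.le]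
      · have e0 : s = 1 + Complex.I * z := Complex.ext (by simp [hs]) (by simp [hz])
        have e : martKernel s x = Complex.exp x * (Complex.exp (Complex.I * ((z * x : ℝ) : ℂ)) - 1)
            - Complex.I * z * (Complex.exp x - 1) := by
          rw [e0, martKernel, show (1 + Complex.I * (z : ℂ)) * x
            = x + Complex.I * ((z * x : ℝ) : ℂ) by push_cast; ring, Complex.exp_add]
          ring
        rw [e]
        refine (norm_sub_le _ _).trans ?_
        rw [norm_mul, hnE]
        have h3 : Real.exp x * ‖Complex.exp (Complex.I * ((z * x : ℝ) : ℂ)) - 1‖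
            ≤ Real.exp x * (|z| * |x|) := by gcongr
        nlinarith [mul_nonneg hz0 (sub_pos.2 hx).le, mul_nonneg (mul_nonneg hz0 (abs_nonneg x)) hE0.le,
          mul_nonneg (mul_nonneg hz0 (sub_pos.2 hx).le) hE0.le]
    refine hfin.trans ?_
    calc |z| * |x| * (2 + 2 * Real.exp x) ≤ |z| * |x| * (6 * (1 + Real.exp (δ * x))) := by
          gcongr
          linarith
      _ = 6 * (|z| * 1) * (|x| * (1 + Real.exp (δ * x))) := by ring
      _ ≤ _ := by
        gcongr
        linarith

/-- The real part of the kernel on the lines `re s = 0` and `re s = 1`. -/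
lemma re_martKernel_of_line {s : ℂ} (hs : s.re = 0 ∨ s.re = 1) (x : ℝ) :
    (martKernel s x).re = -(Real.exp (s.re * x) * (1 - Real.cos (s.im * x))) := by
  have h1 : (Complex.exp (x : ℂ)).re = Real.exp x := by rw [← Complex.ofReal_exp, Complex.ofReal_re]
  have h2 : (s * x).re = s.re * x := Complex.re_mul_ofReal _ _
  have h3 : (s * x).im = s.im * x := Complex.im_mul_ofReal _ _
  rw [martKernel, Complex.sub_re, Complex.sub_re, Complex.exp_re, h2, h3]
  rcases hs with hs | hs
  · simp [hs]
  · simp [hs, h1]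
    ring

end KernelOnLines

/-! ### Cumulant estimates for a jump density on the line. -/

section JumpDensity

/-- Conditions on a function `f` for which `(2 - α) f(x) |x|^{-α-1}` is the jump density of a
near-Gaussian tempered stable model: `f(0-) = S > 0`, `f(0+) = 0`, and exponential decay at `∞`
with rate `δ > 1`. -/
structure JumpDensity (f : ℝ → ℝ) (S δ M : ℝ) : Prop where
  measurable : Measurable f
  nonneg : ∀ x, 0 ≤ f x
  one_lt : 1 < δ
  bound : ∀ x, f x * (1 + Real.exp (δ * x)) ≤ M
  pos : 0 < S
  near : IntegrableOn (fun x => |f x - (Iio 0).indicator (fun _ => S) x| / |x|) (Ioo (-1) 1)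
  lower : ∃ r₀ > 0, ∀ x ∈ Ioo (-r₀) 0, S / 2 ≤ f x

/-- The excess of the density over its stable part. -/
noncomputable def excess (f : ℝ → ℝ) (S x : ℝ) : ℝ := f x - (Iio 0).indicator (fun _ => S) x

/-- The cumulant function `∫ (e^{s x} - 1 - s (eˣ - 1)) (2 - α) f(x) |x|^{-α-1} dx`. -/
noncomputable def jumpCumulant (f : ℝ → ℝ) (α : ℝ) (s : ℂ) : ℂ :=
  ((2 - α : ℝ) : ℂ) * ∫ x, martKernel s x * ((f x * |x| ^ (-α - 1) : ℝ) : ℂ)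

/-- A function dominating `|excess f S x| |x|^{-α-1}` times the kernel, for `3/2 ≤ α ≤ 2`. -/
noncomputable def excessBound (f : ℝ → ℝ) (S δ M x : ℝ) : ℝ :=
  (Ioo (-1) 1).indicator (fun x => (1 + Real.exp δ) * (|excess f S x| / |x|)) x
    + (Ioo (-1) 1)ᶜ.indicator (fun x => (M + 2 * S) * |x| ^ (-(3 / 2) : ℝ)) x

variable {f : ℝ → ℝ} {S δ M : ℝ}

lemma integrableOn_comp_neg_Iio {E : Type*} [NormedAddCommGroup E] {g : ℝ → E}
    (h : IntegrableOn (fun x => g (-x)) (Ioi 0)) : IntegrableOn g (Iio 0) := by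
  have h1 := (Measure.measurePreserving_neg (volume : Measure ℝ)).integrableOn_comp_preimage
    (Homeomorph.neg ℝ).measurableEmbedding (f := fun x => g (-x)) (s := Ioi 0)
  have h2 : (fun x : ℝ => -x) ⁻¹' Ioi 0 = Iio 0 := by ext; simp
  have h3 := h1.2 h
  change IntegrableOn ((fun x => g (-x)) ∘ fun x => -x) ((fun x : ℝ => -x) ⁻¹' Ioi 0) volume at h3
  rw [h2] at h3
  simpa [Function.comp_def] using h3

lemma integrable_of_integrableOn_Ioi {E : Type*} [NormedAddCommGroup E] {g : ℝ → E}
    (h1 : IntegrableOn g (Ioi 0)) (h2 : IntegrableOn (fun x => g (-x)) (Ioi 0)) :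
    Integrable g := by
  rw [← integrableOn_univ, ← Iic_union_Ioi (a := (0 : ℝ)), integrableOn_union]
  exact ⟨(integrableOn_Iic_iff_integrableOn_Iio).2 (integrableOn_comp_neg_Iio h2), h1⟩

lemma JumpDensity.integrable_jumpWeight (h : JumpDensity f S δ M) {α : ℝ} (h1 : 1 < α)
    (h2 : α < 2) : Integrable (fun x => jumpWeight δ x * (f x * |x| ^ (-α - 1))) := by
  have hM : 0 ≤ M := le_trans (mul_nonneg (h.nonneg 0) (by positivity)) (h.bound 0)
  have hmeas : Measurable (fun x => jumpWeight δ x * (f x * |x| ^ (-α - 1))) := by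
    have := (continuous_jumpWeight δ).measurable
    have := h.measurable
    fun_prop
  have hb : ∀ x, ‖jumpWeight δ x * (f x * |x| ^ (-α - 1))‖
      ≤ M * (min (x ^ 2) |x| * |x| ^ (-α - 1)) := by
    intro x
    have h3 := h.nonneg x
    rw [Real.norm_eq_abs, abs_of_nonneg (mul_nonneg (jumpWeight_nonneg _ _) (by positivity))]
    calc jumpWeight δ x * (f x * |x| ^ (-α - 1))
        = (f x * (1 + Real.exp (δ * x))) * (min (x ^ 2) |x| * |x| ^ (-α - 1)) := by
          unfold jumpWeight; ring
      _ ≤ _ := by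
          gcongr
          exact h.bound x
  have hr1 : ∀ r : ℝ, 0 < r → M * (min (r ^ 2) |r| * |r| ^ (-α - 1)) ≤ M * r ^ (1 - α) := by
    intro r hr
    rw [abs_of_pos hr, show 1 - α = 2 + (-α - 1) by ring, Real.rpow_add hr, Real.rpow_two]
    gcongr
    exact min_le_left _ _
  have hr2 : ∀ r : ℝ, 0 < r → M * (min (r ^ 2) |r| * |r| ^ (-α - 1)) ≤ M * r ^ (-α) := by
    intro r hr
    rw [abs_of_pos hr]
    have e := Real.rpow_add hr 1 (-α - 1)
    rw [Real.rpow_one, show 1 + (-α - 1) = -α by ring] at e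
    rw [e]
    gcongr
    exact min_le_right _ _
  refine integrable_of_integrableOn_Ioi
    (integrableOn_Ioi_of_norm_le_rpow (a := 1 - α) (b := -α) (A := M) (B := M) (by linarith)
      (by linarith) hmeas.aestronglyMeasurable
      (fun r hr _ => (hb r).trans (hr1 r hr)) fun r hr => (hb r).trans (hr2 r (by linarith)))
    (integrableOn_Ioi_of_norm_le_rpow (a := 1 - α) (b := -α) (A := M) (B := M) (by linarith)
      (by linarith) (hmeas.comp measurable_neg).aestronglyMeasurable
      (fun r hr _ => (hb (-r)).trans ?_) fun r hr => (hb (-r)).trans ?_)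
  · simpa using hr1 r hr
  · simpa using hr2 r (by linarith)

lemma JumpDensity.measurable_excess (h : JumpDensity f S δ M) : Measurable (excess f S) :=
  h.measurable.sub (measurable_const.indicator measurableSet_Iio)

lemma JumpDensity.abs_excess_mul_le (h : JumpDensity f S δ M) (x : ℝ) :
    |excess f S x| * (1 + Real.exp (δ * x)) ≤ M + 2 * S := by
  have h1 := h.bound x
  have h2 := h.nonneg x
  have hS := h.pos
  have hE := Real.exp_pos (δ * x)
  unfold excess
  by_cases hx : x < 0
  · rw [indicator_of_mem (by exact hx)]
    have h3 : Real.exp (δ * x) ≤ 1 :=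
      Real.exp_le_one_iff.2 (by nlinarith [h.one_lt])
    have h4 : |f x - S| ≤ f x + S := by
      rw [abs_le]; constructor <;> linarith
    calc |f x - S| * (1 + Real.exp (δ * x)) ≤ (f x + S) * (1 + Real.exp (δ * x)) := by gcongr
      _ = f x * (1 + Real.exp (δ * x)) + S * (1 + Real.exp (δ * x)) := by ring
      _ ≤ M + S * 2 := by
        gcongr
        linarith
      _ = _ := by ring
  · rw [indicator_of_notMem (by exact hx), sub_zero, abs_of_nonneg h2]
    linarith

lemma JumpDensity.integrable_excessBound (h : JumpDensity f S δ M) :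
    Integrable (excessBound f S δ M) := by
  refine Integrable.add ?_ ?_
  · rw [integrable_indicator_iff measurableSet_Ioo]
    exact h.near.const_mul _
  · set g : ℝ → ℝ := (Ioo (-1) 1)ᶜ.indicator (fun x => (M + 2 * S) * |x| ^ (-(3 / 2) : ℝ)) with hg
    have hm : Measurable g := Measurable.indicator (by fun_prop) measurableSet_Ioo.compl
    have hb1 : ∀ x, ‖g x‖ ≤ |M + 2 * S| * |x| ^ (-(3 / 2) : ℝ) := by
      intro x
      rw [hg, norm_indicator_eq_indicator_norm]
      refine (indicator_le_self' (fun _ _ => norm_nonneg _) x).trans (le_of_eq ?_)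
      rw [norm_mul, Real.norm_eq_abs, Real.norm_eq_abs, 
        abs_of_nonneg (Real.rpow_nonneg (abs_nonneg x) _)]
    have hb2 : ∀ x, ‖g x‖ ≤ |M + 2 * S| * |x| ^ (0 : ℝ) := by
      intro x
      rw [Real.rpow_zero]
      by_cases hx : x ∈ Ioo (-1 : ℝ) 1
      · rw [hg, indicator_of_notMem (by simpa using hx), norm_zero]
        positivity
      · refine (hb1 x).trans ?_
        gcongr
        refine Real.rpow_le_one_of_one_le_of_nonpos ?_ (by norm_num)
        by_contra h'
        exact hx (abs_lt.1 (not_le.1 h'))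
    refine integrable_of_integrableOn_Ioi
      (integrableOn_Ioi_of_norm_le_rpow (a := 0) (b := -(3 / 2)) (A := |M + 2 * S|)
        (B := |M + 2 * S|) (by norm_num) (by norm_num) hm.aestronglyMeasurable ?_ ?_)
      (integrableOn_Ioi_of_norm_le_rpow (a := 0) (b := -(3 / 2)) (A := |M + 2 * S|)
        (B := |M + 2 * S|) (by norm_num) (by norm_num)
        (hm.comp measurable_neg).aestronglyMeasurable ?_ ?_)
    · intro r hr _
      simpa [abs_of_pos hr] using hb2 r
    · intro r hr
      simpa [abs_of_pos (zero_lt_one.trans hr)] using hb1 r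
    · intro r hr _
      simpa [abs_of_pos hr] using hb2 (-r)
    · intro r hr
      simpa [abs_of_pos (zero_lt_one.trans hr)] using hb1 (-r)

/-- The majorant is uniform up to and including `α = 2`. Near `0`, `x²|x|^{-α-1} ≤ 1/|x|` meets the
integrability condition on the excess; for `|x| ≥ 1`, `|x|·|x|^{-α-1} ≤ |x|^{-3/2}` because `α ≥
3/2`. -/
lemma JumpDensity.jumpWeight_mul_excess_le (h : JumpDensity f S δ M) {α : ℝ} (h1 : 3 / 2 ≤ α)
    (h2 : α ≤ 2) (x : ℝ) :
    jumpWeight δ x * (|excess f S x| * |x| ^ (-α - 1)) ≤ excessBound f S δ M x := by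
  have hS := h.pos
  have hM : 0 ≤ M := le_trans (mul_nonneg (h.nonneg 0) (by positivity)) (h.bound 0)
  have hδ := h.one_lt
  unfold excessBound
  by_cases hx : x ∈ Ioo (-1 : ℝ) 1
  · rw [indicator_of_mem hx, indicator_of_notMem (by simpa using hx), add_zero]
    have hx1 : |x| < 1 := abs_lt.2 hx
    rw [jumpWeight_of_abs_le_one δ hx1.le]
    rcases eq_or_ne x 0 with rfl | hx0
    · simp
    · have hpos : 0 < |x| := abs_pos.2 hx0
      have e1 : Real.exp (δ * x) ≤ Real.exp δ := by
        rw [Real.exp_le_exp]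
        have := (le_abs_self x).trans hx1.le
        nlinarith
      have e2 : x ^ 2 * |x| ^ (-α - 1) ≤ |x|⁻¹ := by
        rw [← sq_abs, ← Real.rpow_two, ← Real.rpow_add hpos, ← Real.rpow_neg_one]
        exact Real.rpow_le_rpow_of_exponent_ge hpos hx1.le (by linarith)
      calc x ^ 2 * (1 + Real.exp (δ * x)) * (|excess f S x| * |x| ^ (-α - 1))
          = (1 + Real.exp (δ * x)) * (|excess f S x| * (x ^ 2 * |x| ^ (-α - 1))) := by ring
        _ ≤ (1 + Real.exp δ) * (|excess f S x| * |x|⁻¹) := by gcongr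
        _ = _ := by rw [div_eq_mul_inv]
  · rw [indicator_of_notMem hx, indicator_of_mem (by simpa using hx), zero_add]
    have hx1 : 1 ≤ |x| := by
      by_contra h'
      exact hx (abs_lt.1 (not_le.1 h'))
    have hpos : 0 < |x| := by linarith
    have e2 : |x| * |x| ^ (-α - 1) ≤ |x| ^ (-(3 / 2) : ℝ) := by
      have e := Real.rpow_add hpos 1 (-α - 1)
      rw [Real.rpow_one, show 1 + (-α - 1) = -α by ring] at e
      rw [← e]
      exact Real.rpow_le_rpow_of_exponent_le hx1 (by linarith)
    have e3 := h.abs_excess_mul_le x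
    unfold jumpWeight
    calc min (x ^ 2) |x| * (1 + Real.exp (δ * x)) * (|excess f S x| * |x| ^ (-α - 1))
        ≤ |x| * (1 + Real.exp (δ * x)) * (|excess f S x| * |x| ^ (-α - 1)) := by
          gcongr
          exact min_le_right _ _
      _ = (|excess f S x| * (1 + Real.exp (δ * x))) * (|x| * |x| ^ (-α - 1)) := by ring
      _ ≤ _ := by gcongr

lemma JumpDensity.norm_kernel_mul_excess_le (h : JumpDensity f S δ M) {α : ℝ} (h1 : 3 / 2 ≤ α)
    (h2 : α ≤ 2) {k : ℂ} {C x : ℝ} (hC : 0 ≤ C) (hk : ‖k‖ ≤ C * jumpWeight δ x) :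
    ‖k * ((excess f S x * |x| ^ (-α - 1) : ℝ) : ℂ)‖ ≤ C * excessBound f S δ M x := by
  rw [norm_mul, Complex.norm_real, norm_mul, Real.norm_eq_abs, Real.norm_eq_abs,
    abs_of_nonneg (by positivity : 0 ≤ |x| ^ (-α - 1))]
  calc ‖k‖ * (|excess f S x| * |x| ^ (-α - 1))
      ≤ C * jumpWeight δ x * (|excess f S x| * |x| ^ (-α - 1)) := by gcongr
    _ = C * (jumpWeight δ x * (|excess f S x| * |x| ^ (-α - 1))) := by ring
    _ ≤ _ := by
      gcongr
      exact h.jumpWeight_mul_excess_le h1 h2 x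

lemma JumpDensity.aestronglyMeasurable_mul_excess (h : JumpDensity f S δ M) (α : ℝ) {k : ℝ → ℂ}
    (hk : Measurable k) :
    AEStronglyMeasurable (fun x => k x * ((excess f S x * |x| ^ (-α - 1) : ℝ) : ℂ)) volume := by
  have := h.measurable_excess
  exact Measurable.aestronglyMeasurable (by fun_prop)

lemma JumpDensity.integrable_mul_excess (h : JumpDensity f S δ M) {α : ℝ} (h1 : 3 / 2 ≤ α)
    (h2 : α ≤ 2) {k : ℝ → ℂ} (hm : Measurable k) {C : ℝ} (hC : 0 ≤ C)
    (hk : ∀ x, ‖k x‖ ≤ C * jumpWeight δ x) :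
    Integrable (fun x => k x * ((excess f S x * |x| ^ (-α - 1) : ℝ) : ℂ)) :=
  (h.integrable_excessBound.const_mul C).mono' (h.aestronglyMeasurable_mul_excess α hm)
    (.of_forall fun x => h.norm_kernel_mul_excess_le h1 h2 hC (hk x))

lemma JumpDensity.integrable_martKernel_mul_excess (h : JumpDensity f S δ M) {α : ℝ}
    (h1 : 3 / 2 ≤ α) (h2 : α ≤ 2) {s : ℂ} (hs0 : 0 ≤ s.re) (hs1 : s.re ≤ δ) :
    Integrable (fun x => martKernel s x * ((excess f S x * |x| ^ (-α - 1) : ℝ) : ℂ)) :=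
  h.integrable_mul_excess h1 h2 (continuous_martKernel s).measurable (by positivity)
    (norm_martKernel_le h.one_lt.le hs0 hs1 le_rfl)

lemma JumpDensity.tendsto_integral_mul_excess (h : JumpDensity f S δ M) {s : ℂ} (hs0 : 0 ≤ s.re)
    (hs1 : s.re ≤ δ) :
    Tendsto (fun α : ℝ => ∫ x, martKernel s x * ((excess f S x * |x| ^ (-α - 1) : ℝ) : ℂ)) (𝓝[<] 2)
      (𝓝 (∫ x, martKernel s x * ((excess f S x * |x| ^ (-2 - 1 : ℝ) : ℝ) : ℂ))) := by
  refine tendsto_integral_filter_of_dominated_convergence _ (.of_forall fun α =>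
    h.aestronglyMeasurable_mul_excess α (continuous_martKernel s).measurable) ?_
    (h.integrable_excessBound.const_mul (‖s‖ ^ 2 * Real.exp ‖s‖ + 3 * ‖s‖ + 2)) ?_
  · filter_upwards [self_mem_nhdsWithin,
      nhdsWithin_le_nhds (Ioi_mem_nhds (show (3 / 2 : ℝ) < 2 by norm_num))] with α hα2 hα1
    exact .of_forall fun x => h.norm_kernel_mul_excess_le (le_of_lt hα1) (le_of_lt hα2)
      (by positivity) (norm_martKernel_le h.one_lt.le hs0 hs1 le_rfl x)
  · refine .of_forall fun x => ?_
    rcases eq_or_ne x 0 with rfl | hx0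
    · simp [martKernel_zero_right]
    · refine Tendsto.const_mul _ ((Complex.continuous_ofReal.tendsto _).comp (Tendsto.const_mul _ ?_))
      have hc : Continuous (fun α : ℝ => |x| ^ (-α - 1)) :=
        Real.continuous_const_rpow (abs_pos.2 hx0).ne' |>.comp (by fun_prop)
      exact (hc.tendsto 2).mono_left nhdsWithin_le_nhds

lemma JumpDensity.norm_integral_mul_excess_le (h : JumpDensity f S δ M) {α : ℝ}
    (h1 : 3 / 2 ≤ α) (h2 : α ≤ 2) {s : ℂ} (hs : s.re = 0 ∨ s.re = 1) :
    ‖∫ x, martKernel s x * ((excess f S x * |x| ^ (-α - 1) : ℝ) : ℂ)‖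
      ≤ 6 * (|s.im| * (1 + |s.im|)) * ∫ x, excessBound f S δ M x := by
  rw [← integral_const_mul]
  exact norm_integral_le_of_norm_le (h.integrable_excessBound.const_mul _) (.of_forall fun x =>
    h.norm_kernel_mul_excess_le h1 h2 (by positivity) (norm_martKernel_le_of_line h.one_lt.le hs x))

/-- Decomposition of the cumulant into its stable part and the excess. -/
lemma JumpDensity.jumpCumulant_eq (h : JumpDensity f S δ M) {α : ℝ} (h1 : 3 / 2 ≤ α)
    (h2 : α < 2) {s : ℂ} (hs0 : 0 ≤ s.re) (hs1 : s.re ≤ δ) (h0 : s ≠ 0) :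
    jumpCumulant f α s = S * (gammaCoeff α * (s ^ (α : ℂ) - s)) + ((2 - α : ℝ) : ℂ)
      * ∫ x, martKernel s x * ((excess f S x * |x| ^ (-α - 1) : ℝ) : ℂ) := by
  have e1 : ∀ x, martKernel s x * ((f x * |x| ^ (-α - 1) : ℝ) : ℂ)
      = (Iio 0).indicator (fun x => S * (martKernel s x * ((|x| ^ (-α - 1) : ℝ) : ℂ))) x
        + martKernel s x * ((excess f S x * |x| ^ (-α - 1) : ℝ) : ℂ) := by
    intro x
    unfold excess
    by_cases hx : x ∈ Iio (0 : ℝ)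
    · rw [indicator_of_mem hx, indicator_of_mem hx]
      push_cast
      ring
    · rw [indicator_of_notMem hx, indicator_of_notMem hx]
      push_cast
      ring
  have i1 : IntegrableOn (fun x => (S : ℂ) * (martKernel s x * ((|x| ^ (-α - 1) : ℝ) : ℂ)))
      (Iio 0) := by
    have i0 : IntegrableOn (fun x => martKernel s x * ((|x| ^ (-α - 1) : ℝ) : ℂ)) (Iio 0) := by
      refine integrableOn_comp_neg_Iio ?_
      refine (integrableOn_martKernel_neg_mul_rpow (by linarith) h2 hs0).congr ?_
      filter_upwards [ae_restrict_mem measurableSet_Ioi] with r hr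
      rw [abs_neg, abs_of_pos hr]
    exact i0.const_mul _
  have v1 : ∫ x in Iio (0 : ℝ), (S : ℂ) * (martKernel s x * ((|x| ^ (-α - 1) : ℝ) : ℂ))
      = S * (Real.Gamma (2 - α) / (α * (α - 1)) * (s ^ (α : ℂ) - s)) := by
    rw [← integral_martKernel_neg (by linarith) h2 hs0 h0, integral_const_mul]
    congr 1
    have := integral_comp_neg_Ioi (0 : ℝ) (fun x => martKernel s x * ((|x| ^ (-α - 1) : ℝ) : ℂ))
    rw [neg_zero] at this
    rw [← integral_Iic_eq_integral_Iio, ← this]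
    refine setIntegral_congr_fun measurableSet_Ioi fun r hr => ?_
    simp only [abs_neg]
    rw [abs_of_pos hr]
  -- The factor `2 - α` is absorbed by the pole of `Γ(2-α)` in the stable part, through
  -- `gammaCoeff_eq`, but stays in front of the excess.
  rw [jumpCumulant]
  simp_rw [e1]
  rw [integral_add (i1.integrable_indicator measurableSet_Iio)
    (h.integrable_martKernel_mul_excess h1 h2.le hs0 hs1), integral_indicator measurableSet_Iio, v1,
    gammaCoeff_eq h2]
  push_cast
  ring

/-- First-order expansion of the cumulant at `α = 2`. -/
lemma JumpDensity.tendsto_jumpCumulant (h : JumpDensity f S δ M) {s : ℂ} (hs0 : 0 ≤ s.re)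
    (hs1 : s.re ≤ δ) (h0 : s ≠ 0) :
    Tendsto (fun α : ℝ => (jumpCumulant f α s - S * (1 / 2 * (s ^ 2 - s))) / ((2 - α : ℝ) : ℂ))
      (𝓝[<] 2)
      (𝓝 (S * (-(1 / 2) * s ^ 2 * Complex.log s
        + (3 - 2 * Real.eulerMascheroniConstant) / 4 * s ^ 2
        - (3 - 2 * Real.eulerMascheroniConstant) / 4 * s)
        + ∫ x, martKernel s x * ((excess f S x * |x| ^ (-2 - 1 : ℝ) : ℝ) : ℂ))) := by
  refine (((tendsto_stable_cumulant h0).const_mul (S : ℂ)).add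
    (h.tendsto_integral_mul_excess hs0 hs1)).congr' ?_
  filter_upwards [self_mem_nhdsWithin,
      nhdsWithin_le_nhds (Ioi_mem_nhds (show (3 / 2 : ℝ) < 2 by norm_num))] with α hα2 hα1
  rw [h.jumpCumulant_eq (le_of_lt hα1) hα2 hs0 hs1 h0]
  have hne : ((2 - α : ℝ) : ℂ) ≠ 0 := by
    have : (2 - α : ℝ) ≠ 0 := (sub_pos.2 hα2).ne'
    exact_mod_cast this
  field_simp
  ring

lemma JumpDensity.exists_norm_jumpCumulant_sub_le (h : JumpDensity f S δ M) :
    ∃ A : ℝ, 0 ≤ A ∧ ∀ᶠ α : ℝ in 𝓝[<] 2, ∀ s : ℂ, s.im ≠ 0 → (s.re = 0 ∨ s.re = 1) →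
      ‖jumpCumulant f α s - S * (1 / 2 * (s ^ 2 - s))‖
        ≤ A * (2 - α) * (|s.im| * (1 + |s.im|) ^ 2) := by
  obtain ⟨A, hA0, hA⟩ := exists_norm_stable_cumulant_le
  have hS := h.pos
  have hD : 0 ≤ ∫ x, excessBound f S δ M x := integral_nonneg fun x =>
    le_trans (mul_nonneg (jumpWeight_nonneg δ x) (by positivity))
      (h.jumpWeight_mul_excess_le (α := 2) (by norm_num) le_rfl x)
  refine ⟨S * A + 6 * ∫ x, excessBound f S δ M x, by positivity, ?_⟩
  filter_upwards [hA, self_mem_nhdsWithin,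
      nhdsWithin_le_nhds (Ioi_mem_nhds (show (3 / 2 : ℝ) < 2 by norm_num))] with α hα hα2 hα1 s h0 hs
  have hα2' : α < 2 := hα2
  have hs0 : 0 ≤ s.re := by rcases hs with hs | hs <;> simp [hs]
  have hs1 : s.re ≤ δ := by rcases hs with hs | hs <;> rw [hs] <;> linarith [h.one_lt]
  rw [h.jumpCumulant_eq (le_of_lt hα1) hα2 hs0 hs1 fun hz => h0 (by simp [hz])]
  have e : (S : ℂ) * (gammaCoeff α * (s ^ (α : ℂ) - s)) + ((2 - α : ℝ) : ℂ)
      * (∫ x, martKernel s x * ((excess f S x * |x| ^ (-α - 1) : ℝ) : ℂ))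
        - S * (1 / 2 * (s ^ 2 - s))
      = S * (gammaCoeff α * (s ^ (α : ℂ) - s) - 1 / 2 * (s ^ 2 - s)) + ((2 - α : ℝ) : ℂ)
        * ∫ x, martKernel s x * ((excess f S x * |x| ^ (-α - 1) : ℝ) : ℂ) := by ring
  rw [e]
  refine (norm_add_le _ _).trans ?_
  rw [norm_mul, norm_mul, Complex.norm_real, Complex.norm_real, Real.norm_eq_abs, Real.norm_eq_abs,
    abs_of_pos hS, abs_of_pos (sub_pos.2 hα2')]
  have b1 := hα s h0 hs
  have b2 := h.norm_integral_mul_excess_le (le_of_lt hα1) hα2'.le hs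
  have hz := abs_nonneg s.im
  have h2α : 0 < 2 - α := sub_pos.2 hα2'
  calc S * ‖(gammaCoeff α : ℂ) * (s ^ (α : ℂ) - s) - 1 / 2 * (s ^ 2 - s)‖ + (2 - α)
        * ‖∫ x, martKernel s x * ((excess f S x * |x| ^ (-α - 1) : ℝ) : ℂ)‖
      ≤ S * (A * (2 - α) * (|s.im| * (1 + |s.im|) ^ 2)) + (2 - α)
        * (6 * (|s.im| * (1 + |s.im|) ^ 2) * ∫ x, excessBound f S δ M x) := by
        refine add_le_add (mul_le_mul_of_nonneg_left b1 hS.le)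
          (mul_le_mul_of_nonneg_left (b2.trans ?_) h2α.le)
        gcongr
        nlinarith
    _ = _ := by ring

/-- The factor `1/(2-α)` compensates the scaling `2-α` of the jump density; this is what makes the
decay of the characteristic functions uniform in `α`. -/
lemma integral_abs_rpow_Ioo {α b : ℝ} (h2 : α < 2) (hb : 0 < b) :
    IntegrableOn (fun x : ℝ => |x| ^ (1 - α)) (Ioo (-b) 0) ∧
      ∫ x in Ioo (-b) 0, |x| ^ (1 - α) = b ^ (2 - α) / (2 - α) := by
  have h1 : IntervalIntegrable (fun x : ℝ => |x| ^ (1 - α)) volume 0 b := by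
    refine (intervalIntegral.intervalIntegrable_rpow' (r := 1 - α) (by linarith)).congr ?_
    intro x hx
    rw [uIoc_of_le hb.le] at hx
    simp only
    rw [abs_of_pos hx.1]
  have h3 : IntervalIntegrable (fun x : ℝ => |x| ^ (1 - α)) volume (-b) 0 := by
    have := (IntervalIntegrable.iff_comp_neg (by simp)).1 h1
    simp only [abs_neg, neg_zero] at this
    exact this.symm
  constructor
  · rw [intervalIntegrable_iff_integrableOn_Ioo_of_le (by linarith)] at h3
    exact h3
  · rw [← integral_Ioc_eq_integral_Ioo, ← intervalIntegral.integral_of_le (by linarith)]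
    have := intervalIntegral.integral_comp_neg (a := 0) (b := b) (fun x : ℝ => |x| ^ (1 - α))
    simp only [abs_neg, neg_zero] at this
    rw [← this, intervalIntegral.integral_congr (g := fun x : ℝ => x ^ (1 - α)),
      integral_rpow (Or.inl (by linarith)), Real.zero_rpow (by linarith)]
    · rw [show 1 - α + 1 = 2 - α by ring, sub_zero]
    · intro x hx
      rw [uIcc_of_le hb.le] at hx
      simp only
      rw [abs_of_nonneg hx.1]

lemma JumpDensity.integrable_martKernel_mul (h : JumpDensity f S δ M) {α : ℝ} (h1 : 1 < α)
    (h2 : α < 2) {s : ℂ} (hs0 : 0 ≤ s.re) (hs1 : s.re ≤ δ) :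
    Integrable (fun x => martKernel s x * ((f x * |x| ^ (-α - 1) : ℝ) : ℂ)) := by
  refine ((h.integrable_jumpWeight h1 h2).const_mul
    (‖s‖ ^ 2 * Real.exp ‖s‖ + 3 * ‖s‖ + 2)).mono' ?_ (.of_forall fun x => ?_)
  · have := (continuous_martKernel s).measurable
    have := h.measurable
    exact Measurable.aestronglyMeasurable (by fun_prop)
  · have h3 := h.nonneg x
    have h4 : 0 ≤ f x * |x| ^ (-α - 1) := by positivity
    rw [norm_mul, Complex.norm_real, Real.norm_eq_abs, abs_of_nonneg h4, ← mul_assoc (_ + _ + _)]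
    exact mul_le_mul_of_nonneg_right (norm_martKernel_le h.one_lt.le hs0 hs1 le_rfl x) h4

/-- Decay of the characteristic functions, uniformly in `α`. -/
lemma JumpDensity.exists_re_jumpCumulant_le (h : JumpDensity f S δ M) :
    ∃ c R : ℝ, 0 < c ∧ ∀ α ∈ Ioo (3 / 2 : ℝ) 2, ∀ s : ℂ, (s.re = 0 ∨ s.re = 1) →
      (jumpCumulant f α s).re ≤ c * (R - |s.im|) := by
  obtain ⟨r₀, hr₀, hlow⟩ := h.lower
  have hS := h.pos
  -- The factors are the lower bound of `f` left of `0`, the bound of `e^{Re s·x}` for `x > -1`, and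
  -- the constant in `1 - cos u ≥ 2u²/π²` for `|u| ≤ π`.
  set c : ℝ := S / 2 * Real.exp (-1) * (2 / Real.pi ^ 2) with hc
  have hcpos : 0 < c := by positivity
  -- For `|im s| ≥ R` the window `(-1/|im s|, 0)` lies in `(-1, 0)` and in the region where `f ≥
  -- S/2`. For smaller `|im s|` the claim follows from `Re κ_α ≤ 0`.
  set R : ℝ := max 1 r₀⁻¹ with hR
  refine ⟨c, R, hcpos, fun α hα s hs => ?_⟩
  have h2α : 0 < 2 - α := by linarith [hα.2]
  have hs0 : 0 ≤ s.re := by rcases hs with hs | hs <;> simp [hs]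
  have hs1 : s.re ≤ 1 := by rcases hs with hs | hs <;> simp [hs]
  have hint := h.integrable_martKernel_mul (by linarith [hα.1]) hα.2 hs0
    (hs1.trans h.one_lt.le)
  set G : ℝ → ℝ := fun x => Real.exp (s.re * x) * (1 - Real.cos (s.im * x))
    * (f x * |x| ^ (-α - 1)) with hG
  have hGre : ∀ x, (martKernel s x * ((f x * |x| ^ (-α - 1) : ℝ) : ℂ)).re = -G x := fun x => by
    rw [Complex.re_mul_ofReal, re_martKernel_of_line hs]
    simp only [hG]
    ring
  have hGint : Integrable G := by
    have := hint.re.neg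
    refine this.congr (.of_forall fun x => ?_)
    have := hGre x
    simp only [Pi.neg_apply, RCLike.re_eq_complex_re]
    rw [this, neg_neg]
  have hG0 : ∀ x, 0 ≤ G x := fun x => by
    have h3 := h.nonneg x
    have h4 := Real.cos_le_one (s.im * x)
    have : 0 ≤ 1 - Real.cos (s.im * x) := by linarith
    simp only [hG]
    positivity
  have hre : (jumpCumulant f α s).re = -((2 - α) * ∫ x, G x) := by
    rw [jumpCumulant, Complex.re_ofReal_mul]
    have : (∫ x, martKernel s x * ((f x * |x| ^ (-α - 1) : ℝ) : ℂ)).re = ∫ x, -G x := by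
      rw [← integral_congr_ae (.of_forall hGre)]
      exact (integral_re hint).symm
    rw [this, integral_neg]
    ring
  rw [hre]
  have hGnn : 0 ≤ ∫ x, G x := integral_nonneg hG0
  rcases lt_or_ge |s.im| R with hz | hz
  · have : 0 ≤ c * (R - |s.im|) := mul_nonneg hcpos.le (by linarith)
    have : 0 ≤ (2 - α) * ∫ x, G x := by positivity
    linarith
  · have hz1 : 1 ≤ |s.im| := (le_max_left _ _).trans hz
    have hzpos : 0 < |s.im| := by linarith
    -- On `(-b, 0)` the argument of the cosine is at most `1` in modulus, and the integral over the
    -- window is of order `|im s|²b^{2-α} = |im s|^α ≥ |im s|`.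
    set b := |s.im|⁻¹ with hb
    have hbpos : 0 < b := inv_pos.2 hzpos
    have hb1 : b ≤ 1 := inv_le_one_of_one_le₀ hz1
    have hbr : b ≤ r₀ := by
      rw [hb, inv_le_comm₀ hzpos hr₀]
      exact (le_max_right _ _).trans hz
    obtain ⟨hi, hv⟩ := integral_abs_rpow_Ioo hα.2 hbpos
    have hlower : ∀ x ∈ Ioo (-b) 0, c * s.im ^ 2 * |x| ^ (1 - α) ≤ G x := by
      intro x hx
      have hxpos : 0 < |x| := abs_pos.2 hx.2.ne
      have hxb : |x| < b := by rw [abs_of_neg hx.2]; linarith [hx.1]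
      have f1 : S / 2 ≤ f x := hlow x ⟨by linarith [hx.1], hx.2⟩
      have f2 : Real.exp (-1) ≤ Real.exp (s.re * x) := by
        rw [Real.exp_le_exp]
        nlinarith [hx.1, hx.2]
      have f3 : 2 / Real.pi ^ 2 * (s.im * x) ^ 2 ≤ 1 - Real.cos (s.im * x) := by
        have habs : |s.im * x| ≤ Real.pi := by
          rw [abs_mul]
          have : |s.im| * |x| ≤ |s.im| * b := by gcongr
          rw [hb, mul_inv_cancel₀ hzpos.ne'] at this
          linarith [Real.pi_gt_three]
        linarith [Real.cos_le_one_sub_mul_cos_sq habs]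
      have f4 : |x| ^ (1 - α) = x ^ 2 * |x| ^ (-α - 1) := by
        rw [← sq_abs, ← Real.rpow_two, ← Real.rpow_add hxpos]
        ring_nf
      calc c * s.im ^ 2 * |x| ^ (1 - α) = Real.exp (-1) * (2 / Real.pi ^ 2 * (s.im * x) ^ 2)
            * (S / 2 * |x| ^ (-α - 1)) := by rw [f4, hc]; ring
        _ ≤ G x := by
          have f5 : 0 ≤ 1 - Real.cos (s.im * x) := by linarith [Real.cos_le_one (s.im * x)]
          have f6 : 0 ≤ Real.exp (s.re * x) * (1 - Real.cos (s.im * x)) := by positivity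
          simp only [hG]
          gcongr
    have hmain : c * s.im ^ 2 * (b ^ (2 - α) / (2 - α)) ≤ ∫ x, G x := by
      rw [← hv, ← integral_const_mul]
      refine (setIntegral_mono_on (hi.const_mul _) hGint.integrableOn measurableSet_Ioo
        hlower).trans ?_
      exact setIntegral_le_integral hGint (.of_forall hG0)
    have hpow : |s.im| ≤ s.im ^ 2 * b ^ (2 - α) := by
      rw [← sq_abs, hb, Real.inv_rpow hzpos.le, ← Real.rpow_neg hzpos.le, ← Real.rpow_two,
        ← Real.rpow_add hzpos]
      conv_lhs => rw [← Real.rpow_one |s.im|]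
      exact Real.rpow_le_rpow_of_exponent_le hz1 (by linarith [hα.1])
    have hfin : c * |s.im| ≤ (2 - α) * ∫ x, G x := by
      calc c * |s.im| ≤ c * (s.im ^ 2 * b ^ (2 - α)) := by gcongr
        _ = (2 - α) * (c * s.im ^ 2 * (b ^ (2 - α) / (2 - α))) := by field_simp
        _ ≤ _ := by gcongr
    have hRpos : 0 ≤ c * R := mul_nonneg hcpos.le (zero_le_one.trans (le_max_left _ _))
    linarith [mul_sub c R |s.im|]

end JumpDensity

/-! ### Dominated convergence for the Fourier integrals. -/

section Expansion

lemma integrable_exp_mul_sub_abs {c : ℝ} (hc : 0 < c) (R : ℝ) :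
    Integrable (fun z : ℝ => Real.exp (c * (R - |z|)) * (1 + |z|) ^ 2) := by
  have h0 : IntegrableOn (fun z : ℝ => Real.exp (c * (R - |z|)) * (1 + |z|) ^ 2) (Ioi 0) := by
    have h1 := integrableOn_rpow_mul_exp_neg_mul_rpow (s := 0) (p := 1) (by norm_num) one_pos hc
    have h2 := integrableOn_rpow_mul_exp_neg_mul_rpow (s := 2) (p := 1) (by norm_num) one_pos hc
    refine (((h1.add h2).const_mul (2 * Real.exp (c * R)))).mono' ?_ ?_
    · exact Continuous.aestronglyMeasurable (by fun_prop)
    · filter_upwards [ae_restrict_mem measurableSet_Ioi] with z hz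
      have hz : 0 < z := hz
      rw [Real.norm_eq_abs, abs_of_nonneg (by positivity), abs_of_pos hz]
      simp only [Pi.add_apply, Real.rpow_zero, Real.rpow_one, Real.rpow_two]
      rw [mul_sub, sub_eq_add_neg, Real.exp_add, ← neg_mul]
      have : (1 + z) ^ 2 ≤ 2 * (1 + z ^ 2) := by nlinarith [sq_nonneg (1 - z)]
      calc Real.exp (c * R) * Real.exp (-c * z) * (1 + z) ^ 2
          ≤ Real.exp (c * R) * Real.exp (-c * z) * (2 * (1 + z ^ 2)) := by gcongr
        _ = _ := by ring
  refine integrable_of_integrableOn_Ioi h0 ?_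
  simpa only [abs_neg] using h0

lemma integrable_cexp_of_re_le {κ : ℝ → ℂ} (hκ : AEStronglyMeasurable κ volume) {c R : ℝ}
    (hc : 0 < c) (h : ∀ z, z ≠ 0 → (κ z).re ≤ c * (R - |z|)) :
    Integrable (fun z => Complex.exp (κ z)) := by
  refine (integrable_exp_mul_sub_abs hc R).mono'
    (Complex.continuous_exp.comp_aestronglyMeasurable hκ) ?_
  filter_upwards [Measure.ae_ne volume (0 : ℝ)] with z hz
  rw [Complex.norm_exp]
  calc Real.exp (κ z).re ≤ Real.exp (c * (R - |z|)) * 1 := by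
        rw [mul_one]; exact Real.exp_le_exp.2 (h z hz)
    _ ≤ _ := by
        gcongr
        have := abs_nonneg z
        nlinarith

/-- Chain rule for difference quotients. `dslope` is continuous at `b` and also covers indices with
`a i = b`. -/
lemma tendsto_cexp_sub_div {ι : Type*} {l : Filter ι} {a : ι → ℂ} {ε : ι → ℂ} {b C : ℂ}
    (ha : Tendsto a l (𝓝 b)) (h : Tendsto (fun i => (a i - b) / ε i) l (𝓝 C)) :
    Tendsto (fun i => (Complex.exp (a i) - Complex.exp b) / ε i) l (𝓝 (Complex.exp b * C)) := by
  have h1 : ContinuousAt (dslope Complex.exp b) b :=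
    continuousAt_dslope_same.2 Complex.differentiable_exp.differentiableAt
  have h2 : Tendsto (fun i => dslope Complex.exp b (a i)) l (𝓝 (Complex.exp b)) := by
    have := h1.tendsto.comp ha
    rwa [dslope_same, Complex.deriv_exp] at this
  refine (h2.mul h).congr fun i => ?_
  have := sub_smul_dslope Complex.exp b (a i)
  rw [smul_eq_mul] at this
  rw [← this]
  ring

/-- First order expansion of `∫ m (e^{κ_α} - e^{κ₂})` as `α ↑ 2`. -/
lemma expansion_integral_exp {κ : ℝ → ℝ → ℂ} {κ₂ C m : ℝ → ℂ} {A c R : ℝ} (hc : 0 < c)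
    (hκ : ∀ᶠ α in 𝓝[<] 2, AEStronglyMeasurable (κ α) volume)
    (hκ₂ : AEStronglyMeasurable κ₂ volume)
    (hC : ∀ z, z ≠ 0 → Tendsto (fun α : ℝ => (κ α z - κ₂ z) / ((2 - α : ℝ) : ℂ)) (𝓝[<] 2)
      (𝓝 (C z)))
    (hA : ∀ᶠ α in 𝓝[<] 2, ∀ z, z ≠ 0 → ‖κ α z - κ₂ z‖ ≤ A * (2 - α) * (|z| * (1 + |z|) ^ 2))
    (hre : ∀ᶠ α in 𝓝[<] 2, ∀ z, z ≠ 0 → (κ α z).re ≤ c * (R - |z|))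
    (hm : AEStronglyMeasurable m volume) (hm' : ∀ z, z ≠ 0 → ‖m z‖ ≤ |z|⁻¹) :
    Integrable (fun z => m z * (Complex.exp (κ₂ z) * C z)) ∧
    (∀ᶠ α in 𝓝[<] 2, Integrable (fun z => m z * (Complex.exp (κ α z) - Complex.exp (κ₂ z)))) ∧
    Tendsto (fun α : ℝ => (∫ z, m z * (Complex.exp (κ α z) - Complex.exp (κ₂ z)))
      / ((2 - α : ℝ) : ℂ)) (𝓝[<] 2) (𝓝 (∫ z, m z * (Complex.exp (κ₂ z) * C z))) := by
  have hlt : ∀ᶠ α in 𝓝[<] (2 : ℝ), α < 2 := self_mem_nhdsWithin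
  have hlim : ∀ z, z ≠ 0 → Tendsto (fun α => κ α z) (𝓝[<] 2) (𝓝 (κ₂ z)) := by
    intro z hz
    rw [tendsto_iff_norm_sub_tendsto_zero]
    have h0 : Tendsto (fun α : ℝ => A * (2 - α) * (|z| * (1 + |z|) ^ 2)) (𝓝[<] 2) (𝓝 0) := by
      have : Continuous (fun α : ℝ => A * (2 - α) * (|z| * (1 + |z|) ^ 2)) := by fun_prop
      simpa using (this.tendsto 2).mono_left nhdsWithin_le_nhds
    exact squeeze_zero' (.of_forall fun _ => norm_nonneg _) (hA.mono fun α h => h z hz) h0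
  -- The decay is uniform in `α`, so it passes to the limiting exponent.
  have hre₂ : ∀ z, z ≠ 0 → (κ₂ z).re ≤ c * (R - |z|) := fun z hz =>
    le_of_tendsto ((Complex.continuous_re.tendsto _).comp (hlim z hz))
      (hre.mono fun α h => h z hz)
  set F : ℝ → ℝ → ℂ := fun α z =>
    m z * ((Complex.exp (κ α z) - Complex.exp (κ₂ z)) * ((2 - α : ℝ) : ℂ)⁻¹) with hF
  have hFmeas : ∀ᶠ α in 𝓝[<] 2, AEStronglyMeasurable (F α) volume := by
    filter_upwards [hκ] with α hα
    exact hm.mul (((Complex.continuous_exp.comp_aestronglyMeasurable hα).sub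
      (Complex.continuous_exp.comp_aestronglyMeasurable hκ₂)).mul_const _)
  -- The multiplier contributes `1/|z|`, cancelled by the factor `|z|` in the error of the
  -- exponents; `2 - α` cancels the denominator.
  have hbound : ∀ᶠ α in 𝓝[<] 2, ∀ᵐ z, ‖F α z‖ ≤ A * (Real.exp (c * (R - |z|)) * (1 + |z|) ^ 2) := by
    filter_upwards [hA, hre, hlt] with α h1 h2 h3
    filter_upwards [Measure.ae_ne volume (0 : ℝ)] with z hz
    have hz' : 0 < |z| := abs_pos.2 hz
    have h4 : 0 < 2 - α := by linarith
    have h5 := norm_exp_sub_exp_le (h2 z hz) (hre₂ z hz)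
    simp only [hF]
    rw [← div_eq_mul_inv, norm_mul, norm_div, Complex.norm_real, Real.norm_eq_abs, abs_of_pos h4]
    calc ‖m z‖ * (‖Complex.exp (κ α z) - Complex.exp (κ₂ z)‖ / (2 - α))
        ≤ |z|⁻¹ * ((Real.exp (c * (R - |z|)) * (A * (2 - α) * (|z| * (1 + |z|) ^ 2))) / (2 - α)) := by
          gcongr
          · exact hm' z hz
          · exact h5.trans (mul_le_mul_of_nonneg_left (h1 z hz) (Real.exp_pos _).le)
      _ = _ := by field_simp
  have hptw : ∀ᵐ z, Tendsto (fun α => F α z) (𝓝[<] 2) (𝓝 (m z * (Complex.exp (κ₂ z) * C z))) := by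
    filter_upwards [Measure.ae_ne volume (0 : ℝ)] with z hz
    exact (tendsto_cexp_sub_div (hlim z hz) (hC z hz)).const_mul (m z)
  have hdom := (integrable_exp_mul_sub_abs hc R).const_mul A
  have hFint : ∀ᶠ α in 𝓝[<] 2, Integrable (F α) := by
    filter_upwards [hFmeas, hbound] with α h1 h2
    exact hdom.mono' h1 h2
  have hmul : ∀ α : ℝ, α < 2 → ∀ z, m z * (Complex.exp (κ α z) - Complex.exp (κ₂ z))
      = F α z * ((2 - α : ℝ) : ℂ) := by
    intro α hα z
    have : ((2 - α : ℝ) : ℂ) ≠ 0 := by exact_mod_cast (by linarith : (2 - α) ≠ 0)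
    simp only [hF]
    field_simp
  -- Measurability of `C` is not assumed: the limit inherits it, together with the majorant, along a
  -- sequence of values of `α`.
  obtain ⟨u, hu⟩ := exists_seq_tendsto (𝓝[<] (2 : ℝ))
  have hJ : Integrable (fun z => m z * (Complex.exp (κ₂ z) * C z)) := by
    obtain ⟨α₀, h₀⟩ := hFmeas.exists
    obtain ⟨N, hN⟩ := eventually_atTop.1 (hu.eventually (hFmeas.and hbound))
    have hu' : Tendsto (fun n => u (n + N)) atTop (𝓝[<] (2 : ℝ)) := hu.comp (tendsto_add_atTop_nat N)
    refine hdom.mono' (aestronglyMeasurable_of_tendsto_ae atTop (f := fun n => F (u (n + N)))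
      (fun n => (hN _ (Nat.le_add_left _ _)).1) ?_) ?_
    · filter_upwards [hptw] with z hz using hz.comp hu'
    · have hall : ∀ᵐ z, ∀ n : ℕ, ‖F (u (n + N)) z‖
          ≤ A * (Real.exp (c * (R - |z|)) * (1 + |z|) ^ 2) :=
        ae_all_iff.2 fun n => (hN _ (Nat.le_add_left _ _)).2
      filter_upwards [hptw, hall] with z hz h1
      exact le_of_tendsto (hz.comp hu').norm (.of_forall h1)
  refine ⟨hJ, ?_, ?_⟩
  · filter_upwards [hFint, hlt] with α h1 h2
    simp_rw [hmul α h2]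
    exact h1.mul_const _
  · have := tendsto_integral_filter_of_dominated_convergence _ hFmeas hbound hdom hptw
    refine this.congr' ?_
    filter_upwards [hlt] with α h2
    have h4 : ((2 - α : ℝ) : ℂ) ≠ 0 := by exact_mod_cast (by linarith : (2 - α) ≠ 0)
    simp_rw [hmul α h2]
    rw [integral_mul_const, mul_div_cancel_right₀ _ h4]

/-- A point of the vertical line `Re s = δ`. -/
lemma re_add_I_mul (δ z : ℝ) : ((δ : ℂ) + Complex.I * z).re = δ := by simp

lemma im_add_I_mul (δ z : ℝ) : ((δ : ℂ) + Complex.I * z).im = z := by simp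

variable {f : ℝ → ℝ} {S δ M : ℝ}

lemma JumpDensity.integrable_jumpWeight_withDensity (h : JumpDensity f S δ M) {α : ℝ} (h1 : 1 < α)
    (h2 : α < 2) : Integrable (jumpWeight δ)
      (volume.withDensity fun x => ENNReal.ofReal ((2 - α) * (f x * |x| ^ (-α - 1)))) := by
  have hm := h.measurable
  rw [integrable_withDensity_iff (by fun_prop) (.of_forall fun _ => ENNReal.ofReal_lt_top)]
  refine ((h.integrable_jumpWeight h1 h2).const_mul (2 - α)).congr (.of_forall fun x => ?_)
  have := h.nonneg x
  have h3 : 0 ≤ 2 - α := by linarith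
  simp only
  rw [ENNReal.toReal_ofReal (by positivity)]
  ring

lemma JumpDensity.integral_withDensity (h : JumpDensity f S δ M) {α : ℝ}
    (h2 : α < 2) (k : ℝ → ℂ) :
    ∫ x, k x ∂(volume.withDensity fun x => ENNReal.ofReal ((2 - α) * (f x * |x| ^ (-α - 1))))
      = ((2 - α : ℝ) : ℂ) * ∫ x, k x * ((f x * |x| ^ (-α - 1) : ℝ) : ℂ) := by
  have hm := h.measurable
  rw [integral_withDensity_eq_integral_toReal_smul (by fun_prop)
    (.of_forall fun _ => ENNReal.ofReal_lt_top), ← integral_const_mul]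
  refine integral_congr_ae (.of_forall fun x => ?_)
  have := h.nonneg x
  have h3 : 0 ≤ 2 - α := by linarith
  simp only
  rw [ENNReal.toReal_ofReal (by positivity), Complex.real_smul]
  push_cast
  ring

lemma JumpDensity.continuousOn_jumpCumulant (h : JumpDensity f S δ M) {α : ℝ} (h1 : 1 < α)
    (h2 : α < 2) : ContinuousOn (jumpCumulant f α) {s | 0 ≤ s.re ∧ s.re ≤ δ} := by
  refine (continuousOn_integral_martKernel h.one_lt.le
    (h.integrable_jumpWeight_withDensity h1 h2)).congr fun s _ => ?_
  simp only [h.integral_withDensity h2, jumpCumulant]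

lemma JumpDensity.continuous_jumpCumulant_line (h : JumpDensity f S δ M) {α : ℝ} (h1 : 1 < α)
    (h2 : α < 2) {a : ℝ} (ha : a = 0 ∨ a = 1) :
    Continuous (fun z : ℝ => jumpCumulant f α (a + Complex.I * z)) := by
  refine (h.continuousOn_jumpCumulant h1 h2).comp_continuous (by fun_prop) fun z => ?_
  have := h.one_lt
  simp only [mem_ofPred_eq, re_add_I_mul]
  rcases ha with rfl | rfl <;> constructor <;> linarith

/-- The coefficient of `2 - α` in the expansion of the cumulant function. -/
noncomputable def excessCoeff (f : ℝ → ℝ) (S : ℝ) (s : ℂ) : ℂ :=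
  S * (-(1 / 2) * s ^ 2 * Complex.log s
      + (3 - 2 * Real.eulerMascheroniConstant) / 4 * s ^ 2
      - (3 - 2 * Real.eulerMascheroniConstant) / 4 * s)
    + ∫ x, martKernel s x * ((excess f S x * |x| ^ (-2 - 1 : ℝ) : ℝ) : ℂ)

/-- The expansion of the Fourier integrals on the lines `Re s = 0` and `Re s = 1`. -/
theorem JumpDensity.expansion (h : JumpDensity f S δ M) {a t : ℝ} (ha : a = 0 ∨ a = 1)
    (ht : 0 < t) {m : ℝ → ℂ} (hm : AEStronglyMeasurable m volume)
    (hm' : ∀ z, z ≠ 0 → ‖m z‖ ≤ |z|⁻¹) :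
    let κ : ℝ → ℝ → ℂ := fun α z => t * jumpCumulant f α (a + Complex.I * z)
    let κ₂ : ℝ → ℂ := fun z => t * (S * (1 / 2 * ((a + Complex.I * z) ^ 2 - (a + Complex.I * z))))
    Integrable (fun z : ℝ => m z * (Complex.exp (κ₂ z) * (t * excessCoeff f S (a + Complex.I * z)))) ∧
    (∀ᶠ α in 𝓝[<] 2, Integrable (fun z => m z * (Complex.exp (κ α z) - Complex.exp (κ₂ z)))) ∧
    Tendsto (fun α : ℝ => (∫ z, m z * (Complex.exp (κ α z) - Complex.exp (κ₂ z)))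
      / ((2 - α : ℝ) : ℂ)) (𝓝[<] 2)
      (𝓝 (∫ z : ℝ, m z * (Complex.exp (κ₂ z) * (t * excessCoeff f S (a + Complex.I * z))))) := by
  intro κ κ₂
  obtain ⟨A, hA0, hA⟩ := h.exists_norm_jumpCumulant_sub_le
  obtain ⟨c, R, hc, hcR⟩ := h.exists_re_jumpCumulant_le
  have hmem : ∀ᶠ α in 𝓝[<] (2 : ℝ), α ∈ Ioo (3 / 2 : ℝ) 2 := Ioo_mem_nhdsLT (by norm_num)
  have hline : ∀ z : ℝ, ((a : ℂ) + Complex.I * z).re = 0 ∨ ((a : ℂ) + Complex.I * z).re = 1 :=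
    fun z => by rwa [re_add_I_mul]
  have hdiff : ∀ α z, κ α z - κ₂ z = t * (jumpCumulant f α (a + Complex.I * z)
      - S * (1 / 2 * ((a + Complex.I * z) ^ 2 - (a + Complex.I * z)))) := fun α z => by
    simp only [κ, κ₂]; ring
  refine expansion_integral_exp (A := t * A) (c := t * c) (R := R) (by positivity) ?_ ?_ ?_ ?_ ?_ hm hm'
  · filter_upwards [hmem] with α hα
    exact ((h.continuous_jumpCumulant_line (by linarith [hα.1]) hα.2 ha).const_mul
      _).aestronglyMeasurable
  · exact Continuous.aestronglyMeasurable (by fun_prop)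
  · intro z hz
    simp_rw [hdiff, mul_div_assoc]
    refine Tendsto.const_mul _ (h.tendsto_jumpCumulant ?_ ?_ ?_)
    · rw [re_add_I_mul]; rcases ha with rfl | rfl <;> norm_num
    · have := h.one_lt
      rw [re_add_I_mul]; rcases ha with rfl | rfl <;> linarith
    · intro h0
      have := congrArg Complex.im h0
      rw [im_add_I_mul] at this
      exact hz this
  · filter_upwards [hA] with α hα z hz
    have := hα (a + Complex.I * z) (by rwa [im_add_I_mul]) (hline z)
    rw [im_add_I_mul] at this
    rw [hdiff, norm_mul, Complex.norm_real, Real.norm_eq_abs, abs_of_pos ht]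
    calc _ ≤ t * _ := mul_le_mul_of_nonneg_left this ht.le
      _ = _ := by ring
  · filter_upwards [hmem] with α hα z hz
    have := hcR α hα (a + Complex.I * z) (hline z)
    rw [im_add_I_mul] at this
    simp only [κ]
    rw [Complex.re_ofReal_mul, mul_assoc]
    exact mul_le_mul_of_nonneg_left this ht.le

lemma JumpDensity.integrable_cexp_jumpCumulant (h : JumpDensity f S δ M) {a t : ℝ}
    (ha : a = 0 ∨ a = 1) (ht : 0 < t) {α : ℝ} (hα : α ∈ Ioo (3 / 2 : ℝ) 2) :
    Integrable (fun z : ℝ => Complex.exp (t * jumpCumulant f α (a + Complex.I * z))) := by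
  obtain ⟨c, R, hc, hcR⟩ := h.exists_re_jumpCumulant_le
  refine integrable_cexp_of_re_le (c := t * c) (R := R)
    ((h.continuous_jumpCumulant_line (by linarith [hα.1]) hα.2 ha).const_mul
      _).aestronglyMeasurable (by positivity) fun z _ => ?_
  have := hcR α hα (a + Complex.I * z) (by rwa [re_add_I_mul])
  rw [im_add_I_mul] at this
  rw [Complex.re_ofReal_mul, mul_assoc]
  exact mul_le_mul_of_nonneg_left this ht.le

end Expansion

/-! ### Exponential tilting and Fourier representation of call prices. -/

section Pricing

/-- The measure `eˣ μ(dx)`. -/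
noncomputable def esscher (μ : Measure ℝ) : Measure ℝ :=
  μ.withDensity (fun x => ENNReal.ofReal (Real.exp x))

variable {μ μ₁ μ₂ : Measure ℝ}

lemma integral_esscher {E : Type*} [NormedAddCommGroup E] [NormedSpace ℝ E] (g : ℝ → E) :
    ∫ x, g x ∂(esscher μ) = ∫ x, Real.exp x • g x ∂μ := by
  rw [esscher, integral_withDensity_eq_integral_toReal_smul (by fun_prop)
    (.of_forall fun _ => ENNReal.ofReal_lt_top)]
  refine integral_congr_ae (.of_forall fun x => ?_)
  simp only
  rw [ENNReal.toReal_ofReal (Real.exp_pos x).le]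

lemma isProbabilityMeasure_esscher (h : Integrable Real.exp μ) (h1 : ∫ x, Real.exp x ∂μ = 1) :
    IsProbabilityMeasure (esscher μ) := by
  constructor
  rw [esscher, withDensity_apply _ MeasurableSet.univ, Measure.restrict_univ,
    ← ofReal_integral_eq_lintegral_ofReal h (.of_forall fun x => (Real.exp_pos x).le), h1,
    ENNReal.ofReal_one]

lemma charFun_esscher (z : ℝ) :
    charFun (esscher μ) z = ∫ x : ℝ, Complex.exp ((1 + Complex.I * z) * x) ∂μ := by
  rw [charFun_apply_real, integral_esscher]
  refine integral_congr_ae (.of_forall fun x => ?_)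
  simp only
  rw [Complex.real_smul, Complex.ofReal_exp, ← Complex.exp_add]
  ring_nf

/-- From `1 - e^{k-x} = ∫_k^x e^{k-u} du` with `k = log K`. The call payoff becomes `e^x` times a
mixture of digital payoffs with weight `e^{k-u}`, and the factor `e^x` passes into the tilted
measure. -/
lemma max_exp_sub_eq {K : ℝ} (hK : 0 < K) (x : ℝ) : max (Real.exp x - K) 0
    = Real.exp x • ∫ u in Ioi (Real.log K), Real.exp (Real.log K - u) * (Iic x).indicator 1 u := by
  have h0 : ∀ u, Real.exp (Real.log K - u) * (Iic x).indicator 1 u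
      = (Iic x).indicator (fun u => Real.exp (Real.log K - u)) u := fun u => by
    by_cases hu : u ∈ Iic x <;> simp [hu]
  simp_rw [h0]
  rw [setIntegral_indicator measurableSet_Iic, Ioi_inter_Iic]
  rcases le_total (Real.log K) x with h | h
  · have h1 : K ≤ Real.exp x := by rwa [← Real.log_le_iff_le_exp hK]
    rw [max_eq_left (by linarith), ← intervalIntegral.integral_of_le h]
    have h2 : ∫ u in Real.log K..x, Real.exp (Real.log K - u) = 1 - Real.exp (Real.log K - x) := by
      rw [intervalIntegral.integral_comp_sub_left (fun u => Real.exp u), integral_exp]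
      simp
    rw [h2, Real.exp_sub, Real.exp_log hK, smul_eq_mul]
    field_simp
  · have h1 : Real.exp x ≤ K := by rwa [← Real.le_log_iff_exp_le hK]
    rw [max_eq_right (by linarith), Ioc_eq_empty (by simpa using h)]
    simp

/-- The call price in terms of the tail of the tilted measure. -/
lemma integral_call_eq [IsProbabilityMeasure (esscher μ)] {K : ℝ} (hK : 0 < K) :
    ∫ x, max (Real.exp x - K) 0 ∂μ
      = ∫ u in Ioi (Real.log K), Real.exp (Real.log K - u) * (esscher μ).real (Ici u) := by
  simp_rw [max_exp_sub_eq hK]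
  rw [← integral_esscher, integral_integral_swap]
  · refine integral_congr_ae (.of_forall fun u => ?_)
    simp only
    rw [integral_const_mul]
    congr 1
    have : ∀ x, (Iic x).indicator (1 : ℝ → ℝ) u = (Ici u).indicator 1 x := fun x => by
      by_cases hu : u ≤ x <;> simp [hu]
    simp_rw [this]
    exact integral_indicator_one measurableSet_Ici
  · have h1 : Integrable (fun u => Real.exp (Real.log K - u))
        (volume.restrict (Ioi (Real.log K))) := by
      have := (integrableOn_exp_neg_Ioi (Real.log K)).const_mul (Real.exp (Real.log K))
      refine this.congr (.of_forall fun u => ?_)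
      simp only
      rw [← Real.exp_add, sub_eq_add_neg]
    have h2 := (integrable_const (μ := esscher μ) (1 : ℝ)).mul_prod h1
    refine h2.mono' ?_ (.of_forall fun p => ?_)
    · refine Measurable.aestronglyMeasurable ?_
      have : (Function.uncurry fun x u : ℝ => Real.exp (Real.log K - u) * (Iic x).indicator 1 u)
          = fun p : ℝ × ℝ => Real.exp (Real.log K - p.2)
            * {p : ℝ × ℝ | p.2 ≤ p.1}.indicator (fun _ => (1 : ℝ)) p := by
        ext ⟨x, u⟩
        by_cases hu : u ≤ x <;> simp [hu, Function.uncurry]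
      rw [this]
      exact (by fun_prop : Measurable fun p : ℝ × ℝ => Real.exp (Real.log K - p.2)).mul
        (measurable_const.indicator (measurableSet_le measurable_snd measurable_fst))
    · rw [Function.uncurry, norm_mul, Real.norm_eq_abs, abs_of_pos (Real.exp_pos _), one_mul]
      refine mul_le_of_le_one_right (Real.exp_pos _).le ?_
      by_cases hu : p.2 ≤ p.1 <;> simp [hu]

lemma integrableOn_exp_mul_measureReal_Ici (μ : Measure ℝ) [IsProbabilityMeasure μ] (k : ℝ) :
    IntegrableOn (fun u => Real.exp (k - u) * μ.real (Ici u)) (Ioi k) := by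
  have h1 : IntegrableOn (fun u => Real.exp (k - u)) (Ioi k) := by
    have := (integrableOn_exp_neg_Ioi k).const_mul (Real.exp k)
    refine this.congr (.of_forall fun u => ?_)
    simp only
    rw [← Real.exp_add, sub_eq_add_neg]
  have hanti : Antitone (fun u => μ.real (Ici u)) := fun a b hab =>
    measureReal_mono (Ici_subset_Ici.2 hab)
  refine h1.mono' ?_ (.of_forall fun u => ?_)
  · exact ((by fun_prop : Measurable fun u => Real.exp (k - u)).mul
      hanti.measurable).aestronglyMeasurable
  · rw [norm_mul, Real.norm_eq_abs, abs_of_pos (Real.exp_pos _), Real.norm_eq_abs,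
      abs_of_nonneg measureReal_nonneg]
    exact mul_le_of_le_one_right (Real.exp_pos _).le measureReal_le_one

lemma neg_sq_add_I_mul (z : ℝ) :
    -(z : ℂ) ^ 2 + Complex.I * z = Complex.I * z * (1 + Complex.I * z) := by
  linear_combination -(z : ℂ) ^ 2 * Complex.I_sq

lemma integral_exp_sub_mul_Ioi (k z : ℝ) :
    ∫ u : ℝ in Ioi k, Complex.exp (k - u) * Complex.exp (-Complex.I * z * u)
      = Complex.exp (-Complex.I * z * k) / (1 + Complex.I * z) := by
  have h := integral_exp_mul_complex_Ioi (a := -(1 + Complex.I * z)) (by simp) k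
  have : ∀ u : ℝ, Complex.exp (k - u) * Complex.exp (-Complex.I * z * u)
      = Complex.exp k * Complex.exp (-(1 + Complex.I * z) * u) := fun u => by
    rw [← Complex.exp_add, ← Complex.exp_add]
    ring_nf
  simp_rw [this]
  rw [integral_const_mul, h, neg_div_neg_eq, ← mul_div_assoc, ← Complex.exp_add]
  ring_nf

/-- Fourier representation of the difference of two call prices. -/
theorem integral_call_sub_eq [IsProbabilityMeasure (esscher μ₁)]
    [IsProbabilityMeasure (esscher μ₂)] (h₁ : Integrable (charFun (esscher μ₁)))
    (h₂ : Integrable (charFun (esscher μ₂)))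
    (h : Integrable (fun z : ℝ =>
      (charFun (esscher μ₁) z - charFun (esscher μ₂) z) / (Complex.I * z)))
    {K : ℝ} (hK : 0 < K) :
    ((∫ x, max (Real.exp x - K) 0 ∂μ₁ - ∫ x, max (Real.exp x - K) 0 ∂μ₂ : ℝ) : ℂ)
      = 1 / (2 * Real.pi) * ∫ z : ℝ, Complex.exp (-Complex.I * z * Real.log K)
        * ((charFun (esscher μ₁) z - charFun (esscher μ₂) z)
          / (-(z : ℂ) ^ 2 + Complex.I * z)) := by
  set k := Real.log K
  set φ : ℝ → ℂ := fun z =>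
    (charFun (esscher μ₁) z - charFun (esscher μ₂) z) / (Complex.I * z) with hφ
  rw [integral_call_eq hK, integral_call_eq hK, ← integral_sub
    (integrableOn_exp_mul_measureReal_Ici _ _) (integrableOn_exp_mul_measureReal_Ici _ _),
    ← integral_complex_ofReal]
  have e1 : ∀ u : ℝ, ((Real.exp (k - u) * (esscher μ₁).real (Ici u)
      - Real.exp (k - u) * (esscher μ₂).real (Ici u) : ℝ) : ℂ)
      = 1 / (2 * Real.pi) * ∫ z : ℝ,
        Complex.exp (k - u) * Complex.exp (-Complex.I * z * u) * φ z := by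
    intro u
    rw [← mul_sub, Complex.ofReal_mul, measureReal_Ici_sub_eq_integral h₁ h₂ h u]
    simp_rw [mul_assoc (Complex.exp (k - u))]
    rw [integral_const_mul]
    push_cast
    ring
  refine (integral_congr_ae (.of_forall e1)).trans ?_
  rw [integral_const_mul]
  congr 1
  -- The weight `e^{k-u}` makes Fubini applicable; its transform over `u > k` is `e^{-izk}/(1+iz)`,
  -- which turns `1/(iz)` into `1/(-z² + iz)`.
  rw [integral_integral_swap]
  · refine integral_congr_ae (.of_forall fun z => ?_)
    simp only
    rw [integral_mul_const, integral_exp_sub_mul_Ioi, hφ, neg_sq_add_I_mul]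
    simp only [div_eq_mul_inv, mul_inv]
    ring
  · have h3 : Integrable (fun u : ℝ => Complex.exp (k - u)) (volume.restrict (Ioi k)) := by
      have := ((integrableOn_exp_neg_Ioi k).const_mul (Real.exp k)).ofReal (𝕜 := ℂ)
      refine this.congr (.of_forall fun u => ?_)
      simp only
      rw [← Real.exp_add, ← sub_eq_add_neg]
      change ((Real.exp (k - u) : ℝ) : ℂ) = _
      push_cast
      rfl
    refine (h3.mul_prod h).mono ?_ (.of_forall fun p => ?_)
    · have h4 := (h3.mul_prod h).aestronglyMeasurable
      have h5 : AEStronglyMeasurable (fun p : ℝ × ℝ => Complex.exp (-Complex.I * p.2 * p.1))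
          ((volume.restrict (Ioi k)).prod volume) :=
        Continuous.aestronglyMeasurable (by fun_prop)
      refine (h5.mul h4).congr (.of_forall fun p => ?_)
      simp only [Function.uncurry, Pi.mul_apply]
      ring
    · simp only [Function.uncurry, norm_mul]
      have : ‖Complex.exp (-Complex.I * p.2 * p.1)‖ = 1 := by
        rw [Complex.norm_exp]; simp
      rw [this, mul_one]

/-- The call price as a combination of two digital prices. -/
lemma integral_call_eq_measureReal [IsProbabilityMeasure μ] (h : Integrable Real.exp μ) {K : ℝ}
    (hK : 0 < K) : ∫ x, max (Real.exp x - K) 0 ∂μ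
      = (esscher μ).real (Ici (Real.log K)) - K * μ.real (Ici (Real.log K)) := by
  have h1 : (esscher μ).real (Ici (Real.log K)) = ∫ x in Ici (Real.log K), Real.exp x ∂μ := by
    rw [← integral_indicator_one measurableSet_Ici, integral_esscher,
      ← integral_indicator measurableSet_Ici]
    refine integral_congr_ae (.of_forall fun x => ?_)
    by_cases hx : Real.log K ≤ x <;> simp [hx]
  have h2 : K * μ.real (Ici (Real.log K)) = ∫ x in Ici (Real.log K), K ∂μ := by
    rw [setIntegral_const, smul_eq_mul, mul_comm]
  rw [h1, h2, ← integral_sub h.integrableOn (integrable_const _),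
    ← integral_indicator measurableSet_Ici]
  refine integral_congr_ae (.of_forall fun x => ?_)
  by_cases hx : Real.log K ≤ x
  · have : K ≤ Real.exp x := by rwa [← Real.log_le_iff_le_exp hK]
    simp [hx, this]
  · have : Real.exp x ≤ K := by rw [← Real.le_log_iff_exp_le hK]; linarith
    simp [hx, this]

end Pricing

/-! ### Closed-form Gaussian prices. -/

section BlackScholes

/-- Tilting by `e^x` shifts a Gaussian mean by its variance, here from `-v/2` to `v/2`; the two laws
are compared through characteristic functions. -/
lemma esscher_gaussianReal (v : ℝ≥0) : esscher (gaussianReal (-(v / 2)) v) = gaussianReal (v / 2) v := by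
  have hint : Integrable Real.exp (gaussianReal (-(v / 2 : ℝ)) v) := by
    simpa using integrable_exp_mul_gaussianReal (μ := -(v / 2 : ℝ)) (v := v) 1
  have hone : ∫ x, Real.exp x ∂(gaussianReal (-(v / 2 : ℝ)) v) = 1 := by
    have := mgf_gaussianReal (p := gaussianReal (-(v / 2 : ℝ)) v) (X := id) Measure.map_id 1
    simp only [mgf, id, one_mul] at this
    rw [this]
    simp
  have := isProbabilityMeasure_esscher hint hone
  refine Measure.ext_of_charFun ?_
  ext z
  rw [charFun_esscher, charFun_gaussianReal]
  have := complexMGF_gaussianReal (p := gaussianReal (-(v / 2 : ℝ)) v) (X := id) Measure.map_id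
    (1 + Complex.I * z)
  simp only [complexMGF, id] at this
  rw [this]
  congr 1
  push_cast
  linear_combination (v : ℂ) / 2 * z ^ 2 * Complex.I_sq

lemma gaussianReal_real_Ici (m : ℝ) {v : ℝ≥0} (hv : v ≠ 0) (k : ℝ) :
    (gaussianReal m v).real (Ici k) = stdNormalCDF ((m - k) / √v) := by
  have hs : 0 < √(v : ℝ) := Real.sqrt_pos.2 (by positivity)
  have h1 : (gaussianReal 0 1).map (fun x => m - √v * x) = gaussianReal m v := by
    have h2 : (fun x : ℝ => m - √v * x) = (fun y => m - y) ∘ (fun x => √v * x) := rfl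
    rw [h2, ← Measure.map_map (by fun_prop) (by fun_prop), gaussianReal_map_const_mul,
      gaussianReal_map_const_sub]
    congr 1
    · simp
    · ext
      simp [Real.sq_sqrt]
  rw [stdNormalCDF, cdf_eq_real, ← h1, map_measureReal_apply (by fun_prop) measurableSet_Ici]
  congr 1
  ext x
  simp only [mem_preimage, mem_Ici, mem_Iic]
  rw [le_div_iff₀ hs]
  constructor <;> intro h <;> linarith

lemma integral_call_gaussianReal {v : ℝ≥0} (hv : v ≠ 0) {t K : ℝ} (hK : 0 < K) {σ : ℝ}
    (hσ : 0 < σ) (h : (v : ℝ) = σ ^ 2 * t) :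
    ∫ x, max (Real.exp x - K) 0 ∂(gaussianReal (-(v / 2)) v) = bsCall t K σ := by
  have hint : Integrable Real.exp (gaussianReal (-(v / 2 : ℝ)) v) := by
    simpa using integrable_exp_mul_gaussianReal (μ := -(v / 2 : ℝ)) (v := v) 1
  rw [integral_call_eq_measureReal hint hK, esscher_gaussianReal, gaussianReal_real_Ici _ hv,
    gaussianReal_real_Ici _ hv, bsCall, h, Real.sqrt_mul (by positivity), Real.sqrt_sq hσ.le]
  simp only [one_div, Real.log_inv]
  congr 3 <;> ring

end BlackScholes

/-! ### Integration over the two-point sphere. -/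

section Sphere

lemma eq_posDir_or_eq_negDir (ξ : Sph) : ξ = posDir ∨ ξ = negDir := by
  have h : |(ξ : ℝ)| = 1 := mem_sphere_zero_iff_norm.1 ξ.2
  rcases (abs_eq zero_le_one).1 h with h | h
  · exact Or.inl (Subtype.ext h)
  · exact Or.inr (Subtype.ext h)

lemma posDir_ne_negDir : posDir ≠ negDir := fun h => by
  have : (1 : ℝ) = -1 := congrArg Subtype.val h
  norm_num at this

lemma measure_sph_eq (ρ : Measure Sph) :
    ρ = ρ {posDir} • Measure.dirac posDir + ρ {negDir} • Measure.dirac negDir := by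
  ext s hs
  rw [← measure_inter_add_sdiff s (measurableSet_singleton posDir)]
  simp only [Measure.add_apply, Measure.smul_apply, Measure.dirac_apply, smul_eq_mul]
  congr 1
  · by_cases h : posDir ∈ s
    · rw [inter_eq_self_of_subset_right (singleton_subset_iff.2 h)]; simp [h]
    · rw [inter_singleton_eq_empty.2 h]; simp [h]
  · by_cases h : negDir ∈ s
    · have : s \ {posDir} = {negDir} := by
        ext ξ
        rcases eq_posDir_or_eq_negDir ξ with rfl | rfl
        · simp [posDir_ne_negDir]
        · simp [h, posDir_ne_negDir.symm]
      rw [this]; simp [h]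
    · have : s \ {posDir} = ∅ := by
        ext ξ
        rcases eq_posDir_or_eq_negDir ξ with rfl | rfl
        · simp
        · simp [h]
      rw [this]; simp [h]

lemma lintegral_sph (ρ : Measure Sph) (g : Sph → ℝ≥0∞) :
    ∫⁻ ξ, g ξ ∂ρ = ρ {posDir} * g posDir + ρ {negDir} * g negDir := by
  conv_lhs => rw [measure_sph_eq ρ]
  rw [lintegral_add_measure, lintegral_smul_measure, lintegral_smul_measure, lintegral_dirac,
    lintegral_dirac, smul_eq_mul, smul_eq_mul]

lemma integral_sph (ρ : Measure Sph) [IsFiniteMeasure ρ] {E : Type*} [NormedAddCommGroup E]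
    [NormedSpace ℝ E] [CompleteSpace E] (g : Sph → E) :
    ∫ ξ, g ξ ∂ρ = ρ.real {posDir} • g posDir + ρ.real {negDir} • g negDir := by
  have hi : ∀ ξ, Integrable g (ρ {ξ} • Measure.dirac ξ) := fun ξ =>
    (integrable_dirac (by simp)).smul_measure (measure_ne_top _ _)
  conv_lhs => rw [measure_sph_eq ρ]
  rw [integral_add_measure (hi _) (hi _), integral_smul_measure, integral_smul_measure,
    integral_dirac, integral_dirac]
  rfl

lemma prod_sph_eq (ρ : Measure Sph) [IsFiniteMeasure ρ] (m : Measure ℝ) [SFinite m] :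
    ρ.prod m = ρ {posDir} • m.map (Prod.mk posDir) + ρ {negDir} • m.map (Prod.mk negDir) := by
  conv_lhs => rw [measure_sph_eq ρ]
  rw [Measure.add_prod, Measure.prod_smul_left, Measure.prod_smul_left, Measure.dirac_prod,
    Measure.dirac_prod]

/-- The weight stays inside the hypothesis, so a direction of mass zero, about which `q` may give no
information, imposes no condition. -/
lemma integrable_prod_sph {ρ : Measure Sph} [IsFiniteMeasure ρ] {m : Measure ℝ} [SFinite m]
    {F : Sph × ℝ → ℂ} (h : ∀ ξ, Integrable (fun r => ρ.real {ξ} * F (ξ, r)) m) :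
    Integrable F (ρ.prod m) := by
  have key : ∀ ξ, Integrable F (ρ {ξ} • m.map (Prod.mk ξ)) := by
    intro ξ
    rcases eq_or_ne (ρ {ξ}) 0 with h0 | h0
    · simp [h0]
    · refine Integrable.smul_measure ?_ (measure_ne_top _ _)
      rw [(measurableEmbedding_prodMk_left ξ).integrable_map_iff]
      have h1 : (ρ.real {ξ} : ℂ) ≠ 0 := by
        exact_mod_cast ENNReal.toReal_ne_zero.2 ⟨h0, measure_ne_top _ _⟩
      refine ((h ξ).const_mul (ρ.real {ξ} : ℂ)⁻¹).congr (.of_forall fun r => ?_)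
      simp only [Function.comp]
      field_simp
  rw [prod_sph_eq]
  exact (key _).add_measure (key _)

end Sphere

/-! ### Splitting the line at the origin. -/

section Reflection

lemma lintegral_eq_Ioi_add_Ioi_neg (g : ℝ → ℝ≥0∞) :
    ∫⁻ x, g x = (∫⁻ r in Ioi (0 : ℝ), g r) + ∫⁻ r in Ioi (0 : ℝ), g (-r) := by
  rw [← lintegral_add_compl g (measurableSet_Ioi (a := (0 : ℝ))), compl_Ioi,
    setLIntegral_congr Iio_ae_eq_Iic.symm]
  congr 1
  have := (Measure.measurePreserving_neg (volume : Measure ℝ)).setLIntegral_comp_emb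
    (Homeomorph.neg ℝ).measurableEmbedding g (Ioi 0)
  rw [this]
  congr 2
  ext x
  simp

lemma integral_eq_Ioi_add_Ioi_neg {g : ℝ → ℂ} (hg : Integrable g) :
    ∫ x, g x = (∫ r in Ioi (0 : ℝ), g r) + ∫ r in Ioi (0 : ℝ), g (-r) := by
  rw [← integral_add_compl (measurableSet_Ioi (a := (0 : ℝ))) hg, compl_Ioi]
  congr 1
  rw [integral_comp_neg_Ioi, neg_zero]

end Reflection

/-! ### The truncated kernel and the martingale drift. -/

section TruncKernel

/-- The Lévy–Khintchine kernel `e^{s x} - 1 - s x 1_{|x| < 1}`. -/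
noncomputable def truncKernel (s : ℂ) (x : ℝ) : ℂ :=
  Complex.exp (s * x) - 1 - s * (({y : ℝ | |y| < 1}.indicator (fun y => y) x : ℝ) : ℂ)

/-- The truncation term is linear in `s`, so subtracting `s` times the kernel at `1` removes it.
This cancellation is used for the drift of the model and again for the last two integrals in `C(z,
δ)`. -/
lemma truncKernel_eq (s : ℂ) (x : ℝ) :
    truncKernel s x = martKernel s x + s * truncKernel 1 x := by
  simp only [truncKernel, martKernel]
  rw [one_mul, one_mul]
  ring

lemma measurable_truncKernel (s : ℂ) : Measurable (truncKernel s) := by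
  have : Measurable ({y : ℝ | |y| < 1}.indicator (fun y => y)) :=
    measurable_id.indicator (measurableSet_lt (by fun_prop) measurable_const)
  unfold truncKernel
  fun_prop

lemma norm_truncKernel_one_le {δ : ℝ} (hδ : 1 ≤ δ) (x : ℝ) :
    ‖truncKernel 1 x‖ ≤ jumpWeight δ x := by
  have he : Real.exp x ≤ 1 + Real.exp (δ * x) := by
    simpa using exp_mul_le_one_add_exp zero_le_one hδ x
  rcases lt_or_ge |x| 1 with hx | hx
  · have h1 : truncKernel 1 x = Complex.exp x - 1 - x := by
      simp only [truncKernel]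
      rw [indicator_of_mem (by simpa using hx), one_mul]
    rw [h1, jumpWeight_of_abs_le_one δ hx.le]
    calc ‖Complex.exp x - 1 - x‖ ≤ x ^ 2 := norm_cexp_sub_one_sub_le_sq hx.le
      _ ≤ _ := by
        have := Real.exp_pos (δ * x)
        nlinarith [sq_nonneg x]
  · have h1 : truncKernel 1 x = ((Real.exp x - 1 : ℝ) : ℂ) := by
      simp only [truncKernel]
      rw [indicator_of_notMem (by simpa using hx)]
      simp
    rw [h1, Complex.norm_real, Real.norm_eq_abs]
    have h2 : |Real.exp x - 1| ≤ 1 + Real.exp (δ * x) := by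
      have := Real.exp_pos x
      have := Real.exp_pos (δ * x)
      rw [abs_le]; constructor <;> linarith
    have h3 : min (x ^ 2) |x| = |x| := by
      rw [min_eq_right]
      rw [← sq_abs]; nlinarith
    rw [jumpWeight, h3]
    have := Real.exp_pos (δ * x)
    nlinarith

lemma norm_truncKernel_le {δ : ℝ} (hδ : 1 ≤ δ) {s : ℂ} (h0 : 0 ≤ s.re) (h1 : s.re ≤ δ) (x : ℝ) :
    ‖truncKernel s x‖ ≤ (‖s‖ ^ 2 * Real.exp ‖s‖ + 4 * ‖s‖ + 2) * jumpWeight δ x := by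
  rw [truncKernel_eq]
  calc _ ≤ ‖martKernel s x‖ + ‖s‖ * ‖truncKernel 1 x‖ := by
        rw [← norm_mul]; exact norm_add_le _ _
    _ ≤ (‖s‖ ^ 2 * Real.exp ‖s‖ + 3 * ‖s‖ + 2) * jumpWeight δ x + ‖s‖ * jumpWeight δ x := by
        gcongr
        · exact norm_martKernel_le hδ h0 h1 le_rfl x
        · exact norm_truncKernel_one_le hδ x
    _ = _ := by ring

lemma integrable_truncKernel {ν : Measure ℝ} {δ : ℝ} (hδ : 1 ≤ δ)
    (hW : Integrable (jumpWeight δ) ν) {s : ℂ} (h0 : 0 ≤ s.re) (h1 : s.re ≤ δ) :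
    Integrable (truncKernel s) ν :=
  (hW.const_mul _).mono' (measurable_truncKernel s).aestronglyMeasurable
    (.of_forall fun x => norm_truncKernel_le hδ h0 h1 x)

/-- With the martingale drift the truncation function disappears from the exponent. -/
lemma integral_martKernel_eq_exponent {ν : Measure ℝ} {δ : ℝ} (hδ : 1 ≤ δ)
    (hW : Integrable (jumpWeight δ) ν) (z : ℝ) :
    Complex.I * martingaleDrift ν * z + ∫ x, truncKernel (Complex.I * z) x ∂ν
      = ∫ x, martKernel (Complex.I * z) x ∂ν := by
  have hI : (Complex.I * z).re = 0 := by simp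
  have hd : (martingaleDrift ν : ℂ) = -∫ x, truncKernel 1 x ∂ν := by
    rw [martingaleDrift, Complex.ofReal_neg, ← integral_complex_ofReal]
    congr 1
    refine integral_congr_ae (.of_forall fun x => ?_)
    simp only [truncKernel]
    push_cast
    rw [one_mul, one_mul]
  have h1 : Integrable (truncKernel 1) ν := integrable_truncKernel hδ hW (by simp) (by simpa)
  have h2 : Integrable (truncKernel (Complex.I * z)) ν :=
    integrable_truncKernel hδ hW hI.ge (by rw [hI]; linarith)
  have h3 : ∀ x, martKernel (Complex.I * z) x
      = truncKernel (Complex.I * z) x - Complex.I * z * truncKernel 1 x := fun x => by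
    rw [truncKernel_eq (Complex.I * z)]; ring
  simp_rw [h3]
  rw [integral_sub h2 (h1.const_mul _), integral_const_mul, hd]
  ring

end TruncKernel

/-! ### Reduction of the model to a jump density on the line. -/

section Model

variable {ρ : Measure Sph} {q : ℝ → Sph → ℝ}

/-- The density of the Lévy measures with respect to `(2 - α) |x|^{-α-1} dx`. -/
noncomputable def jumpDensity (ρ : Measure Sph) (q : ℝ → Sph → ℝ) (x : ℝ) : ℝ :=
  ρ.real {posDir} * (Ioi 0).indicator (fun r => q r posDir) x
    + ρ.real {negDir} * (Ioi 0).indicator (fun r => q r negDir) (-x)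

lemma jumpDensity_of_pos {r : ℝ} (hr : 0 < r) :
    jumpDensity ρ q r = ρ.real {posDir} * q r posDir := by
  have : ¬ (0 < -r) := by linarith
  simp [jumpDensity, hr, hr.le]

lemma jumpDensity_neg {r : ℝ} (hr : 0 < r) :
    jumpDensity ρ q (-r) = ρ.real {negDir} * q r negDir := by
  simp [jumpDensity, hr, hr.le]

lemma jumpDensity_zero : jumpDensity ρ q 0 = 0 := by simp [jumpDensity]

lemma measurable_jumpDensity (h : Measurable (fun p : Ioi (0 : ℝ) × Sph => q p.1 p.2)) :
    Measurable (jumpDensity ρ q) := by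
  have key : ∀ ξ, Measurable ((Ioi (0 : ℝ)).indicator (fun r => q r ξ)) := by
    intro ξ
    refine measurable_of_restrict_of_restrict_compl (measurableSet_Ioi (a := (0 : ℝ))) ?_ ?_
    · have h1 : Measurable (fun r : Ioi (0 : ℝ) => q r ξ) :=
        h.comp (measurable_id.prodMk measurable_const)
      convert h1 using 1
      ext r
      exact indicator_of_mem r.2 _
    · convert measurable_const (a := (0 : ℝ)) using 1
      ext r
      exact indicator_of_notMem r.2 _
  exact ((key _).const_mul _).add (((key _).comp measurable_neg).const_mul _)

lemma levyMeasure_scaledTempering (ρ : Measure Sph) [IsFiniteMeasure ρ] (q : ℝ → Sph → ℝ) (α : ℝ) :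
    levyMeasure α ρ (scaledTempering q α) = volume.withDensity
      (fun x => ENNReal.ofReal ((2 - α) * (jumpDensity ρ q x * |x| ^ (-α - 1)))) := by
  ext s hs
  have hmeas : Measurable (fun p : Sph × ℝ => p.2 * (p.1 : ℝ)) := by fun_prop
  have hpre := hmeas hs
  rw [levyMeasure, Measure.map_apply hmeas hs, withDensity_apply _ hpre,
    ← lintegral_indicator hpre, withDensity_apply _ hs, ← lintegral_indicator hs,
    lintegral_eq_Ioi_add_Ioi_neg, prod_sph_eq, lintegral_add_measure, lintegral_smul_measure,
    lintegral_smul_measure, (measurableEmbedding_prodMk_left _).lintegral_map,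
    (measurableEmbedding_prodMk_left _).lintegral_map, smul_eq_mul, smul_eq_mul,
    ← lintegral_const_mul' _ _ (measure_ne_top _ _), ← lintegral_const_mul' _ _ (measure_ne_top _ _)]
  have hval : ∀ (ξ : Sph) {r : ℝ}, 0 < r →
      ρ {ξ} * ENNReal.ofReal (scaledTempering q α r ξ / r ^ (α + 1))
        = ENNReal.ofReal ((2 - α) * (ρ.real {ξ} * q r ξ * r ^ (-α - 1))) := by
    intro ξ r hr
    rw [← ENNReal.ofReal_toReal (measure_ne_top ρ {ξ}), ← ENNReal.ofReal_mul ENNReal.toReal_nonneg,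
      show -α - 1 = -(α + 1) by ring,
      Real.rpow_neg hr.le, scaledTempering, Measure.real]
    congr 1
    ring
  congr 1
  · refine setLIntegral_congr_fun measurableSet_Ioi fun r (hr : 0 < r) => ?_
    by_cases hrs : r ∈ s
    · have h1 : ((posDir, r) : Sph × ℝ) ∈ (fun p : Sph × ℝ => p.2 * (p.1 : ℝ)) ⁻¹' s := by
        simpa [posDir] using hrs
      simp only [indicator_of_mem hrs, indicator_of_mem h1]
      rw [hval _ hr, jumpDensity_of_pos hr, abs_of_pos hr]
    · have h1 : ((posDir, r) : Sph × ℝ) ∉ (fun p : Sph × ℝ => p.2 * (p.1 : ℝ)) ⁻¹' s := by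
        simpa [posDir] using hrs
      simp only [indicator_of_notMem hrs, indicator_of_notMem h1, mul_zero]
  · refine setLIntegral_congr_fun measurableSet_Ioi fun r (hr : 0 < r) => ?_
    by_cases hrs : -r ∈ s
    · have h1 : ((negDir, r) : Sph × ℝ) ∈ (fun p : Sph × ℝ => p.2 * (p.1 : ℝ)) ⁻¹' s := by
        simpa [negDir] using hrs
      simp only [indicator_of_mem hrs, indicator_of_mem h1]
      rw [hval _ hr, jumpDensity_neg hr, abs_neg, abs_of_pos hr]
    · have h1 : ((negDir, r) : Sph × ℝ) ∉ (fun p : Sph × ℝ => p.2 * (p.1 : ℝ)) ⁻¹' s := by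
        simpa [negDir] using hrs
      simp only [indicator_of_notMem hrs, indicator_of_notMem h1, mul_zero]

variable {Ω : Type*} [MeasurableSpace Ω] {P : Measure Ω} {X : ℝ → ℝ≥0 → Ω → ℝ}

lemma IsScaledModel.measurable (hX : IsScaledModel X P ρ q) :
    Measurable (fun p : Ioi (0 : ℝ) × Sph => q p.1 p.2) := by
  -- Any admissible index would do; at `7/4` the scaling is `1/4`, undone by the factor `4`.
  have h := (hX.gts (7 / 4) ⟨by norm_num, by norm_num⟩).tempering.measurable
  convert h.const_mul 4 using 2 with p
  simp only [scaledTempering]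
  ring

lemma IsScaledModel.nonneg (hX : IsScaledModel X P ρ q) {r : ℝ} (hr : 0 < r) (ξ : Sph) :
    0 ≤ q r ξ := by
  have h := (hX.gts (7 / 4) ⟨by norm_num, by norm_num⟩).tempering.nonneg r hr ξ
  simp only [scaledTempering] at h
  linarith

lemma IsScaledModel.qZero_posDir (hX : IsScaledModel X P ρ q) : qZero q posDir = 0 :=
  hX.qZero_pos.limUnder_eq

/-- An almost sure property holds at every atom. -/
lemma IsScaledModel.tendsto_negDir (hX : IsScaledModel X P ρ q) (hρ : 0 < ρ {negDir}) :
    Tendsto (fun r => q r negDir) (𝓝[>] 0) (𝓝 (qZero q negDir)) := by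
  have h := hX.conditions.limit_exists
  rw [ae_iff] at h
  by_contra hcon
  have : negDir ∈ {ξ | ¬∃ l, Tendsto (fun r => q r ξ) (𝓝[>] 0) (𝓝 l)} := by
    rintro ⟨l, hl⟩
    exact hcon (by rw [qZero, hl.limUnder_eq]; exact hl)
  exact hρ.ne' (measure_mono_null (singleton_subset_iff.2 this) h)

lemma IsScaledModel.totalVar_eq [IsFiniteMeasure ρ] (hX : IsScaledModel X P ρ q) :
    totalVar ρ q = ρ.real {negDir} * qZero q negDir := by
  rw [totalVar, integral_sph, hX.qZero_posDir]
  simp [negDir]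

lemma IsScaledModel.excess_of_pos [IsFiniteMeasure ρ] (hX : IsScaledModel X P ρ q) {r : ℝ}
    (hr : 0 < r) : excess (jumpDensity ρ q) (totalVar ρ q) r
      = ρ.real {posDir} * (q r posDir - qZero q posDir) := by
  rw [excess, jumpDensity_of_pos hr, indicator_of_notMem (by simpa using hr.le), hX.qZero_posDir,
    sub_zero, sub_zero]

lemma IsScaledModel.excess_neg [IsFiniteMeasure ρ] (hX : IsScaledModel X P ρ q) {r : ℝ}
    (hr : 0 < r) : excess (jumpDensity ρ q) (totalVar ρ q) (-r)
      = ρ.real {negDir} * (q r negDir - qZero q negDir) := by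
  rw [excess, jumpDensity_neg hr, indicator_of_mem (by simpa using hr), hX.totalVar_eq]
  ring

lemma IsScaledModel.jumpDensity_nonneg (hX : IsScaledModel X P ρ q) (x : ℝ) :
    0 ≤ jumpDensity ρ q x := by
  rcases lt_trichotomy x 0 with hx | rfl | hx
  · have h : 0 < -x := by linarith
    rw [← neg_neg x, jumpDensity_neg h]
    exact mul_nonneg measureReal_nonneg (hX.nonneg h _)
  · rw [jumpDensity_zero]
  · rw [jumpDensity_of_pos hx]
    exact mul_nonneg measureReal_nonneg (hX.nonneg hx _)

/-- On the negative side `e^{δx} ≤ 1` and boundedness of `q` suffices. On the positive side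
boundedness covers `x ≤ R` and exponential decay covers the rest; the decay rate itself serves as
`δ`. -/
lemma IsScaledModel.exists_jumpDensity_bound (hX : IsScaledModel X P ρ q) :
    ∃ δ M : ℝ, 1 < δ ∧ ∀ x, jumpDensity ρ q x * (1 + Real.exp (δ * x)) ≤ M := by
  obtain ⟨M₀, hM₀, hM⟩ := hX.conditions.bounded
  obtain ⟨δ, hδ, hO⟩ := hX.decay
  obtain ⟨C, hC, hO⟩ := hO.exists_pos
  rw [Asymptotics.isBigOWith_iff, eventually_atTop] at hO
  obtain ⟨R, hR⟩ := hO
  have ha : 0 ≤ ρ.real {posDir} := measureReal_nonneg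
  have hb : 0 ≤ ρ.real {negDir} := measureReal_nonneg
  have he := Real.exp_pos (δ * R)
  refine ⟨δ, ρ.real {negDir} * (M₀ * 2) + ρ.real {posDir} * (M₀ * (1 + Real.exp (δ * R)) + C),
    hδ, fun x => ?_⟩
  have n1 : 0 ≤ ρ.real {negDir} * (M₀ * 2) := by positivity
  have n2 : 0 ≤ ρ.real {posDir} * (M₀ * (1 + Real.exp (δ * R)) + C) := by positivity
  rcases lt_trichotomy x 0 with hx | rfl | hx
  · have h : 0 < -x := by linarith
    have h1 : Real.exp (δ * x) ≤ 1 := Real.exp_le_one_iff.2 (by nlinarith)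
    have h2 : jumpDensity ρ q x = ρ.real {negDir} * q (-x) negDir := by
      rw [← jumpDensity_neg h, neg_neg]
    rw [h2]
    have h3 := hM _ h negDir
    have h4 := hX.nonneg h negDir
    have h5 : q (-x) negDir * (1 + Real.exp (δ * x)) ≤ M₀ * 2 :=
      mul_le_mul h3 (by linarith) (by positivity) hM₀.le
    nlinarith [mul_le_mul_of_nonneg_left h5 hb]
  · rw [jumpDensity_zero]
    linarith
  · rw [jumpDensity_of_pos hx]
    have h3 := hM _ hx posDir
    have h4 := hX.nonneg hx posDir
    have h5 : q x posDir * (1 + Real.exp (δ * x)) ≤ M₀ * (1 + Real.exp (δ * R)) + C := by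
      rcases le_total x R with hxR | hxR
      · have : Real.exp (δ * x) ≤ Real.exp (δ * R) := Real.exp_le_exp.2 (by nlinarith)
        have : q x posDir * (1 + Real.exp (δ * x)) ≤ M₀ * (1 + Real.exp (δ * R)) := by gcongr
        linarith
      · have h6 := hR x hxR
        rw [Real.norm_eq_abs, Real.norm_eq_abs, abs_of_nonneg h4, abs_of_pos (Real.exp_pos _)] at h6
        have h7 : q x posDir * Real.exp (δ * x) ≤ C := by
          calc _ ≤ C * Real.exp (-δ * x) * Real.exp (δ * x) := by gcongr
            _ = C := by rw [mul_assoc, ← Real.exp_add]; simp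
        nlinarith [mul_pos hM₀ he]
    nlinarith [mul_le_mul_of_nonneg_left h5 ha]

lemma IsScaledModel.integrableOn_excess [IsFiniteMeasure ρ] (hX : IsScaledModel X P ρ q) :
    IntegrableOn (fun x => |excess (jumpDensity ρ q) (totalVar ρ q) x| / |x|) (Ioo (-1) 1) := by
  have hm : Measurable (fun x => |excess (jumpDensity ρ q) (totalVar ρ q) x| / |x|) := by
    have h1 := measurable_jumpDensity (ρ := ρ) hX.measurable
    have h2 : Measurable ((Iio (0 : ℝ)).indicator fun _ => totalVar ρ q) :=
      measurable_const.indicator measurableSet_Iio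
    unfold excess
    fun_prop
  have hint := hX.conditions.integrable
  rw [lintegral_sph] at hint
  obtain ⟨hp, hn⟩ := ENNReal.add_lt_top.1 hint
  have key : ∀ (ξ : Sph) (g : ℝ → ℝ), Measurable g →
      (∀ r ∈ Ioo (0 : ℝ) 1, g r = ρ.real {ξ} * (|q r ξ - qZero q ξ| / r)) →
      ρ {ξ} * ∫⁻ r in Ioo (0 : ℝ) 1, ENNReal.ofReal (|q r ξ - qZero q ξ| / r) < ⊤ →
      IntegrableOn g (Ioo 0 1) := by
    intro ξ g hg heq hfin
    refine ⟨hg.aestronglyMeasurable, ?_⟩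
    rw [hasFiniteIntegral_iff_norm]
    rw [← lintegral_const_mul' _ _ (measure_ne_top _ _)] at hfin
    refine lt_of_le_of_lt (le_of_eq (setLIntegral_congr_fun measurableSet_Ioo fun r hr => ?_)) hfin
    have hr0 : 0 < r := hr.1
    rw [heq r hr, Real.norm_eq_abs, abs_of_nonneg (mul_nonneg measureReal_nonneg (by positivity)),
      ENNReal.ofReal_mul measureReal_nonneg, Measure.real, ENNReal.ofReal_toReal (measure_ne_top _ _)]
  have hpos := key posDir _ hm (fun r hr => by
    rw [hX.excess_of_pos hr.1, abs_mul, abs_of_nonneg measureReal_nonneg, abs_of_pos hr.1,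
      mul_div_assoc]) hp
  have hneg := key negDir _ (hm.comp measurable_neg) (fun r hr => by
    simp only [Function.comp]
    rw [hX.excess_neg hr.1, abs_mul, abs_of_nonneg measureReal_nonneg, abs_neg, abs_of_pos hr.1,
      mul_div_assoc]) hn
  rw [← integrable_indicator_iff measurableSet_Ioo]
  refine integrable_of_integrableOn_Ioi ?_ ?_
  · rw [← integrable_indicator_iff measurableSet_Ioi, indicator_indicator]
    rw [← integrable_indicator_iff measurableSet_Ioo] at hpos
    rwa [inter_comm, Ioo_inter_Ioi, max_eq_right (by norm_num)]
  · rw [← integrable_indicator_iff measurableSet_Ioi]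
    rw [← integrable_indicator_iff measurableSet_Ioo] at hneg
    refine hneg.congr (.of_forall fun x => ?_)
    by_cases hx : 0 < x
    · by_cases hx1 : x < 1
      · have h1 : -1 < -x ∧ -x < 1 := by constructor <;> linarith
        simp [indicator, hx, hx1, h1.2]
      · simp [indicator, hx, hx1]
    · simp [indicator, hx]

/-- The one-dimensional description of the model. -/
theorem IsScaledModel.exists_jumpDensity [IsFiniteMeasure ρ] (hX : IsScaledModel X P ρ q)
    (hρ : 0 < ρ {negDir}) (hq : 0 < qZero q negDir) :
    ∃ δ M, JumpDensity (jumpDensity ρ q) (totalVar ρ q) δ M := by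
  obtain ⟨δ, M, hδ, hM⟩ := hX.exists_jumpDensity_bound
  have hρ' : 0 < ρ.real {negDir} := ENNReal.toReal_pos hρ.ne' (measure_ne_top _ _)
  refine ⟨δ, M, measurable_jumpDensity hX.measurable, hX.jumpDensity_nonneg, hδ, hM, ?_,
    hX.integrableOn_excess, ?_⟩
  · rw [hX.totalVar_eq]
    positivity
  · have h1 := (hX.tendsto_negDir hρ).eventually_const_le (half_lt_self hq)
    obtain ⟨r₀, hr₀, h2⟩ := mem_nhdsGT_iff_exists_Ioo_subset.1 h1
    refine ⟨r₀, hr₀, fun x hx => ?_⟩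
    have h3 : 0 < -x := by linarith [hx.2]
    have h4 : qZero q negDir / 2 ≤ q (-x) negDir := h2 ⟨h3, by linarith [hx.1]⟩
    rw [← neg_neg x, jumpDensity_neg h3, hX.totalVar_eq, mul_div_assoc]
    exact mul_le_mul_of_nonneg_left h4 hρ'.le

end Model

/-! ### Identification of `C(z, δ)` with the derivative of the cumulant. -/

section Coefficient

variable {ρ : Measure Sph} [IsFiniteMeasure ρ] {q : ℝ → Sph → ℝ} {δ M : ℝ}
  {Ω : Type*} [MeasurableSpace Ω] {P : Measure Ω} {X : ℝ → ℝ≥0 → Ω → ℝ}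

lemma rpow_neg_three {r : ℝ} (hr : 0 < r) : r ^ (-2 - 1 : ℝ) = (r ^ 3)⁻¹ := by
  rw [show (-2 - 1 : ℝ) = -((3 : ℕ) : ℝ) by norm_num, Real.rpow_neg hr.le, Real.rpow_natCast]

lemma indicator_abs_lt_one {r : ℝ} (hr : 0 < r) :
    {y : ℝ | |y| < 1}.indicator (fun y => y) r = (Ioo (0 : ℝ) 1).indicator (fun u => u) r := by
  by_cases h : r < 1 <;> simp [indicator, hr, abs_of_pos hr, h]

lemma indicator_abs_lt_one_neg {r : ℝ} (hr : 0 < r) :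
    {y : ℝ | |y| < 1}.indicator (fun y => y) (-r)
      = -(Ioo (0 : ℝ) 1).indicator (fun u => u) r := by
  by_cases h : r < 1 <;> simp [indicator, hr, abs_of_pos hr, h]

lemma IsScaledModel.temperingIntegrand_posDir (hX : IsScaledModel X P ρ q) (s : ℂ) {r : ℝ}
    (hr : 0 < r) : ρ.real {posDir} * temperingIntegrand q s posDir r = truncKernel s r
      * ((excess (jumpDensity ρ q) (totalVar ρ q) r * |r| ^ (-2 - 1 : ℝ) : ℝ) : ℂ) := by
  rw [hX.excess_of_pos hr, abs_of_pos hr, rpow_neg_three hr, truncKernel, indicator_abs_lt_one hr,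
    temperingIntegrand]
  simp only [posDir]
  push_cast
  rw [mul_one, mul_one]
  ring

lemma IsScaledModel.temperingIntegrand_negDir (hX : IsScaledModel X P ρ q) (s : ℂ) {r : ℝ}
    (hr : 0 < r) : ρ.real {negDir} * temperingIntegrand q s negDir r = truncKernel s (-r)
      * ((excess (jumpDensity ρ q) (totalVar ρ q) (-r) * |-r| ^ (-2 - 1 : ℝ) : ℝ) : ℂ) := by
  rw [hX.excess_neg hr, abs_neg, abs_of_pos hr, rpow_neg_three hr, truncKernel,
    indicator_abs_lt_one_neg hr, temperingIntegrand]
  simp only [negDir]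
  push_cast
  rw [show s * (r : ℂ) * -1 = s * -(r : ℂ) by ring]
  ring

lemma integrable_truncKernel_mul_excess {f : ℝ → ℝ} {S : ℝ} (h : JumpDensity f S δ M) {s : ℂ}
    (hs0 : 0 ≤ s.re) (hs1 : s.re ≤ 1) :
    Integrable (fun x => truncKernel s x * ((excess f S x * |x| ^ (-2 - 1 : ℝ) : ℝ) : ℂ)) :=
  h.integrable_mul_excess (by norm_num) le_rfl (measurable_truncKernel s) (by positivity)
    (norm_truncKernel_le h.one_lt.le hs0 (hs1.trans h.one_lt.le))

lemma IsScaledModel.integrable_temperingIntegrand (hX : IsScaledModel X P ρ q)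
    (h : JumpDensity (jumpDensity ρ q) (totalVar ρ q) δ M) {s : ℂ}
    (hs0 : 0 ≤ s.re) (hs1 : s.re ≤ 1) :
    Integrable (fun p : Sph × ℝ => temperingIntegrand q s p.1 p.2)
      (ρ.prod (volume.restrict (Ioi (0 : ℝ)))) := by
  have hint := integrable_truncKernel_mul_excess h hs0 hs1
  refine integrable_prod_sph fun ξ => ?_
  rcases eq_posDir_or_eq_negDir ξ with rfl | rfl
  · refine (hint.integrableOn (s := Ioi 0)).congr ?_
    filter_upwards [ae_restrict_mem measurableSet_Ioi] with r hr
    exact (hX.temperingIntegrand_posDir s hr).symm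
  · refine (hint.comp_neg.integrableOn (s := Ioi 0)).congr ?_
    filter_upwards [ae_restrict_mem measurableSet_Ioi] with r hr
    exact (hX.temperingIntegrand_negDir s hr).symm

lemma IsScaledModel.temperingIntegral_eq (hX : IsScaledModel X P ρ q)
    (h : JumpDensity (jumpDensity ρ q) (totalVar ρ q) δ M) {s : ℂ}
    (hs0 : 0 ≤ s.re) (hs1 : s.re ≤ 1) :
    temperingIntegral ρ q s = ∫ x, truncKernel s x
      * ((excess (jumpDensity ρ q) (totalVar ρ q) x * |x| ^ (-2 - 1 : ℝ) : ℝ) : ℂ) := by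
  rw [temperingIntegral, integral_sph,
    integral_eq_Ioi_add_Ioi_neg (integrable_truncKernel_mul_excess h hs0 hs1),
    Complex.real_smul, Complex.real_smul, ← integral_const_mul, ← integral_const_mul]
  congr 1
  · exact setIntegral_congr_fun measurableSet_Ioi fun r hr => hX.temperingIntegrand_posDir s hr
  · exact setIntegral_congr_fun measurableSet_Ioi fun r hr => hX.temperingIntegrand_negDir s hr

/-- The two tempering integrals combine under one sign, and `truncKernel s - s · truncKernel 1 =
martKernel s`. -/
lemma IsScaledModel.cumulantCoeff_eq (hX : IsScaledModel X P ρ q)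
    (h : JumpDensity (jumpDensity ρ q) (totalVar ρ q) δ M) (z : ℝ) {a : ℝ} (ha : a = 0 ∨ a = 1) :
    cumulantCoeff ρ q z a
      = excessCoeff (jumpDensity ρ q) (totalVar ρ q) (a + Complex.I * z) := by
  have ha' : 0 ≤ a ∧ a ≤ 1 := by rcases ha with rfl | rfl <;> norm_num
  have h0 : 0 ≤ ((a : ℂ) + Complex.I * z).re := by rw [re_add_I_mul]; exact ha'.1
  have h1 : ((a : ℂ) + Complex.I * z).re ≤ 1 := by rw [re_add_I_mul]; exact ha'.2
  simp only [cumulantCoeff, excessCoeff]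
  rw [hX.temperingIntegral_eq h h0 h1, hX.temperingIntegral_eq h (by simp) (by simp),
    add_sub_assoc, mul_comm (integral _ _) ((a : ℂ) + Complex.I * z),
    ← integral_const_mul,
    ← integral_sub (integrable_truncKernel_mul_excess h h0 h1)
    ((integrable_truncKernel_mul_excess h (by simp) (by simp)).const_mul _)]
  congr 1
  refine integral_congr_ae (.of_forall fun x => ?_)
  simp only
  rw [truncKernel_eq ((a : ℂ) + Complex.I * z)]
  ring

end Coefficient

/-! ### Conjugation symmetry. -/

section Conj

open scoped ComplexConjugate

lemma martKernel_conj (s : ℂ) (x : ℝ) : martKernel (conj s) x = conj (martKernel s x) := by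
  simp [martKernel, ← Complex.exp_conj]

/-- Every ingredient has real coefficients; the slit plane is needed only for the principal
logarithm to commute with conjugation. -/
lemma excessCoeff_conj (f : ℝ → ℝ) (S : ℝ) {s : ℂ} (hs : s ∈ Complex.slitPlane) :
    excessCoeff f S (conj s) = conj (excessCoeff f S s) := by
  have h : ∫ x, martKernel (conj s) x * ((excess f S x * |x| ^ (-2 - 1 : ℝ) : ℝ) : ℂ)
      = conj (∫ x, martKernel s x * ((excess f S x * |x| ^ (-2 - 1 : ℝ) : ℝ) : ℂ)) := by
    rw [← integral_conj]
    refine integral_congr_ae (.of_forall fun x => ?_)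
    simp only [map_mul, Complex.conj_ofReal, martKernel_conj]
  rw [excessCoeff, excessCoeff, h, Complex.log_conj _ (Complex.mem_slitPlane_iff_arg.1 hs).1]
  have h2 : conj (2 : ℂ) = 2 := Complex.conj_ofReal 2
  have h3 : conj (3 : ℂ) = 3 := Complex.conj_ofReal 3
  have h4 : conj (4 : ℂ) = 4 := Complex.conj_ofReal 4
  simp [h2, h3, h4]

/-- The integral of a function with `F (-z) = conj (F z)`. -/
lemma integral_eq_two_mul_integral_re {F : ℝ → ℂ} (hF : Integrable F)
    (h : ∀ z, 0 < z → F (-z) = conj (F z)) :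
    ∫ z, F z = ((2 * ∫ z in Ioi (0 : ℝ), (F z).re : ℝ) : ℂ) := by
  have h1 : IntegrableOn (fun z => F (-z)) (Ioi 0) := hF.comp_neg.integrableOn
  rw [integral_eq_Ioi_add_Ioi_neg hF, ← integral_add hF.integrableOn h1, ← integral_const_mul,
    ← integral_complex_ofReal]
  refine setIntegral_congr_fun measurableSet_Ioi fun z hz => ?_
  rw [h z hz, Complex.add_conj]

end Conj

/-! ### Laws of the log-prices in both models. -/

section Law

variable {ρ : Measure Sph} [IsFiniteMeasure ρ] {q : ℝ → Sph → ℝ} {δ M : ℝ}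
  {Ω : Type*} [MeasurableSpace Ω] {P : Measure Ω} {X : ℝ → ℝ≥0 → Ω → ℝ}

lemma martKernel_zero_left (x : ℝ) : martKernel 0 x = 0 := by simp [martKernel]

lemma martKernel_one_left (x : ℝ) : martKernel 1 x = 0 := by simp [martKernel]

/-- The exponential moments of the law of `X^α_t`. -/
lemma IsScaledModel.integral_cexp [IsProbabilityMeasure P] (hX : IsScaledModel X P ρ q)
    (h : JumpDensity (jumpDensity ρ q) (totalVar ρ q) δ M) {α : ℝ} (hα : α ∈ Ioo (3 / 2 : ℝ) 2)
    (t : ℝ≥0) :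
    Integrable (fun x => Real.exp (δ * x)) (P.map (X α t)) ∧
    ∀ s : ℂ, 0 ≤ s.re → s.re ≤ 1 → ∫ x : ℝ, Complex.exp (s * x) ∂(P.map (X α t))
      = Complex.exp (t * jumpCumulant (jumpDensity ρ q) α s) := by
  have hg := hX.gts α hα
  set ν := levyMeasure α ρ (scaledTempering q α) with hν
  have hν' := levyMeasure_scaledTempering ρ q α
  have hW : Integrable (jumpWeight δ) ν := by
    rw [hν, hν']
    exact h.integrable_jumpWeight_withDensity (by linarith [hα.1]) hα.2
  have hcum : ∀ s, ∫ x, martKernel s x ∂ν = jumpCumulant (jumpDensity ρ q) α s := fun s => by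
    rw [hν, hν', h.integral_withDensity hα.2, jumpCumulant]
  have hδ := h.one_lt
  have hψ : Continuous (fun z : ℝ => ∫ x, martKernel (Complex.I * z) x ∂ν) := by
    refine (continuousOn_integral_martKernel hδ.le hW).comp_continuous (by fun_prop) fun z => ?_
    simp only [mem_ofPred_eq]
    have : (Complex.I * z).re = 0 := by simp
    rw [this]
    constructor <;> linarith
  have h1 : ∀ z, charFun (P.map (X α 1)) z
      = Complex.exp (∫ x, martKernel (Complex.I * z) x ∂ν) := by
    intro z
    rw [hg.triplet.charFun_one z, ← integral_martKernel_eq_exponent hδ.le hW]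
    simp only [truncKernel]
    simp
    rfl
  have ht := hg.levy.charFun_eq hψ (by simp [martKernel_zero_left]) h1 t
  have := Measure.isProbabilityMeasure_map (μ := P) (hg.levy.measurable t).aemeasurable
  -- The law at time `t` is infinitely divisible with Lévy measure `t • ν`, to which the moment
  -- theorem applies directly.
  have hmul : ∀ s, ∫ x, martKernel s x ∂(t • ν) = t * ∫ x, martKernel s x ∂ν := fun s => by
    rw [integral_smul_nnreal_measure, NNReal.smul_def, Complex.real_smul]
  obtain ⟨h2, h3⟩ := integral_exp_eq_of_charFun_eq (μ := P.map (X α t)) (ν := t • ν) hδ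
    hW.smul_measure_nnreal (fun z => by rw [ht z, hmul])
  refine ⟨h2, fun s hs0 hs1 => ?_⟩
  rw [h3 s hs0 hs1, hmul, hcum]

lemma integrable_exp_of_integrable_exp_mul {μ : Measure ℝ} [IsFiniteMeasure μ] (hδ : 1 ≤ δ)
    (h : Integrable (fun x => Real.exp (δ * x)) μ) : Integrable Real.exp μ := by
  refine ((integrable_const (1 : ℝ)).add h).mono' (by fun_prop) (.of_forall fun x => ?_)
  rw [Real.norm_eq_abs, abs_of_pos (Real.exp_pos x)]
  simpa using exp_mul_le_one_add_exp zero_le_one hδ x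

variable {Ω' : Type*} [MeasurableSpace Ω'] {P' : Measure Ω'} {B : ℝ≥0 → Ω' → ℝ}

lemma aemeasurable_bsLogPrice (hB : IsBrownianReal B P') (v : ℝ) (t : ℝ≥0) :
    AEMeasurable (bsLogPrice v B t) P' :=
  ((hB.toIsPreBrownianReal.hasLaw_eval t).aemeasurable.const_mul _).const_add _

lemma map_bsLogPrice (hB : IsBrownianReal B P') {v : ℝ} {t w : ℝ≥0} (hv : 0 ≤ v)
    (hw : (w : ℝ) = v * t) :
    P'.map (bsLogPrice v B t) = gaussianReal (-(w / 2)) w := by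
  have hl := hB.toIsPreBrownianReal.hasLaw_eval t
  have h1 : bsLogPrice v B t = (fun x => -(v / 2) * t + x) ∘ (fun x => √v * x) ∘ B t := rfl
  have hm : AEMeasurable ((fun x => √v * x) ∘ B t) P' := hl.aemeasurable.const_mul _
  rw [h1, ← AEMeasurable.map_map_of_aemeasurable (by fun_prop) hm,
    ← AEMeasurable.map_map_of_aemeasurable (by fun_prop) hl.aemeasurable, hl.map_eq,
    gaussianReal_map_const_mul, gaussianReal_map_const_add]
  congr 1
  · rw [hw]; ring
  · ext
    simp [Real.sq_sqrt hv, hw]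

lemma charFunC_of_map_eq {Y : Ω' → ℝ} {S t : ℝ} {w : ℝ≥0} (hw : (w : ℝ) = S * t)
    (hY : P'.map Y = gaussianReal (-(w / 2)) w) (u : ℂ) : charFunC P' Y u
      = Complex.exp (t * (S * (1 / 2 * ((Complex.I * u) ^ 2 - Complex.I * u)))) := by
  have hw' : (w : ℂ) = S * t := by exact_mod_cast congrArg (fun x : ℝ => (x : ℂ)) hw
  rw [charFunC, complexMGF_gaussianReal hY]
  congr 1
  push_cast
  rw [hw']
  ring

end Law

/-! ### From difference quotients to little-o statements. -/

section LittleO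

lemma isLittleO_of_tendsto_div {D : ℝ → ℂ} {c : ℂ}
    (h : Tendsto (fun α : ℝ => D α / ((2 - α : ℝ) : ℂ)) (𝓝[<] 2) (𝓝 c)) :
    (fun α => D α - ((2 - α : ℝ) : ℂ) * c) =o[𝓝[<] 2] (fun α : ℝ => 2 - α) := by
  have hne : ∀ᶠ α in 𝓝[<] (2 : ℝ), ((2 - α : ℝ) : ℂ) ≠ 0 := by
    filter_upwards [self_mem_nhdsWithin] with α hα
    have hα : α < 2 := hα
    exact_mod_cast (by linarith : (2 - α) ≠ 0)
  have h1 : (fun α => D α - ((2 - α : ℝ) : ℂ) * c) =o[𝓝[<] 2]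
      (fun α : ℝ => ((2 - α : ℝ) : ℂ)) := by
    rw [Asymptotics.isLittleO_iff_tendsto' (hne.mono fun α h h' => absurd h' h)]
    have h2 := h.sub_const c
    rw [sub_self] at h2
    refine h2.congr' ?_
    filter_upwards [hne] with α hα
    field_simp
  refine Asymptotics.IsLittleO.of_norm_right ?_
  refine h1.norm_right.congr_right fun α => ?_
  rw [Complex.norm_real]

end LittleO

/-! ### Bounds on the payoff multipliers. -/

section Multipliers

lemma norm_cexp_neg_I_mul (z k : ℝ) : ‖Complex.exp (-Complex.I * z * k)‖ = 1 := by
  rw [Complex.norm_exp]; simp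

lemma norm_inv_I_mul (z : ℝ) : ‖(Complex.I * z)⁻¹‖ = |z|⁻¹ := by simp

lemma norm_inv_one_add_I_mul_le (z : ℝ) : ‖(1 + Complex.I * z)⁻¹‖ ≤ 1 := by
  rw [norm_inv]
  refine inv_le_one_of_one_le₀ ?_
  have := Complex.abs_re_le_norm (1 + Complex.I * z)
  simpa using this

lemma norm_digital_multiplier (k z : ℝ) :
    ‖Complex.exp (-Complex.I * z * k) * (Complex.I * z)⁻¹‖ = |z|⁻¹ := by
  rw [norm_mul, norm_cexp_neg_I_mul, one_mul, norm_inv_I_mul]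

lemma norm_call_multiplier_le (k z : ℝ) :
    ‖Complex.exp (-Complex.I * z * k) * (-(z : ℂ) ^ 2 + Complex.I * z)⁻¹‖ ≤ |z|⁻¹ := by
  rw [norm_mul, norm_cexp_neg_I_mul, one_mul, neg_sq_add_I_mul, mul_inv, norm_mul, norm_inv_I_mul]
  exact mul_le_of_le_one_right (by positivity) (norm_inv_one_add_I_mul_le z)

end Multipliers

/-! ### The Black–Scholes exponent on the two lines. -/

section BrownianLine

/-- The exponent of the Black–Scholes model on the line `Re s = a`. -/
noncomputable def bsExponent (S t a z : ℝ) : ℂ :=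
  t * (S * (1 / 2 * ((a + Complex.I * z) ^ 2 - (a + Complex.I * z))))

variable {S t a : ℝ}

/-- The term `a² - a` vanishes exactly at `a = 0` and `a = 1`, so both lines show the same Gaussian
decay. -/
lemma re_bsExponent (ha : a = 0 ∨ a = 1) (z : ℝ) :
    (bsExponent S t a z).re = t * S * (-(z ^ 2) / 2) := by
  have h : bsExponent S t a z = ((t * S * ((a ^ 2 - a - z ^ 2) / 2) : ℝ) : ℂ)
      + ((t * S * ((2 * a - 1) * z / 2) : ℝ) : ℂ) * Complex.I := by
    rw [bsExponent]
    push_cast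
    linear_combination (t : ℂ) * S * z ^ 2 / 2 * Complex.I_sq
  rw [h, Complex.add_re, Complex.ofReal_re, Complex.re_ofReal_mul, Complex.I_re]
  rcases ha with rfl | rfl <;> ring

lemma integrable_cexp_bsExponent (hS : 0 < S) (ht : 0 < t) (ha : a = 0 ∨ a = 1) :
    Integrable (fun z => Complex.exp (bsExponent S t a z)) := by
  -- The value `1/2` comes from `(|z| - 1)² ≥ 0`, that is, `-z²/2 ≤ 1/2 - |z|`.
  refine integrable_cexp_of_re_le (c := t * S) (R := 1 / 2) ?_ (by positivity) fun z _ => ?_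
  · unfold bsExponent
    exact Continuous.aestronglyMeasurable (by fun_prop)
  · rw [re_bsExponent ha]
    refine mul_le_mul_of_nonneg_left ?_ (by positivity)
    nlinarith [sq_nonneg (|z| - 1), sq_abs z]

lemma charFun_gaussianReal_eq_bsExponent {w : ℝ≥0} (hw : (w : ℝ) = S * t) (z : ℝ) :
    charFun (gaussianReal (-(w / 2)) w) z = Complex.exp (bsExponent S t 0 z) := by
  have hw' : (w : ℂ) = S * t := by exact_mod_cast congrArg (fun x : ℝ => (x : ℂ)) hw
  rw [charFun_gaussianReal, bsExponent]
  congr 1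
  push_cast
  rw [hw']
  linear_combination -((t : ℂ) * S * z ^ 2 / 2 * Complex.I_sq)

lemma charFun_esscher_gaussianReal {w : ℝ≥0} (hw : (w : ℝ) = S * t) (z : ℝ) :
    charFun (esscher (gaussianReal (-(w / 2)) w)) z = Complex.exp (bsExponent S t 1 z) := by
  have hw' : (w : ℂ) = S * t := by exact_mod_cast congrArg (fun x : ℝ => (x : ℂ)) hw
  rw [esscher_gaussianReal, charFun_gaussianReal, bsExponent]
  congr 1
  push_cast
  rw [hw']
  linear_combination -((t : ℂ) * S * z ^ 2 / 2 * Complex.I_sq)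

end BrownianLine

/-! ### Expansion of the price differences. -/

section Prices

variable {ρ : Measure Sph} {q : ℝ → Sph → ℝ} {δ M : ℝ} {Ω Ω' : Type*} [MeasurableSpace Ω]
  [MeasurableSpace Ω'] {P : Measure Ω} {P' : Measure Ω'} {X : ℝ → ℝ≥0 → Ω → ℝ} {Y : Ω' → ℝ}
  {t w : ℝ≥0}

/-- The integrand of the first order coefficients, without the multiplier of the payoff. -/
noncomputable def coeffIntegrand (ρ : Measure Sph) (q : ℝ → Sph → ℝ) (t a z : ℝ) : ℂ :=
  Complex.exp (bsExponent (totalVar ρ q) t a z)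
    * (t * excessCoeff (jumpDensity ρ q) (totalVar ρ q) (a + Complex.I * z))

lemma IsScaledModel.isProbabilityMeasure_map [IsProbabilityMeasure P] (hX : IsScaledModel X P ρ q)
    {α : ℝ} (hα : α ∈ Ioo (3 / 2 : ℝ) 2) (t : ℝ≥0) : IsProbabilityMeasure (P.map (X α t)) :=
  Measure.isProbabilityMeasure_map ((hX.gts α hα).levy.measurable t).aemeasurable

lemma digitalPrice_eq (hY : AEMeasurable Y P') {K : ℝ} (hK : 0 < K) :
    digitalPrice P' Y K = (P'.map Y).real (Ici (Real.log K)) := by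
  rw [digitalPrice, Measure.real, Measure.real, Measure.map_apply_of_aemeasurable hY
    measurableSet_Ici]
  congr 2
  ext ω
  simp [Real.log_le_iff_le_exp hK]

lemma callPrice_eq (hY : AEMeasurable Y P') (K : ℝ) :
    callPrice P' Y K = ∫ x, max (Real.exp x - K) 0 ∂(P'.map Y) := by
  rw [callPrice, integral_map hY (Continuous.aestronglyMeasurable (by fun_prop))]

variable [IsFiniteMeasure ρ]

lemma IsScaledModel.callIntegrand_eq (hX : IsScaledModel X P ρ q)
    (h : JumpDensity (jumpDensity ρ q) (totalVar ρ q) δ M) (hw : (w : ℝ) = totalVar ρ q * t)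
    (hY : P'.map Y = gaussianReal (-(w / 2)) w) (K z : ℝ) :
    callIntegrand ρ q (charFunC P' Y) t K z = Complex.exp (-Complex.I * z * Real.log K)
      * (-(z : ℂ) ^ 2 + Complex.I * z)⁻¹ * coeffIntegrand ρ q t 1 z := by
  have e : Complex.I * ((z : ℂ) - Complex.I) = (1 : ℝ) + Complex.I * z := by
    push_cast
    linear_combination -Complex.I_sq
  rw [callIntegrand, charFunC_of_map_eq hw hY, hX.cumulantCoeff_eq h z (Or.inr rfl), e,
    coeffIntegrand, bsExponent]
  ring

lemma IsScaledModel.digitalIntegrand_eq (hX : IsScaledModel X P ρ q)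
    (h : JumpDensity (jumpDensity ρ q) (totalVar ρ q) δ M) (hw : (w : ℝ) = totalVar ρ q * t)
    (hY : P'.map Y = gaussianReal (-(w / 2)) w) (K z : ℝ) :
    digitalIntegrand ρ q (charFunC P' Y) t K z = (Complex.exp (-Complex.I * z * Real.log K)
      * (Complex.I * z)⁻¹ * coeffIntegrand ρ q t 0 z).re := by
  have e : Complex.I * (z : ℂ) = (0 : ℝ) + Complex.I * z := by simp
  rw [digitalIntegrand, charFunC_of_map_eq hw hY, hX.cumulantCoeff_eq h z (Or.inl rfl),
    coeffIntegrand, bsExponent, ← e]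
  congr 1
  ring

variable [IsProbabilityMeasure P]

lemma IsScaledModel.charFun_map (hX : IsScaledModel X P ρ q)
    (h : JumpDensity (jumpDensity ρ q) (totalVar ρ q) δ M) {α : ℝ} (hα : α ∈ Ioo (3 / 2 : ℝ) 2)
    (z : ℝ) : charFun (P.map (X α t)) z
      = Complex.exp ((t : ℝ) * jumpCumulant (jumpDensity ρ q) α ((0 : ℝ) + Complex.I * z)) := by
  have h1 := (hX.integral_cexp h hα t).2 ((0 : ℝ) + Complex.I * z) (by simp) (by simp)
  rw [← h1, charFun_apply_real]
  refine integral_congr_ae (.of_forall fun x => ?_)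
  simp only
  congr 1
  push_cast
  ring

lemma IsScaledModel.charFun_esscher_map (hX : IsScaledModel X P ρ q)
    (h : JumpDensity (jumpDensity ρ q) (totalVar ρ q) δ M) {α : ℝ} (hα : α ∈ Ioo (3 / 2 : ℝ) 2)
    (z : ℝ) : charFun (esscher (P.map (X α t))) z
      = Complex.exp ((t : ℝ) * jumpCumulant (jumpDensity ρ q) α ((1 : ℝ) + Complex.I * z)) := by
  have h1 := (hX.integral_cexp h hα t).2 ((1 : ℝ) + Complex.I * z) (by simp) (by simp)
  rw [charFun_esscher, ← h1]
  simp

lemma IsScaledModel.integrable_exp (hX : IsScaledModel X P ρ q)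
    (h : JumpDensity (jumpDensity ρ q) (totalVar ρ q) δ M) {α : ℝ} (hα : α ∈ Ioo (3 / 2 : ℝ) 2)
    (t : ℝ≥0) : Integrable Real.exp (P.map (X α t)) :=
  have := hX.isProbabilityMeasure_map hα t
  integrable_exp_of_integrable_exp_mul h.one_lt.le (hX.integral_cexp h hα t).1

/-- The price `e^{X^α}` is a martingale. -/
lemma IsScaledModel.integral_exp_eq_one (hX : IsScaledModel X P ρ q)
    (h : JumpDensity (jumpDensity ρ q) (totalVar ρ q) δ M) {α : ℝ} (hα : α ∈ Ioo (3 / 2 : ℝ) 2)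
    (t : ℝ≥0) : ∫ x, Real.exp x ∂(P.map (X α t)) = 1 := by
  have h1 := (hX.integral_cexp h hα t).2 1 (by simp) (by simp)
  have h2 : jumpCumulant (jumpDensity ρ q) α 1 = 0 := by
    simp [jumpCumulant, martKernel_one_left]
  rw [h2, mul_zero, Complex.exp_zero] at h1
  have h3 : ((∫ x, Real.exp x ∂(P.map (X α t)) : ℝ) : ℂ) = 1 := by
    rw [← integral_complex_ofReal, ← h1]
    refine integral_congr_ae (.of_forall fun x => ?_)
    simp
  exact_mod_cast h3

lemma eventually_mem_Ioo_nhdsLT_two : ∀ᶠ α in 𝓝[<] (2 : ℝ), α ∈ Ioo (3 / 2 : ℝ) 2 :=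
  Ioo_mem_nhdsLT (by norm_num)

lemma IsScaledModel.tendsto_digital (hX : IsScaledModel X P ρ q)
    (h : JumpDensity (jumpDensity ρ q) (totalVar ρ q) δ M) (ht : 0 < t)
    (hw : (w : ℝ) = totalVar ρ q * t) (k : ℝ) :
    Tendsto (fun α : ℝ => (((P.map (X α t)).real (Ici k)
        - (gaussianReal (-(w / 2)) w).real (Ici k) : ℝ) : ℂ) / ((2 - α : ℝ) : ℂ)) (𝓝[<] 2)
      (𝓝 (1 / (2 * Real.pi) * ∫ z : ℝ, Complex.exp (-Complex.I * z * k) * (Complex.I * z)⁻¹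
        * coeffIntegrand ρ q t 0 z)) := by
  have ht' : 0 < (t : ℝ) := ht
  have hmeas : ∀ k : ℝ, AEStronglyMeasurable
      (fun z : ℝ => Complex.exp (-Complex.I * z * k) * (Complex.I * z)⁻¹) volume := fun k =>
    Measurable.aestronglyMeasurable (by fun_prop)
  obtain ⟨-, -, h1⟩ := h.expansion (a := 0) (Or.inl rfl) ht' (hmeas k)
    (fun z _ => (norm_digital_multiplier k z).le)
  -- A second use with trivial phase `k = 0`: it supplies integrability of the bare quotient by
  -- `iz`, which the inversion formula requires.
  obtain ⟨-, h2, -⟩ := h.expansion (a := 0) (Or.inl rfl) ht' (hmeas 0)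
    (fun z _ => (norm_digital_multiplier 0 z).le)
  refine (h1.const_mul (1 / (2 * Real.pi) : ℂ)).congr' ?_
  filter_upwards [h2, eventually_mem_Ioo_nhdsLT_two] with α h3 hα
  have := hX.isProbabilityMeasure_map hα t
  have e1 := hX.charFun_map (t := t) h hα
  have e2 := charFun_gaussianReal_eq_bsExponent hw
  have i1 : Integrable (charFun (P.map (X α t))) := by
    simp_rw [funext e1]
    exact h.integrable_cexp_jumpCumulant (Or.inl rfl) ht' hα
  have i2 : Integrable (charFun (gaussianReal (-(w / 2 : ℝ)) w)) := by
    simp_rw [funext e2]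
    exact integrable_cexp_bsExponent h.pos ht' (Or.inl rfl)
  rw [measureReal_Ici_sub_eq_integral i1 i2, ← mul_div_assoc]
  · congr 2
    refine integral_congr_ae (.of_forall fun z => ?_)
    simp only [e1, e2, bsExponent]
    ring
  · refine h3.congr (.of_forall fun z => ?_)
    simp only [e1, e2, bsExponent, Complex.ofReal_zero, mul_zero, Complex.exp_zero, one_mul]
    ring

lemma IsScaledModel.tendsto_call (hX : IsScaledModel X P ρ q)
    (h : JumpDensity (jumpDensity ρ q) (totalVar ρ q) δ M) (ht : 0 < t)
    (hw : (w : ℝ) = totalVar ρ q * t) {K : ℝ} (hK : 0 < K) :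
    Tendsto (fun α : ℝ => ((∫ x, max (Real.exp x - K) 0 ∂(P.map (X α t))
        - ∫ x, max (Real.exp x - K) 0 ∂(gaussianReal (-(w / 2)) w) : ℝ) : ℂ)
        / ((2 - α : ℝ) : ℂ)) (𝓝[<] 2)
      (𝓝 (1 / (2 * Real.pi) * ∫ z : ℝ, Complex.exp (-Complex.I * z * Real.log K)
        * (-(z : ℂ) ^ 2 + Complex.I * z)⁻¹ * coeffIntegrand ρ q t 1 z)) := by
  have ht' : 0 < (t : ℝ) := ht
  obtain ⟨-, -, h1⟩ := h.expansion (a := 1) (Or.inr rfl) ht'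
    (m := fun z : ℝ => Complex.exp (-Complex.I * z * Real.log K)
        * (-(z : ℂ) ^ 2 + Complex.I * z)⁻¹) (Measurable.aestronglyMeasurable (by fun_prop))
    (fun z _ => norm_call_multiplier_le _ z)
  -- The call representation is derived from tails of the tilted laws, so it needs integrability
  -- with the weaker multiplier `1/(iz)` as well.
  obtain ⟨-, h2, -⟩ := h.expansion (a := 1) (Or.inr rfl) ht'
    (m := fun z : ℝ => (Complex.I * z)⁻¹) (Measurable.aestronglyMeasurable (by fun_prop))
    (fun z _ => (norm_inv_I_mul z).le)
  refine (h1.const_mul (1 / (2 * Real.pi) : ℂ)).congr' ?_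
  filter_upwards [h2, eventually_mem_Ioo_nhdsLT_two] with α h3 hα
  have := hX.isProbabilityMeasure_map hα t
  have := isProbabilityMeasure_esscher (hX.integrable_exp h hα t) (hX.integral_exp_eq_one h hα t)
  have : IsProbabilityMeasure (esscher (gaussianReal (-(w / 2 : ℝ)) w)) := by
    rw [esscher_gaussianReal]; infer_instance
  have e1 := hX.charFun_esscher_map (t := t) h hα
  have e2 := charFun_esscher_gaussianReal hw
  have i1 : Integrable (charFun (esscher (P.map (X α t)))) := by
    simp_rw [funext e1]
    exact h.integrable_cexp_jumpCumulant (Or.inr rfl) ht' hα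
  have i2 : Integrable (charFun (esscher (gaussianReal (-(w / 2 : ℝ)) w))) := by
    simp_rw [funext e2]
    exact integrable_cexp_bsExponent h.pos ht' (Or.inr rfl)
  rw [integral_call_sub_eq i1 i2 ?_ hK, ← mul_div_assoc]
  · congr 2
    refine integral_congr_ae (.of_forall fun z => ?_)
    simp only [e1, e2, bsExponent]
    ring
  · refine h3.congr (.of_forall fun z => ?_)
    simp only [e1, e2, bsExponent]
    ring

open scoped ComplexConjugate in
lemma digital_coeffIntegrand_neg (ρ : Measure Sph) (q : ℝ → Sph → ℝ) (t k : ℝ) {z : ℝ}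
    (hz : 0 < z) : Complex.exp (-Complex.I * (-z : ℝ) * k) * (Complex.I * (-z : ℝ))⁻¹
        * coeffIntegrand ρ q t 0 (-z)
      = conj (Complex.exp (-Complex.I * z * k) * (Complex.I * z)⁻¹ * coeffIntegrand ρ q t 0 z) := by
  have e : ((0 : ℝ) : ℂ) + Complex.I * (-z : ℝ) = conj (((0 : ℝ) : ℂ) + Complex.I * z) := by
    simp
  have hs : ((0 : ℝ) : ℂ) + Complex.I * z ∈ Complex.slitPlane :=
    mem_slitPlane_of_re_nonneg (by simp) (fun h0 => hz.ne' (by simpa using congrArg Complex.im h0))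
  have h2 : conj (2 : ℂ) = 2 := Complex.conj_ofReal 2
  rw [coeffIntegrand, coeffIntegrand, bsExponent, bsExponent, e, excessCoeff_conj _ _ hs]
  simp [← Complex.exp_conj, h2]

end Prices

end GTS

/-! ### Assembly of the two expansions. -/

theorem theorem4p2 {Ω Ω' : Type*} [MeasurableSpace Ω] [MeasurableSpace Ω']
    (P : Measure Ω) [IsProbabilityMeasure P] (P' : Measure Ω') [IsProbabilityMeasure P']
    (ρ : Measure GTS.Sph) [IsFiniteMeasure ρ] (q : ℝ → GTS.Sph → ℝ)
    (X : ℝ → ℝ≥0 → Ω → ℝ) (hX : GTS.IsScaledModel X P ρ q)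
    (hρ : 0 < ρ {GTS.negDir}) (hq : 0 < GTS.qZero q GTS.negDir)
    (B : ℝ≥0 → Ω' → ℝ) (hB : IsBrownianReal B P')
    (t : ℝ≥0) (ht : 0 < t) (K : ℝ) (hK : 0 < K) :
    let v : ℝ := GTS.totalVar ρ q
    let Y : Ω' → ℝ := GTS.bsLogPrice v B t
    let g : ℂ → ℂ := GTS.charFunC P' Y
    -- the prices and the coefficients are given by convergent integrals
    (∀ α ∈ Ioo (3 / 2 : ℝ) 2, Integrable (fun ω => max (Real.exp (X α t ω) - K) 0) P) ∧
    (∀ s : ℂ, 0 ≤ s.re → s.re ≤ 1 →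
      Integrable (fun p : GTS.Sph × ℝ => GTS.temperingIntegrand q s p.1 p.2)
        (ρ.prod (volume.restrict (Ioi (0 : ℝ))))) ∧
    Integrable (GTS.callIntegrand ρ q g t K) ∧
    IntegrableOn (GTS.digitalIntegrand ρ q g t K) (Ioi (0 : ℝ)) ∧
    -- the expansion of the call price
    (fun α : ℝ => ((GTS.callPrice P (X α t) K - GTS.bsCall t K (√v) : ℝ) : ℂ)
        - ((2 - α : ℝ) : ℂ) * GTS.callCoeff ρ q g t K) =o[𝓝[<] 2] (fun α : ℝ => 2 - α) ∧
    -- the expansion of the digital price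
    (fun α : ℝ => GTS.digitalPrice P (X α t) K - GTS.digitalPrice P' Y K
        - (2 - α) * GTS.digitalCoeff ρ q g t K) =o[𝓝[<] 2] (fun α : ℝ => 2 - α) := by
  intro v Y g
  obtain ⟨δ, M, h⟩ := hX.exists_jumpDensity hρ hq
  have ht' : 0 < (t : ℝ) := ht
  have hv : 0 < v := h.pos
  -- The variance of the Gaussian log-price at time `t`; its mean is `-w/2`.
  set w : ℝ≥0 := ⟨v * t, by positivity⟩ with hwdef
  have hw : (w : ℝ) = v * t := rfl
  have hw0 : w ≠ 0 := fun h0 => by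
    have : v * t = 0 := by rw [← hw, h0]; rfl
    exact (mul_pos hv ht').ne' this
  have hYm : AEMeasurable Y P' := GTS.aemeasurable_bsLogPrice hB v t
  have hY : P'.map Y = gaussianReal (-(w / 2)) w := GTS.map_bsLogPrice hB hv.le hw
  have hXm : ∀ α ∈ Ioo (3 / 2 : ℝ) 2, AEMeasurable (X α t) P := fun α hα =>
    ((hX.gts α hα).levy.measurable t).aemeasurable
  have hcall : GTS.callIntegrand ρ q g t K = _ :=
    funext fun z => hX.callIntegrand_eq h hw hY K z
  have hdig : GTS.digitalIntegrand ρ q g t K = _ :=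
    funext fun z => hX.digitalIntegrand_eq h hw hY K z
  have hdigInt : Integrable (fun z : ℝ => Complex.exp (-Complex.I * z * Real.log K)
      * (Complex.I * z)⁻¹ * GTS.coeffIntegrand ρ q t 0 z) := (h.expansion (a := 0) (Or.inl rfl) ht'
    (m := fun z : ℝ => Complex.exp (-Complex.I * z * Real.log K) * (Complex.I * z)⁻¹)
    (Measurable.aestronglyMeasurable (by fun_prop))
    (fun z _ => (GTS.norm_digital_multiplier _ z).le)).1
  refine ⟨fun α hα => ?_, fun s hs0 hs1 => hX.integrable_temperingIntegrand h hs0 hs1, ?_, ?_,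
    ?_, ?_⟩
  · have h1 := (integrable_map_measure (by fun_prop) (hXm α hα)).1 (hX.integrable_exp h hα t)
    exact (h1.sub (integrable_const K)).pos_part
  · rw [hcall]
    exact (h.expansion (a := 1) (Or.inr rfl) ht'
      (m := fun z : ℝ => Complex.exp (-Complex.I * z * Real.log K)
        * (-(z : ℂ) ^ 2 + Complex.I * z)⁻¹) (Measurable.aestronglyMeasurable (by fun_prop))
      (fun z _ => GTS.norm_call_multiplier_le _ z)).1
  · rw [hdig]
    exact hdigInt.re.integrableOn
  · refine (GTS.isLittleO_of_tendsto_div (hX.tendsto_call h ht hw hK)).congr' ?_ EventuallyEq.rfl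
    filter_upwards [GTS.eventually_mem_Ioo_nhdsLT_two] with α hα
    rw [GTS.callPrice_eq (hXm α hα), GTS.callCoeff, hcall,
      GTS.integral_call_gaussianReal hw0 (t := t) hK (Real.sqrt_pos.2 hv)
        (by rw [Real.sq_sqrt hv.le, hw])]
  · have h1 := GTS.isLittleO_of_tendsto_div (hX.tendsto_digital h ht hw (Real.log K))
    -- The integrand takes conjugate values at `z` and `-z`, so the integral over the line is twice
    -- the integral of the real part over the half-line; hence the prefactor `1/π` and a real
    -- coefficient.
    have h2 : (1 / (2 * Real.pi) * ∫ z : ℝ, Complex.exp (-Complex.I * z * Real.log K)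
        * (Complex.I * z)⁻¹ * GTS.coeffIntegrand ρ q t 0 z : ℂ)
        = (GTS.digitalCoeff ρ q g t K : ℂ) := by
      rw [GTS.integral_eq_two_mul_integral_re hdigInt
        (fun z hz => GTS.digital_coeffIntegrand_neg ρ q t _ hz), GTS.digitalCoeff, hdig]
      generalize integral (G := ℝ) (volume.restrict (Ioi (0 : ℝ))) _ = J
      push_cast
      field_simp
    rw [h2] at h1
    refine Asymptotics.IsLittleO.of_norm_left ((h1.norm_left).congr' ?_ EventuallyEq.rfl)
    filter_upwards [GTS.eventually_mem_Ioo_nhdsLT_two] with α hα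
    rw [GTS.digitalPrice_eq (hXm α hα) hK, GTS.digitalPrice_eq hYm hK, hY, ← Complex.norm_real]
    push_cast
    rfl
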